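/- Let $M$ be a Hausdorff smooth ($C^\infty$) Banach manifold without boundary and let $\pi\colon E\to M$ be a smooth vector bundle whose typical fibre is a Banach space. Let $\pi^*E=\{(a,b)\in E\times E:\pi(a)=\pi(b)\}$, regarded as a vector bundle over $E$ by $(a,b)\mapsto a$, and let $\xi(a,b)=\frac{d}{ds}(a+sb)\big|_{s=0}\in T_aE$ be the vertical lift; it identifies $\pi^*E$ with $\operatorname{Ver}\pi=\operatorname{Ker}T\pi$, and the vertical projection $\nu_\pi\colon\operatorname{Ver}\pi\to E$ is given by $\nu_\pi(\xi(a,b))=b$. For a map $\phi$ from (an open subset of) $E$ to $E$ that maps fibres to fibres put $\mathcal F\phi(a,b)=\bigl(\phi(a),\nu_\pi(T\phi(\xi(a,b)))\bigr)$, so that $\xi\circ\mathcal F\phi=T\phi\circ\xi$. The map $T\pi\colon TE\to TM$ is a vector bundle whose operations $+_\tau$, $\cdot_\tau$ are the differentials of the operations of $\pi$; its vertical lift is $\xi_{T\pi}(v,w)=\frac{d}{ds}(v+_\tau s\cdot_\tau w)\big|_{s=0}\in T(TE)$, for $v,w\in TE$ with $T\pi(v)=T\pi(w)$. Such pairs $(v,w)$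 are identified with the tangent vectors to $\pi^*E$. A vector field $Y$ on $E$ (all vector fields are smooth) is projectable if $T\pi\circ Y=X\circ\pi$ for some vector field $X$ on $M$. Its fibre derivative is the vector field $\mathcal FY$ on $\pi^*E$ determined by $\xi_{T\pi}(\mathcal FY(z))=TY(\xi(z))$ for all $z\in\pi^*E$. A vector field $Z$ on the total space of a vector bundle $\tau\colon W\to N$ is linear, over a vector field $X$ on $N$, if it is a vector bundle morphism over $X$ from $\tau\colon W\to N$ to $T\tau\colon TW\to TN$. The derivation of sections of $W$ associated with $Z$ is $$(\mathcal D\eta)(p)=\lim_{s\to0}\frac{\Phi_{-s}\bigl(\eta(\varphi_s(p))\bigr)-\eta(p)}{s},$$ where $\Phi_s$ and $\varphi_s$ are the local flows of $Z$ and of $X$. Let $\operatorname{Sec}_\pi(E)$ be the set of smooth maps $\sigma\colon E\to E$ with $\pi\circ\sigma=\pi$ (equivalently, of sections of $\pi^*E\to E$), and for such $\sigma$ let $\sigma^V(a)=\xi(a,\sigma(a))$, a vector field on $E$. **Proposition 6.1.** Let $Y$ be a projectable vector field on $E$. 1. The equation $\xi_{T\pi}(\mathcal FY(z))=TY(\xi(z))$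 has exactly one solution for every $z\in\pi^*E$, and $\mathcal FY$ is a (smooth) linear vector field on $\pi^*E\to E$ over $Y$. 2. If $\{\phi_s\}$ is a smooth local flow of $Y$, with domain $D\subseteq\mathbb R\times E$, then $\xi\circ\mathcal F\phi_s=T\phi_s\circ\xi$ wherever $\phi_s$ is defined, and $\{\mathcal F\phi_s\}$ is a smooth local flow of $\mathcal FY$ with domain $\{(s,(a,b)):(s,a)\in D\}$. If $\{\phi_s\}$ is the maximal local flow of $Y$, then $\{\mathcal F\phi_s\}$ is the maximal local flow of $\mathcal FY$. 3. For every $\sigma\in\operatorname{Sec}_\pi(E)$ the limit that defines $\mathcal D^Y\sigma$, where $\mathcal D^Y$ is the derivation associated with $\mathcal FY$, exists at every point; the vector field $[Y,\sigma^V]$ is vertical and $\mathcal D^Y\sigma=\nu_\pi([Y,\sigma^V])$. Moreover $\mathcal D^Y$ maps $\operatorname{Sec}_\pi(E)$ to itself, is additive, and $\mathcal D^Y(f\sigma)=f\,\mathcal D^Y\sigma+(Yf)\,\sigma$ for $f\in C^\infty(E)$. If $Y'$ is another projectable vector field on $E$, then $[Y,Y']$ is projectable and 4. $[\mathcal FY,\mathcal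 FY']=\mathcal F[Y,Y']$; 5. $[\mathcal D^Y,\mathcal D^{Y'}]=\mathcal D^{[Y,Y']}$ on $\operatorname{Sec}_\pi(E)$. -/

import Mathlib

open Bundle Set Filter Topology
open scoped Manifold ContDiff

noncomputable section

namespace FibreDerivative

/-! ### Flows on a manifold -/

section Flows

variable {EP : Type*} [NormedAddCommGroup EP] [NormedSpace ℝ EP]
  {HP : Type*} [TopologicalSpace HP] (I : ModelWithCorners ℝ EP HP)
  {P : Type*} [TopologicalSpace P] [ChartedSpace HP P]

/-- `Φ`, defined on `D ⊆ ℝ × P`, is a (smooth) local flow of the vector field `Z`: the domain `D` is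
open and contains `{0} × P`, each `{s | (s, p) ∈ D}` is an interval, `Φ` is smooth on `D`,
`Φ₀ = id`, and `s ↦ Φ_s(p)` is an integral curve of `Z`.  Values outside `D` are irrelevant. -/
structure IsLocalFlow (Z : ∀ p : P, TangentSpace I p) (D : Set (ℝ × P)) (Φ : ℝ → P → P) :
    Prop where
  isOpen : IsOpen D
  zero_mem : ∀ p, ((0 : ℝ), p) ∈ D
  ordConnected : ∀ p, OrdConnected {s : ℝ | (s, p) ∈ D}
  smooth : ContMDiffOn (𝓘(ℝ, ℝ).prod I) I ∞ (fun q : ℝ × P => Φ q.1 q.2) D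
  map_zero : ∀ p, Φ 0 p = p
  integralCurve : ∀ p, IsMIntegralCurveOn (I := I) (fun s => Φ s p) Z {s : ℝ | (s, p) ∈ D}

/-- `Φ`, defined on `D`, is the maximal local flow of `Z`: every integral curve of `Z` through `p`
defined on an open interval around `0` is a restriction of `s ↦ Φ_s(p)`. -/
structure IsMaximalLocalFlow (Z : ∀ p : P, TangentSpace I p) (D : Set (ℝ × P)) (Φ : ℝ → P → P) :
    Prop extends IsLocalFlow I Z D Φ where
  maximal : ∀ (γ : ℝ → P) (J : Set ℝ), IsOpen J → OrdConnected J → (0 : ℝ) ∈ J →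
    IsMIntegralCurveOn (I := I) γ Z J → ∀ s ∈ J, (s, γ 0) ∈ D ∧ γ s = Φ s (γ 0)

open Classical in
/-- The point reached at time `s` by the integral curve of `Z` that starts at `p`
(and `p` itself if that curve does not live until time `s`).  On a Hausdorff manifold without
boundary and for a smooth `Z` the integral curve is unique, so every local flow of `Z` agrees with
this map on its domain. -/
def flowMap (Z : ∀ p : P, TangentSpace I p) (s : ℝ) (p : P) : P :=
  if h : ∃ (γ : ℝ → P) (J : Set ℝ), IsOpen J ∧ OrdConnected J ∧ (0 : ℝ) ∈ J ∧ s ∈ J ∧ γ 0 = p ∧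
      IsMIntegralCurveOn (I := I) γ Z J
  then h.choose s else p

/-- The velocity at time `0` of a curve `c` with `c 0 = p`. -/
def velocityAt (c : ℝ → P) (p : P) (h : c 0 = p) : TangentSpace I p :=
  h ▸ (mfderiv 𝓘(ℝ, ℝ) I c 0 (1 : ℝ) : TangentSpace I (c 0))

/-- `Z` is a smooth vector field. -/
def IsSmoothVF [IsManifold I 1 P] (Z : ∀ p : P, TangentSpace I p) : Prop :=
  ContMDiff I I.tangent ∞ (fun p => (⟨p, Z p⟩ : TangentBundle I P))

end Flows

/-! ### Vector bundles

`V` is a smooth vector bundle over a manifold `N` modelled on `I`, with typical fibre `F`; its total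
space is `TotalSpace F V`, a manifold modelled on `I.prod 𝓘(ℝ, F)`, with projection `π F V`. -/

section Lines

variable {N F : Type*} {V : N → Type*} [∀ x, AddCommMonoid (V x)] [∀ x, Module ℝ (V x)]

/-- The curve `s ↦ a + s b` in the fibre through `a`. -/
def lineCurve (a : TotalSpace F V) (b : V a.proj) (s : ℝ) : TotalSpace F V :=
  ⟨a.proj, a.snd + s • b⟩

theorem lineCurve_zero (a : TotalSpace F V) (b : V a.proj) : lineCurve a b 0 = a := by
  simp [lineCurve]

/-- Fibrewise multiplication by a scalar, `a ↦ r a`. -/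
def smulMap (r : ℝ) (a : TotalSpace F V) : TotalSpace F V := ⟨a.proj, r • a.snd⟩

end Lines

section Bundles

variable {EN : Type*} [NormedAddCommGroup EN] [NormedSpace ℝ EN]
  {HN : Type*} [TopologicalSpace HN] (I : ModelWithCorners ℝ EN HN)
  {N : Type*} [TopologicalSpace N] [ChartedSpace HN N]
  (F : Type*) [NormedAddCommGroup F] [NormedSpace ℝ F]
  (V : N → Type*) [TopologicalSpace (TotalSpace F V)] [∀ x, AddCommMonoid (V x)]
  [∀ x, Module ℝ (V x)] [∀ x, TopologicalSpace (V x)] [FiberBundle F V]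

/-- The bundle projection as a smooth map. -/
def projMap : C^∞⟮I.prod 𝓘(ℝ, F), TotalSpace F V; I, N⟯ :=
  ⟨π F V, contMDiff_proj V⟩

/-- The pullback of the bundle along its own projection, as a vector bundle over its total space:
the fibre over `a` is the fibre of `V` over `π a`. -/
abbrev PullFibre : TotalSpace F V → Type _ :=
  (projMap I F V : TotalSpace F V → N) *ᵖ V

/-- The total space of the pullback bundle: the manifold of pairs `(a, b)` with `π a = π b`. -/
abbrev Pull : Type _ := TotalSpace F (PullFibre I F V)

variable {F V}

/-- The first component `(a, b) ↦ a`; it is also the projection of the pullback bundle. -/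
def pr₁ (z : Pull I F V) : TotalSpace F V := z.proj

/-- The element `b` of the fibre over `π a`, for a point `(a, b)` of the pullback bundle. -/
def sndVec (z : Pull I F V) : V z.proj.proj := z.snd

/-- The second component `(a, b) ↦ b`. -/
def pr₂ (z : Pull I F V) : TotalSpace F V := ⟨z.proj.proj, sndVec I z⟩

/-- Fibrewise addition `(a, b) ↦ a + b`. -/
def addMap (z : Pull I F V) : TotalSpace F V :=
  ⟨z.proj.proj, z.proj.snd + sndVec I z⟩

/-- `(a, b) ↦ (a, s b)`. -/
def scaleSnd (s : ℝ) (z : Pull I F V) : Pull I F V :=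
  ⟨z.proj, s • sndVec I z⟩

/-! #### The vertical lift and the vertical projection of a vector bundle -/

/-- The vertical lift `ξ(a, b) = d/ds (a + s b)|₀`, a tangent vector at `a`. -/
def vertLift (a : TotalSpace F V) (b : V a.proj) : TangentSpace (I.prod 𝓘(ℝ, F)) a :=
  velocityAt (I.prod 𝓘(ℝ, F)) (lineCurve a b) a (lineCurve_zero a b)

open Classical in
/-- The vertical projection `ν`: `ν(ξ(a, b)) = b`, and `0` (a junk value) on vectors that are not
vertical. -/
def vertProj (a : TotalSpace F V) (w : TangentSpace (I.prod 𝓘(ℝ, F)) a) : V a.proj :=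
  if h : ∃ b, vertLift I a b = w then h.choose else 0

/-! #### The vector bundle structure `Tπ : TE → TN` -/

open Classical in
/-- The canonical identification of pairs `(v, w)` of tangent vectors at `a` and at `b` (where
`z = (a, b)`) having the same image under `Tπ` with tangent vectors at `z` to the pullback bundle:
`pair z v w` is the vector `ζ` with `T pr₁ ζ = v` and `T pr₂ ζ = w`
(and `0` if the images of `v` and `w` differ). -/
def pair (z : Pull I F V) (v : TangentSpace (I.prod 𝓘(ℝ, F)) (pr₁ I z))
    (w : TangentSpace (I.prod 𝓘(ℝ, F)) (pr₂ I z)) :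
    TangentSpace ((I.prod 𝓘(ℝ, F)).prod 𝓘(ℝ, F)) z :=
  if h : ∃ ζ : TangentSpace ((I.prod 𝓘(ℝ, F)).prod 𝓘(ℝ, F)) z,
      mfderiv ((I.prod 𝓘(ℝ, F)).prod 𝓘(ℝ, F)) (I.prod 𝓘(ℝ, F)) (pr₁ I) z ζ = v ∧
      mfderiv ((I.prod 𝓘(ℝ, F)).prod 𝓘(ℝ, F)) (I.prod 𝓘(ℝ, F)) (pr₂ I) z ζ = w
  then h.choose else 0

/-- The addition `v +_τ w` of the vector bundle `Tπ`: the derivative of the addition of the bundle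
`π`.  It is defined for `v` at `a` and `w` at `b` with `Tπ v = Tπ w`, where `z = (a, b)`. -/
def tAdd (z : Pull I F V) (v : TangentSpace (I.prod 𝓘(ℝ, F)) (pr₁ I z))
    (w : TangentSpace (I.prod 𝓘(ℝ, F)) (pr₂ I z)) :
    TangentSpace (I.prod 𝓘(ℝ, F)) (addMap I z) :=
  mfderiv ((I.prod 𝓘(ℝ, F)).prod 𝓘(ℝ, F)) (I.prod 𝓘(ℝ, F)) (addMap I) z (pair I z v w)

/-- The scalar multiplication `r ·_τ v` of the vector bundle `Tπ`: the derivative of the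
multiplication by `r` in the bundle `π`. -/
def tSmul (r : ℝ) (a : TotalSpace F V) (v : TangentSpace (I.prod 𝓘(ℝ, F)) a) :
    TangentSpace (I.prod 𝓘(ℝ, F)) (smulMap r a) :=
  mfderiv (I.prod 𝓘(ℝ, F)) (I.prod 𝓘(ℝ, F)) (smulMap r) a v

variable [VectorBundle ℝ F V] [IsManifold I ∞ N] [ContMDiffVectorBundle ∞ F V I]

/-- The curve `s ↦ v +_τ s ·_τ w` in `TE`, where `(v, w)` is the pair that corresponds to the tangent
vector `ζ` to the pullback bundle at `z = (a, b)`; it lies over `s ↦ a + s b`. -/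
def tLineCurve (z : Pull I F V) (ζ : TangentSpace ((I.prod 𝓘(ℝ, F)).prod 𝓘(ℝ, F)) z) (s : ℝ) :
    TangentBundle (I.prod 𝓘(ℝ, F)) (TotalSpace F V) :=
  ⟨addMap I (scaleSnd I s z),
    tAdd I (scaleSnd I s z)
      (mfderiv ((I.prod 𝓘(ℝ, F)).prod 𝓘(ℝ, F)) (I.prod 𝓘(ℝ, F)) (pr₁ I) z ζ)
      (tSmul I s (pr₂ I z)
        (mfderiv ((I.prod 𝓘(ℝ, F)).prod 𝓘(ℝ, F)) (I.prod 𝓘(ℝ, F)) (pr₂ I) z ζ))⟩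

/-- The vertical lift `ξ_{Tπ}(v, w) = d/ds (v +_τ s ·_τ w)|₀ ∈ T(TE)` of the vector bundle `Tπ`, where
`(v, w)` is the pair that corresponds to the tangent vector `ζ` to the pullback bundle at `z`. -/
def tVertLift (z : Pull I F V) (ζ : TangentSpace ((I.prod 𝓘(ℝ, F)).prod 𝓘(ℝ, F)) z) :
    TangentBundle (I.prod 𝓘(ℝ, F)).tangent (TangentBundle (I.prod 𝓘(ℝ, F)) (TotalSpace F V)) :=
  tangentMap 𝓘(ℝ, ℝ) (I.prod 𝓘(ℝ, F)).tangent (tLineCurve I z ζ) ⟨0, (1 : ℝ)⟩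

/-! #### Projectable vector fields and linear vector fields -/

/-- `Y` projects onto the vector field `X` of the base: `Tπ ∘ Y = X ∘ π`. -/
def ProjectsTo (Y : ∀ a : TotalSpace F V, TangentSpace (I.prod 𝓘(ℝ, F)) a)
    (X : ∀ x : N, TangentSpace I x) : Prop :=
  ∀ a, mfderiv (I.prod 𝓘(ℝ, F)) I (π F V) a (Y a) = X a.proj

/-- `Y` is a smooth vector field on the total space that projects onto a smooth vector field of the
base. -/
def IsProjectable (Y : ∀ a : TotalSpace F V, TangentSpace (I.prod 𝓘(ℝ, F)) a) : Prop :=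
  IsSmoothVF (I.prod 𝓘(ℝ, F)) Y ∧ ∃ X : ∀ x : N, TangentSpace I x, IsSmoothVF I X ∧
    ProjectsTo I Y X

/-- `Z` is a linear vector field on the total space of the bundle, over the vector field `X` of the
base: `Z` is smooth and is a morphism from the vector bundle `π` to the vector bundle `Tπ`,
over `X`. -/
structure IsLinearVF (Z : ∀ a : TotalSpace F V, TangentSpace (I.prod 𝓘(ℝ, F)) a)
    (X : ∀ x : N, TangentSpace I x) : Prop where
  smooth : IsSmoothVF (I.prod 𝓘(ℝ, F)) Z
  smooth_base : IsSmoothVF I X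
  projectsTo : ProjectsTo I Z X
  map_add : ∀ z : Pull I F V, Z (addMap I z) = tAdd I z (Z (pr₁ I z)) (Z (pr₂ I z))
  map_smul : ∀ (r : ℝ) (a : TotalSpace F V), Z (smulMap r a) = tSmul I r a (Z a)

/-! #### The derivation of sections associated with a linear vector field -/

/-- The vector field of the base onto which a linear vector field `Z` projects, read off along the
zero section. -/
def baseVF (Z : ∀ a : TotalSpace F V, TangentSpace (I.prod 𝓘(ℝ, F)) a) (x : N) :
    TangentSpace I x :=
  mfderiv (I.prod 𝓘(ℝ, F)) I (π F V) (zeroSection F V x) (Z (zeroSection F V x))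

open Classical in
/-- An element `w` of the total space lying over `x`, seen as an element of the fibre over `x`. -/
def inFibre (x : N) (w : TotalSpace F V) : V x :=
  if h : w.proj = x then h ▸ w.snd else 0

/-- `(φ_s^* η)(x) = φ_{-s}(η(ϕ_s(x)))`, where `φ` is the flow of `Z` and `ϕ` the flow of its
projection to the base. -/
def flowPullback (Z : ∀ a : TotalSpace F V, TangentSpace (I.prod 𝓘(ℝ, F)) a) (η : ∀ x, V x)
    (x : N) (s : ℝ) : V x :=
  inFibre x (flowMap (I.prod 𝓘(ℝ, F)) Z (-s)
    ⟨flowMap I (baseVF I Z) s x, η (flowMap I (baseVF I Z) s x)⟩)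

/-- The difference quotient `((φ_s^* η)(x) - η(x)) / s`. -/
def flowQuotient (Z : ∀ a : TotalSpace F V, TangentSpace (I.prod 𝓘(ℝ, F)) a) (η : ∀ x, V x)
    (x : N) (s : ℝ) : V x :=
  s⁻¹ • (flowPullback I Z η x s + (-1 : ℝ) • η x)

/-- The derivation of sections associated with a linear vector field `Z`:
`(𝒟η)(x) = lim_{s → 0} ((φ_s^* η)(x) - η(x)) / s`. -/
def assocDerivation (Z : ∀ a : TotalSpace F V, TangentSpace (I.prod 𝓘(ℝ, F)) a) (η : ∀ x, V x)
    (x : N) : V x :=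
  limUnder (𝓝[≠] (0 : ℝ)) (flowQuotient I Z η x)

/-! #### The fibre derivative -/

/-- The fibre derivative `𝓕φ(a, b) = (φ(a), ν(Tφ(ξ(a, b))))` of a fibred map `φ` from the bundle to
itself; it depends only on `φ` near `a`. -/
def fibreDerivMap (φ : TotalSpace F V → TotalSpace F V) (z : Pull I F V) : Pull I F V :=
  ⟨φ (pr₁ I z), vertProj I (φ (pr₁ I z))
    (mfderiv (I.prod 𝓘(ℝ, F)) (I.prod 𝓘(ℝ, F)) φ (pr₁ I z) (vertLift I (pr₁ I z) (sndVec I z)))⟩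

/-- `ζ`, a tangent vector at `z` to the pullback bundle, that is, a pair of tangent vectors to the
total space with the same image under `Tπ`, satisfies the defining equation
`ξ_{Tπ}(ζ) = TY(ξ_π(z))` of the fibre derivative at `z` of the map `Y` from the bundle `π` to the
bundle `Tπ`. -/
def IsFibreDerivAt (Y : ∀ a : TotalSpace F V, TangentSpace (I.prod 𝓘(ℝ, F)) a) (z : Pull I F V)
    (ζ : TangentSpace ((I.prod 𝓘(ℝ, F)).prod 𝓘(ℝ, F)) z) : Prop :=
  tVertLift I z ζ =
    tangentMap (I.prod 𝓘(ℝ, F)) (I.prod 𝓘(ℝ, F)).tangent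
      (fun a => (⟨a, Y a⟩ : TangentBundle (I.prod 𝓘(ℝ, F)) (TotalSpace F V)))
      ⟨pr₁ I z, vertLift I (pr₁ I z) (sndVec I z)⟩

open Classical in
/-- The fibre derivative `𝓕Y` of a projectable vector field `Y`, as a vector field on the pullback
bundle: its value at `z` is the solution of the defining equation. -/
def fibreDeriv (Y : ∀ a : TotalSpace F V, TangentSpace (I.prod 𝓘(ℝ, F)) a) (z : Pull I F V) :
    TangentSpace ((I.prod 𝓘(ℝ, F)).prod 𝓘(ℝ, F)) z :=
  if h : ∃ ζ, IsFibreDerivAt I Y z ζ then h.choose else 0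

/-! #### Sections along the projection

A section along `π` assigns to each `a` an element of the fibre of `V` over `π a`; it is the same
thing as a section of the pullback bundle. -/

/-- The section `σ` along `π` is smooth. -/
def IsSmoothAlong (σ : ∀ a : TotalSpace F V, V a.proj) : Prop :=
  ContMDiff (I.prod 𝓘(ℝ, F)) (I.prod 𝓘(ℝ, F)) ∞ (fun a => (⟨a.proj, σ a⟩ : TotalSpace F V))

/-- The vertical lift `σ^V = ξ ∘ σ` of a section along `π`. -/
def vertLiftVF (σ : ∀ a : TotalSpace F V, V a.proj) (a : TotalSpace F V) :
    TangentSpace (I.prod 𝓘(ℝ, F)) a :=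
  vertLift I a (σ a)

/-- The derivation of sections along `π` associated with a linear vector field on the pullback
bundle. -/
def derivationAlong
    (Z : ∀ z : Pull I F V, TangentSpace ((I.prod 𝓘(ℝ, F)).prod 𝓘(ℝ, F)) z)
    (σ : ∀ a : TotalSpace F V, V a.proj) (a : TotalSpace F V) : V a.proj :=
  assocDerivation (F := F) (V := PullFibre I F V) (I.prod 𝓘(ℝ, F)) Z σ a

/-- The derivative `Y f` of a function `f` in the direction of the vector field `Y`. -/
def dirDeriv (Y : ∀ a : TotalSpace F V, TangentSpace (I.prod 𝓘(ℝ, F)) a)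
    (f : TotalSpace F V → ℝ) (a : TotalSpace F V) : ℝ :=
  mfderiv (I.prod 𝓘(ℝ, F)) 𝓘(ℝ, ℝ) f a (Y a)

/-- `𝒟` is a derivation of the module of smooth sections along `π` with symbol `Y`: it preserves
smooth sections, is additive on them, and `𝒟(f σ) = f 𝒟σ + (Y f) σ`. -/
structure IsDerivationAlong
    (𝒟 : (∀ a : TotalSpace F V, V a.proj) → ∀ a : TotalSpace F V, V a.proj)
    (Y : ∀ a : TotalSpace F V, TangentSpace (I.prod 𝓘(ℝ, F)) a) : Prop where
  smooth : ∀ σ, IsSmoothAlong I σ → IsSmoothAlong I (𝒟 σ)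
  map_add : ∀ σ σ', IsSmoothAlong I σ → IsSmoothAlong I σ' →
    ∀ a, 𝒟 (fun a => σ a + σ' a) a = 𝒟 σ a + 𝒟 σ' a
  leibniz : ∀ (f : TotalSpace F V → ℝ) σ, ContMDiff (I.prod 𝓘(ℝ, F)) 𝓘(ℝ, ℝ) ∞ f →
    IsSmoothAlong I σ → ∀ a, 𝒟 (fun a => f a • σ a) a = f a • 𝒟 σ a + dirDeriv I Y f a • σ a

end Bundles
end FibreDerivative

end

open FibreDerivative

set_option linter.unusedSectionVars false

/-! Everything is read in bundle charts. There a projectable field is `y(x, f) = (y₁(x), y₂(x, f))`,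
because its base component does not vary along the fibres. The equation that defines `𝓕Y` prescribes
`y` at the foot point and asks that `(0, ?) = Dy(0, g)`. The right side has zero base component, so
there is exactly one solution, `((x, f), g) ↦ (y(x, f), (Dy(x, f)(0, g))₂)`, which is
`fibreDerivRep`. It is smooth, and linear in `g` (`isFibreDerivAt_iff`, `fderiv_vfRep_vertical`,
`isLinearVF_fibreDeriv`).

For the flow, differentiate the equation `∂ₜG = y(G)` of the coordinate flow in a vertical direction
of the initial point. Symmetry of the second derivative gives the linearized equation
(`hasDerivAt_fderiv_of_ode`), which is the equation of integral curves of `𝓕Y` in the fibre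
variable. Uniqueness of integral curves on the base shows that the flow maps fibres to fibres, so
the derivatives involved are vertical. An integral curve of `𝓕Y` projects to one of `Y`, so
maximality is inherited.

For the derivation, let `c` solve `c' = y(c)`, and let `U` be the fundamental solution of the linear
equation along `c` whose coefficient is the vertical part of `Dy`. Pulling back a section with
coordinate expression `S` along the flow gives `U(s)⁻¹ S(c(s))`. Its derivative at `0` is `DS(y) -
(Dy(0, S))₂`, the fibre component of the bracket of `y` with `(0, S)`
(`exists_hasDerivAt_flowPullback`, `vertLiftVF_derivationAlong`). Since the vertical lift is linear
and injective, smoothness, additivity, the Leibniz rule and the commutator formula become properties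
of Lie brackets; the commutator formula is the Jacobi identity.

Compatibility of `𝓕` with brackets is a computation with `fibreDerivRep`, using symmetry of second
derivatives and verticality of `Dy(0, g)` (`lieBracket_fibreDerivRep`). -/

namespace FibreDerivative

/-! ### Tangent vectors and vector fields in charts -/

section Charts

variable {EP : Type*} [NormedAddCommGroup EP] [NormedSpace ℝ EP]
  {HP : Type*} [TopologicalSpace HP] (I : ModelWithCorners ℝ EP HP)
  {P : Type*} [TopologicalSpace P] [ChartedSpace HP P]
  {EQ : Type*} [NormedAddCommGroup EQ] [NormedSpace ℝ EQ]
  {HQ : Type*} [TopologicalSpace HQ] (K : ModelWithCorners ℝ EQ HQ)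
  {Q : Type*} [TopologicalSpace Q] [ChartedSpace HQ Q]

/-- The coordinates of tangent vectors at `p` in the extended chart centred at `p₀`. -/
noncomputable def chartDeriv (p₀ p : P) : TangentSpace I p →L[ℝ] EP :=
  mfderiv I 𝓘(ℝ, EP) (extChartAt I p₀) p

/-- The coordinate expression of a vector field in the extended chart centred at `p₀`. -/
noncomputable def vfRep (p₀ : P) (Z : ∀ p : P, TangentSpace I p) (x : EP) : EP :=
  chartDeriv I p₀ ((extChartAt I p₀).symm x) (Z ((extChartAt I p₀).symm x))

variable {I K} [IsManifold I ∞ P] [IsManifold K ∞ Q] {p₀ p : P} {q₀ q : Q}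

theorem chartDeriv_injective (hp : p ∈ (extChartAt I p₀).source) :
    Function.Injective (chartDeriv I p₀ p) := by
  obtain ⟨e, he⟩ := isInvertible_mfderiv_extChartAt (I := I) hp
  unfold chartDeriv
  rw [← he]
  exact e.injective

theorem chartDeriv_surjective (hp : p ∈ (extChartAt I p₀).source) :
    Function.Surjective (chartDeriv I p₀ p) := by
  obtain ⟨e, he⟩ := isInvertible_mfderiv_extChartAt (I := I) hp
  unfold chartDeriv
  rw [← he]
  exact e.surjective

theorem hasMFDerivAt_extChartAt_chartDeriv (hp : p ∈ (extChartAt I p₀).source) :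
    HasMFDerivAt I 𝓘(ℝ, EP) (extChartAt I p₀) p (chartDeriv I p₀ p) :=
  (mdifferentiableAt_extChartAt (by rwa [← extChartAt_source (I := I)])).hasMFDerivAt

theorem contMDiffAt_extChartAt_of_mem (hp : p ∈ (extChartAt I p₀).source) :
    ContMDiffAt I 𝓘(ℝ, EP) ∞ (extChartAt I p₀) p :=
  contMDiffAt_extChartAt' (by rwa [← extChartAt_source (I := I)])

theorem contMDiffAt_extChartAt_symm [I.Boundaryless] {x : EP} (hx : x ∈ (extChartAt I p₀).target) :
    ContMDiffAt 𝓘(ℝ, EP) I ∞ (extChartAt I p₀).symm x :=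
  (contMDiffOn_extChartAt_symm p₀).contMDiffAt ((isOpen_extChartAt_target p₀).mem_nhds hx)

/-- The derivative of a map in coordinates. -/
theorem chartDeriv_mfderiv {f : P → Q} (hf : MDifferentiableAt I K f p)
    (hp : p ∈ (extChartAt I p₀).source) (hq : f p ∈ (extChartAt K q₀).source)
    {g : EP → EQ} {g' : EP →L[ℝ] EQ} (hg : HasFDerivAt g g' (extChartAt I p₀ p))
    (hfg : ∀ᶠ x in 𝓝 p, extChartAt K q₀ (f x) = g (extChartAt I p₀ x)) (v : TangentSpace I p) :
    chartDeriv K q₀ (f p) (mfderiv I K f p v) = g' (chartDeriv I p₀ p v) := by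
  have h1 : HasMFDerivAt I 𝓘(ℝ, EQ) (extChartAt K q₀ ∘ f) p
      ((chartDeriv K q₀ (f p)).comp (mfderiv I K f p)) :=
    (hasMFDerivAt_extChartAt_chartDeriv hq).comp p hf.hasMFDerivAt
  have h2 : HasMFDerivAt I 𝓘(ℝ, EQ) (g ∘ extChartAt I p₀) p (g'.comp (chartDeriv I p₀ p)) :=
    hg.hasMFDerivAt.comp p (hasMFDerivAt_extChartAt_chartDeriv hp)
  have h3 := hasMFDerivAt_unique h1 (h2.congr_of_eventuallyEq hfg)
  exact DFunLike.congr_fun h3 v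

theorem chartDeriv_mfderiv_curve {c : ℝ → P} {t : ℝ} (hc : MDifferentiableAt 𝓘(ℝ, ℝ) I c t)
    (ht : c t ∈ (extChartAt I p₀).source) :
    HasDerivAt (fun s => extChartAt I p₀ (c s))
      (chartDeriv I p₀ (c t) (mfderiv 𝓘(ℝ, ℝ) I c t (1 : ℝ))) t := by
  have h1 : HasMFDerivAt 𝓘(ℝ, ℝ) 𝓘(ℝ, EP) (extChartAt I p₀ ∘ c) t
      ((chartDeriv I p₀ (c t)).comp (mfderiv 𝓘(ℝ, ℝ) I c t)) :=
    (hasMFDerivAt_extChartAt_chartDeriv ht).comp t hc.hasMFDerivAt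
  let L : ℝ →L[ℝ] EP := (chartDeriv I p₀ (c t)).comp (mfderiv 𝓘(ℝ, ℝ) I c t)
  have h2 : HasFDerivAt (fun s => extChartAt I p₀ (c s)) L t := h1.hasFDerivAt
  exact h2.hasDerivAt

/-- Continuity keeps the curve in the chart near `t`, where it is the inverse chart composed with
its coordinate expression. So it is differentiable, and injectivity of `chartDeriv` identifies the
velocity. -/
theorem hasMFDerivAt_curve [I.Boundaryless] {c : ℝ → P} {t : ℝ} (hc : ContinuousAt c t)
    (ht : c t ∈ (extChartAt I p₀).source) {v : TangentSpace I (c t)}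
    (hd : HasDerivAt (fun s => extChartAt I p₀ (c s)) (chartDeriv I p₀ (c t) v) t) :
    HasMFDerivAt 𝓘(ℝ, ℝ) I c t ((1 : ℝ →L[ℝ] ℝ).smulRight v) := by
  have h1 : MDifferentiableAt 𝓘(ℝ, ℝ) I c t := by
    have h2 : MDifferentiableAt 𝓘(ℝ, ℝ) I
        ((extChartAt I p₀).symm ∘ fun s => extChartAt I p₀ (c s)) t :=
      MDifferentiableAt.comp t
        ((contMDiffAt_extChartAt_symm ((extChartAt I p₀).map_source ht)).mdifferentiableAt
          (by simp)) hd.differentiableAt.mdifferentiableAt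
    refine h2.congr_of_eventuallyEq ?_
    filter_upwards [hc.preimage_mem_nhds ((isOpen_extChartAt_source p₀).mem_nhds ht)] with s hs
    exact ((extChartAt I p₀).left_inv hs).symm
  have h3 := (chartDeriv_mfderiv_curve h1 ht).unique hd
  have h4 := chartDeriv_injective ht h3
  have h5 : (1 : ℝ →L[ℝ] ℝ).smulRight v = mfderiv 𝓘(ℝ, ℝ) I c t := by
    refine ContinuousLinearMap.ext_ring ?_
    rw [← h4]
    exact one_smul ℝ _
  rw [h5]
  exact h1.hasMFDerivAt

theorem hasDerivAt_extChartAt_velocityAt {c : ℝ → P} (h : c 0 = p)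
    (hc : MDifferentiableAt 𝓘(ℝ, ℝ) I c 0) (hp : p ∈ (extChartAt I p₀).source) :
    HasDerivAt (fun s => extChartAt I p₀ (c s)) (chartDeriv I p₀ p (velocityAt I c p h)) 0 := by
  subst h
  exact chartDeriv_mfderiv_curve hc hp

theorem tangentBundle_ext {w w' : TangentBundle I P} (hw : w.proj ∈ (extChartAt I p₀).source)
    (hw' : w'.proj ∈ (extChartAt I p₀).source)
    (h1 : extChartAt I p₀ w.proj = extChartAt I p₀ w'.proj)
    (h2 : chartDeriv I p₀ w.proj w.snd = chartDeriv I p₀ w'.proj w'.snd) : w = w' := by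
  obtain ⟨a, v⟩ := w
  obtain ⟨b, v'⟩ := w'
  obtain rfl : a = b := (extChartAt I p₀).injOn hw hw' h1
  exact congrArg (TotalSpace.mk a) (chartDeriv_injective hw h2)

theorem trivializationAt_tangent_snd (hp : p ∈ (extChartAt I p₀).source) (v : TangentSpace I p) :
    (trivializationAt EP (TangentSpace I) p₀ ⟨p, v⟩).2 = chartDeriv I p₀ p v := by
  have h : p ∈ (chartAt HP p₀).source := by rwa [← extChartAt_source (I := I)]
  unfold chartDeriv
  rw [← TangentBundle.continuousLinearMapAt_trivializationAt h,
    Trivialization.continuousLinearMapAt_apply, Trivialization.linearMapAt_apply, if_pos]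
  simpa using h

theorem extChartAt_tangent_apply {w₀ w : TangentBundle I P}
    (hw : w.proj ∈ (extChartAt I w₀.proj).source) :
    extChartAt I.tangent w₀ w = (extChartAt I w₀.proj w.proj, chartDeriv I w₀.proj w.proj w.snd) := by
  have h := FiberBundle.extChartAt (IB := I) (F := EP) (E := TangentSpace I) w₀
  have h2 : extChartAt I.tangent w₀ w = ((trivializationAt EP (TangentSpace I) w₀.proj).toPartialEquiv ≫
        (extChartAt I w₀.proj).prod (PartialEquiv.refl EP)) w := by
    exact congrArg (fun (e : PartialEquiv (TangentBundle I P) (EP × EP)) => e w) h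
  rw [h2]
  refine Prod.ext ?_ (trivializationAt_tangent_snd hw w.snd)
  simp

theorem mem_extChartAt_tangent_source {w₀ w : TangentBundle I P} :
    w ∈ (extChartAt I.tangent w₀).source ↔ w.proj ∈ (extChartAt I w₀.proj).source := by
  rw [extChartAt_source, extChartAt_source, TangentBundle.mem_chart_source_iff]

/-- The chart need not be centred at the foot point. This freedom lets nearby points be treated in
one fixed chart. -/
theorem contMDiffAt_tangentBundle {EQ : Type*} [NormedAddCommGroup EQ] [NormedSpace ℝ EQ]
    {HQ : Type*} [TopologicalSpace HQ] {K : ModelWithCorners ℝ EQ HQ}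
    {Q : Type*} [TopologicalSpace Q] [ChartedSpace HQ Q] {f : Q → TangentBundle I P} {q : Q}
    (hq : (f q).proj ∈ (extChartAt I p₀).source) :
    ContMDiffAt K I.tangent ∞ f q ↔ ContMDiffAt K I ∞ (fun x => (f x).proj) q ∧
      ContMDiffAt K 𝓘(ℝ, EP) ∞ (fun x => chartDeriv I p₀ (f x).proj (f x).snd) q := by
  have hs : f q ∈ (trivializationAt EP (TangentSpace I) p₀).source := by
    rw [TangentBundle.trivializationAt_source]
    rwa [extChartAt_source] at hq
  refine ((trivializationAt EP (TangentSpace I) p₀).contMDiffAt_iff hs).trans ?_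
  refine and_congr_right fun h => ?_
  refine Filter.EventuallyEq.contMDiffAt_iff ?_
  filter_upwards [h.continuousAt.preimage_mem_nhds
    ((isOpen_extChartAt_source p₀).mem_nhds hq)] with x hx
  exact trivializationAt_tangent_snd hx _

theorem IsSmoothVF.contMDiffAt_chartDeriv {Z : ∀ p : P, TangentSpace I p} (hZ : IsSmoothVF I Z)
    (hp : p ∈ (extChartAt I p₀).source) :
    ContMDiffAt I 𝓘(ℝ, EP) ∞ (fun p => chartDeriv I p₀ p (Z p)) p :=
  ((contMDiffAt_tangentBundle (f := fun p => (⟨p, Z p⟩ : TangentBundle I P)) hp).1 (hZ p)).2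

theorem IsSmoothVF.contDiffAt_vfRep [I.Boundaryless] {Z : ∀ p : P, TangentSpace I p}
    (hZ : IsSmoothVF I Z) {x : EP} (hx : x ∈ (extChartAt I p₀).target) :
    ContDiffAt ℝ ∞ (vfRep I p₀ Z) x :=
  ((hZ.contMDiffAt_chartDeriv ((extChartAt I p₀).map_target hx)).comp x
    (contMDiffAt_extChartAt_symm hx)).contDiffAt

omit [IsManifold I ∞ P] in
theorem vfRep_extChartAt (Z : ∀ p : P, TangentSpace I p) (hp : p ∈ (extChartAt I p₀).source) :
    vfRep I p₀ Z (extChartAt I p₀ p) = chartDeriv I p₀ p (Z p) := by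
  unfold vfRep
  rw [(extChartAt I p₀).left_inv hp]

theorem isSmoothVF_of_chartDeriv {Z : ∀ p : P, TangentSpace I p}
    (h : ∀ p₀ : P, ∃ g : EP → EP, ContDiffAt ℝ ∞ g (extChartAt I p₀ p₀) ∧
      ∀ᶠ p in 𝓝 p₀, chartDeriv I p₀ p (Z p) = g (extChartAt I p₀ p)) : IsSmoothVF I Z := by
  intro p
  obtain ⟨g, hg, he⟩ := h p
  refine (contMDiffAt_tangentBundle (p₀ := p) (mem_extChartAt_source p)).2 ⟨contMDiffAt_id, ?_⟩
  exact (hg.contMDiffAt.comp p (contMDiffAt_extChartAt_of_mem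
    (mem_extChartAt_source p))).congr_of_eventuallyEq he

theorem IsSmoothVF.mdifferentiableAt {Z : ∀ p : P, TangentSpace I p} (hZ : IsSmoothVF I Z) (p : P) :
    MDifferentiableAt I I.tangent (fun p => (⟨p, Z p⟩ : TangentBundle I P)) p :=
  (hZ p).mdifferentiableAt (by simp)

/-- The pullback applies the inverse of the derivative of the inverse chart, which is the derivative
of the chart. -/
theorem mpullback_extChartAt_symm [I.Boundaryless] (Z : ∀ p : P, TangentSpace I p) {x : EP}
    (hx : x ∈ (extChartAt I p₀).target) :
    VectorField.mpullback 𝓘(ℝ, EP) I (extChartAt I p₀).symm Z x = vfRep I p₀ Z x := by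
  have h1 := mfderiv_extChartAt_comp_mfderivWithin_extChartAt_symm (I := I) hx
  have h2 := mfderivWithin_extChartAt_symm_comp_mfderiv_extChartAt (I := I) hx
  rw [I.range_eq_univ, mfderivWithin_univ] at h1 h2
  unfold VectorField.mpullback vfRep chartDeriv
  rw [ContinuousLinearMap.inverse_eq h2 h1]
  rfl

/-- The bracket is natural under pullback by the inverse chart. Since it involves derivatives, the
fields are replaced by their coordinate expressions on a whole neighbourhood of `x`. -/
theorem vfRep_mlieBracket [I.Boundaryless] [CompleteSpace EP] {Z Z' : ∀ p : P, TangentSpace I p}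
    (hZ : IsSmoothVF I Z) (hZ' : IsSmoothVF I Z') {x : EP} (hx : x ∈ (extChartAt I p₀).target) :
    vfRep I p₀ (VectorField.mlieBracket I Z Z') x =
      VectorField.lieBracket ℝ (vfRep I p₀ Z) (vfRep I p₀ Z') x := by
  have hn : ∀ᶠ y in 𝓝 x, y ∈ (extChartAt I p₀).target := (isOpen_extChartAt_target p₀).mem_nhds hx
  have : IsManifold I (minSmoothness ℝ 3) P := by
    simp only [minSmoothness_of_isRCLikeNormedField]; exact IsManifold.of_le (n := ∞) (by norm_cast)
  rw [← mpullback_extChartAt_symm _ hx,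
    VectorField.mpullback_mlieBracket (hZ.mdifferentiableAt _) (hZ'.mdifferentiableAt _)
      (contMDiffAt_extChartAt_symm hx)
      (by simp only [minSmoothness_of_isRCLikeNormedField]; norm_cast)]
  have e1 : ∀ Z : ∀ p : P, TangentSpace I p,
    VectorField.mpullback 𝓘(ℝ, EP) I (extChartAt I p₀).symm Z =ᶠ[𝓝 x] vfRep I p₀ Z := fun Z => by
    filter_upwards [hn] with y hy using mpullback_extChartAt_symm Z hy
  rw [Filter.EventuallyEq.mlieBracket_vectorField_eq (e1 Z) (e1 Z'),
    ← VectorField.lieBracketWithin_univ]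
  exact congrFun (VectorField.mlieBracketWithin_eq_lieBracketWithin
    (V := vfRep I p₀ Z) (W := vfRep I p₀ Z') (s := univ)) x

theorem IsSmoothVF.mlieBracket [CompleteSpace EP] {Z Z' : ∀ p : P, TangentSpace I p}
    (hZ : IsSmoothVF I Z) (hZ' : IsSmoothVF I Z') :
    IsSmoothVF I (VectorField.mlieBracket I Z Z') := by
  have : IsManifold I (((⊤ : ℕ∞) : ℕ∞ω) + 1) P := by simpa
  have : IsManifold I (minSmoothness ℝ 2) P := by
    simp only [minSmoothness_of_isRCLikeNormedField]; exact IsManifold.of_le (n := ∞) (by norm_cast)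
  have : IsManifold I (minSmoothness ℝ 3) P := by
    simp only [minSmoothness_of_isRCLikeNormedField]; exact IsManifold.of_le (n := ∞) (by norm_cast)
  exact ContDiff.mlieBracket_vectorField (m := ⊤) (n := ⊤) hZ hZ' (by simp)

/-! ### The double tangent bundle in coordinates -/

/-- The coordinates of points of the tangent bundle induced by the extended chart centred at
`p₀`. -/
noncomputable def tangentCoord (I : ModelWithCorners ℝ EP HP) (p₀ : P) (w : TangentBundle I P) :
    EP × EP :=
  (extChartAt I p₀ w.proj, chartDeriv I p₀ w.proj w.snd)

/-- The coordinates of vectors tangent to the tangent bundle induced by the extended chart centred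
at `p₀`. -/
noncomputable def tangentCoordDeriv (I : ModelWithCorners ℝ EP HP) [IsManifold I ∞ P] (p₀ : P)
    (w : TangentBundle I.tangent (TangentBundle I P)) : EP × EP :=
  chartDeriv I.tangent (⟨p₀, 0⟩ : TangentBundle I P) w.proj w.snd

/-- The chart of the tangent bundle centred at a vector depends only on the foot of that vector, so
the zero vector at `p₀` can serve as centre for all of them. -/
theorem eventually_extChartAt_tangent_eq {w : TangentBundle I P}
    (hw : w.proj ∈ (extChartAt I p₀).source) :
    ∀ᶠ w' in 𝓝 w, extChartAt I.tangent (⟨p₀, 0⟩ : TangentBundle I P) w' = tangentCoord I p₀ w' := by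
  have h := (isOpen_extChartAt_source (I := I.tangent) (⟨p₀, 0⟩ : TangentBundle I P)).mem_nhds
    (mem_extChartAt_tangent_source.2 hw)
  filter_upwards [h] with w' hw'
  exact extChartAt_tangent_apply (mem_extChartAt_tangent_source.1 hw')

theorem tangentCoordDeriv_curve {c : ℝ → TangentBundle I P} {t : ℝ}
    (hc : MDifferentiableAt 𝓘(ℝ, ℝ) I.tangent c t) (ht : (c t).proj ∈ (extChartAt I p₀).source)
    {u : EP × EP} (hd : HasDerivAt (fun s => tangentCoord I p₀ (c s)) u t) :
    tangentCoordDeriv I p₀ (tangentMap 𝓘(ℝ, ℝ) I.tangent c ⟨t, (1 : ℝ)⟩) = u := by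
  have h1 := chartDeriv_mfderiv_curve (p₀ := (⟨p₀, 0⟩ : TangentBundle I P)) hc
    (mem_extChartAt_tangent_source.2 ht)
  refine h1.unique (hd.congr_of_eventuallyEq ?_)
  exact hc.continuousAt.eventually (eventually_extChartAt_tangent_eq ht)

/-- In coordinates the field is the graph map `x ↦ (x, z(x))`, whose derivative is `v ↦ (v, Dz(v))`.
-/
theorem tangentCoordDeriv_vectorField [I.Boundaryless] {Z : ∀ p : P, TangentSpace I p}
    (hZ : IsSmoothVF I Z) (hp : p ∈ (extChartAt I p₀).source) (v : TangentSpace I p) :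
    tangentCoordDeriv I p₀ (tangentMap I I.tangent (fun p => (⟨p, Z p⟩ : TangentBundle I P)) ⟨p, v⟩) =
      (chartDeriv I p₀ p v,
        fderiv ℝ (vfRep I p₀ Z) (extChartAt I p₀ p) (chartDeriv I p₀ p v)) := by
  have hd : HasFDerivAt (fun x => (x, vfRep I p₀ Z x))
      ((ContinuousLinearMap.id ℝ EP).prod (fderiv ℝ (vfRep I p₀ Z) (extChartAt I p₀ p)))
      (extChartAt I p₀ p) :=
    (hasFDerivAt_id _).prodMk ((hZ.contDiffAt_vfRep
      ((extChartAt I p₀).map_source hp)).differentiableAt (by simp)).hasFDerivAt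
  refine chartDeriv_mfderiv (q₀ := (⟨p₀, 0⟩ : TangentBundle I P))
    (hZ.mdifferentiableAt p) hp (mem_extChartAt_tangent_source.2 hp) hd ?_ v
  filter_upwards [(isOpen_extChartAt_source p₀).mem_nhds hp] with x hx
  rw [vfRep_extChartAt _ hx]
  exact extChartAt_tangent_apply (w₀ := (⟨p₀, 0⟩ : TangentBundle I P)) (w := ⟨x, Z x⟩) hx

/-- This reduces the defining equation of the fibre derivative to vector equations. Working in the
total space avoids comparing tangent vectors at points that are not definitionally equal. -/
theorem doubleTangent_ext_iff {w w' : TangentBundle I.tangent (TangentBundle I P)}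
    (hw : w.proj.proj ∈ (extChartAt I p₀).source) (hw' : w'.proj.proj ∈ (extChartAt I p₀).source) :
    w = w' ↔ tangentCoord I p₀ w.proj = tangentCoord I p₀ w'.proj ∧
      tangentCoordDeriv I p₀ w = tangentCoordDeriv I p₀ w' := by
  refine ⟨fun h => h ▸ ⟨rfl, rfl⟩, fun h => ?_⟩
  refine tangentBundle_ext (p₀ := (⟨p₀, 0⟩ : TangentBundle I P))
    (mem_extChartAt_tangent_source.2 hw) (mem_extChartAt_tangent_source.2 hw') ?_ h.2
  have e : ∀ w : TangentBundle I P, w.proj ∈ (extChartAt I p₀).source →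
      extChartAt I.tangent (⟨p₀, 0⟩ : TangentBundle I P) w = tangentCoord I p₀ w := fun w hw =>
    (eventually_extChartAt_tangent_eq hw).self_of_nhds
  rw [e _ hw, e _ hw', h.1]

end Charts


/-! ### Vector bundles in charts -/

section BundleCharts

variable {EN : Type*} [NormedAddCommGroup EN] [NormedSpace ℝ EN]
  {HN : Type*} [TopologicalSpace HN] {I : ModelWithCorners ℝ EN HN}
  {N : Type*} [TopologicalSpace N] [ChartedSpace HN N]
  {F : Type*} [NormedAddCommGroup F] [NormedSpace ℝ F]
  {V : N → Type*} [TopologicalSpace (TotalSpace F V)] [∀ x, AddCommMonoid (V x)]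
  [∀ x, Module ℝ (V x)] [∀ x, TopologicalSpace (V x)] [FiberBundle F V]

/-- The fibre coordinate in the preferred trivialization at `x₀`. -/
noncomputable def fibreCoord (x₀ : N) (a : TotalSpace F V) : F := (trivializationAt F V x₀ a).2

theorem extChartAt_total_apply {a₀ a : TotalSpace F V}
    (ha : a.proj ∈ (trivializationAt F V a₀.proj).baseSet) :
    extChartAt (I.prod 𝓘(ℝ, F)) a₀ a =
      (extChartAt I a₀.proj a.proj, fibreCoord a₀.proj a) := by
  rw [FiberBundle.extChartAt]
  refine Prod.ext ?_ rfl
  simp [Trivialization.coe_fst' _ ha]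

theorem mem_extChartAt_total_source {a₀ a : TotalSpace F V} :
    a ∈ (extChartAt (I.prod 𝓘(ℝ, F)) a₀).source ↔
      a.proj ∈ (trivializationAt F V a₀.proj).baseSet ∧
        a.proj ∈ (extChartAt I a₀.proj).source := by
  rw [FiberBundle.extChartAt]
  simp only [PartialEquiv.trans_source, mem_inter_iff, mem_preimage, PartialEquiv.prod_source,
    PartialEquiv.refl_source, mem_prod, mem_univ, and_true]
  refine Iff.trans (and_congr_left' (Trivialization.mem_source _)) (and_congr_right fun h => ?_)
  simp [Trivialization.coe_fst' _ h]

theorem mem_extChartAt_total_target {a₀ : TotalSpace F V} {x : EN × F} {f : F}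
    (hx : x ∈ (extChartAt (I.prod 𝓘(ℝ, F)) a₀).target) :
    (x.1, f) ∈ (extChartAt (I.prod 𝓘(ℝ, F)) a₀).target := by
  rw [FiberBundle.extChartAt_target] at hx ⊢
  exact ⟨hx.1, mem_univ _⟩

/-- Bundle charts contain whole fibres, so the fibrewise operations never leave the chart. -/
theorem mem_extChartAt_total_source_of_proj_eq {a₀ a b : TotalSpace F V}
    (ha : a ∈ (extChartAt (I.prod 𝓘(ℝ, F)) a₀).source) (h : b.proj = a.proj) :
    b ∈ (extChartAt (I.prod 𝓘(ℝ, F)) a₀).source := by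
  rw [mem_extChartAt_total_source, h]
  exact mem_extChartAt_total_source.1 ha

theorem extChartAt_total_fst {a₀ a : TotalSpace F V}
    (ha : a ∈ (extChartAt (I.prod 𝓘(ℝ, F)) a₀).source) :
    (extChartAt (I.prod 𝓘(ℝ, F)) a₀ a).1 = extChartAt I a₀.proj a.proj := by
  rw [extChartAt_total_apply (mem_extChartAt_total_source.1 ha).1]

theorem contMDiffAt_total {EQ : Type*} [NormedAddCommGroup EQ] [NormedSpace ℝ EQ]
    {HQ : Type*} [TopologicalSpace HQ] {K : ModelWithCorners ℝ EQ HQ}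
    {Q : Type*} [TopologicalSpace Q] [ChartedSpace HQ Q]
    [VectorBundle ℝ F V] [IsManifold I ∞ N] [ContMDiffVectorBundle ∞ F V I]
    {f : Q → TotalSpace F V} {q : Q} {x₀ : N}
    (hq : (f q).proj ∈ (trivializationAt F V x₀).baseSet) :
    ContMDiffAt K (I.prod 𝓘(ℝ, F)) ∞ f q ↔ ContMDiffAt K I ∞ (fun x => (f x).proj) q ∧
      ContMDiffAt K 𝓘(ℝ, F) ∞ (fun x => fibreCoord x₀ (f x)) q :=
  (trivializationAt F V x₀).contMDiffAt_iff ((Trivialization.mem_source _).2 hq)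

section Linear

variable [VectorBundle ℝ F V] {x₀ x : N}

theorem fibreCoord_add (hx : x ∈ (trivializationAt F V x₀).baseSet) (u v : V x) :
    fibreCoord x₀ (⟨x, u + v⟩ : TotalSpace F V) =
      fibreCoord x₀ (⟨x, u⟩ : TotalSpace F V) + fibreCoord x₀ (⟨x, v⟩ : TotalSpace F V) :=
  ((trivializationAt F V x₀).linear ℝ hx).map_add u v

theorem fibreCoord_smul (hx : x ∈ (trivializationAt F V x₀).baseSet) (r : ℝ) (u : V x) :
    fibreCoord x₀ (⟨x, r • u⟩ : TotalSpace F V) = r • fibreCoord x₀ (⟨x, u⟩ : TotalSpace F V) :=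
  ((trivializationAt F V x₀).linear ℝ hx).map_smul r u

theorem fibreCoord_injective (hx : x ∈ (trivializationAt F V x₀).baseSet) {u v : V x}
    (h : fibreCoord x₀ (⟨x, u⟩ : TotalSpace F V) = fibreCoord x₀ (⟨x, v⟩ : TotalSpace F V)) :
    u = v := by
  have h1 : (⟨x, u⟩ : TotalSpace F V) = ⟨x, v⟩ := by
    refine (trivializationAt F V x₀).injOn ((Trivialization.mem_source _).2 hx)
      ((Trivialization.mem_source _).2 hx) (Prod.ext ?_ h)
    have h2 : ∀ u : V x, (trivializationAt F V x₀ ⟨x, u⟩).1 = x := fun u =>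
      Trivialization.coe_fst' _ hx
    exact (h2 u).trans (h2 v).symm
  exact eq_of_heq (TotalSpace.mk.inj h1).2

theorem fibreCoord_surjective (hx : x ∈ (trivializationAt F V x₀).baseSet) (f : F) :
    ∃ u : V x, fibreCoord x₀ (⟨x, u⟩ : TotalSpace F V) = f :=
  ⟨(trivializationAt F V x₀).symm x f, by
    unfold fibreCoord
    rw [Trivialization.apply_mk_symm _ hx]⟩

end Linear

variable [VectorBundle ℝ F V] [IsManifold I ∞ N] [ContMDiffVectorBundle ∞ F V I]

/-! ### The vertical lift in coordinates -/

theorem contMDiff_lineCurve (a : TotalSpace F V) (b : V a.proj) :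
    ContMDiff 𝓘(ℝ, ℝ) (I.prod 𝓘(ℝ, F)) ∞ (lineCurve a b) := by
  intro s
  have hb := mem_baseSet_trivializationAt F V a.proj
  refine (contMDiffAt_total (x₀ := a.proj) hb).2 ⟨contMDiffAt_const, ?_⟩
  have : (fun t => fibreCoord a.proj (lineCurve a b t)) = fun t : ℝ =>
      fibreCoord a.proj a + t • fibreCoord a.proj (⟨a.proj, b⟩ : TotalSpace F V) := by
    funext t
    rw [← fibreCoord_smul hb]
    exact fibreCoord_add hb _ _
  rw [this]
  exact ContDiffAt.contMDiffAt (by fun_prop)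

theorem extChartAt_lineCurve {a₀ a : TotalSpace F V}
    (ha : a ∈ (extChartAt (I.prod 𝓘(ℝ, F)) a₀).source) (b : V a.proj) (s : ℝ) :
    extChartAt (I.prod 𝓘(ℝ, F)) a₀ (lineCurve a b s) = extChartAt (I.prod 𝓘(ℝ, F)) a₀ a +
      s • ((0 : EN), fibreCoord a₀.proj (⟨a.proj, b⟩ : TotalSpace F V)) := by
  have hb := (mem_extChartAt_total_source.1 ha).1
  rw [extChartAt_total_apply (a := lineCurve a b s) hb, extChartAt_total_apply hb]
  refine Prod.ext (by simp [lineCurve]) ?_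
  change _ = _ + s • _
  rw [← fibreCoord_smul hb]
  exact fibreCoord_add hb _ _

/-- In the chart `lineCurve` is an affine line with direction `(0, b)`. -/
theorem chartDeriv_vertLift {a₀ a : TotalSpace F V}
    (ha : a ∈ (extChartAt (I.prod 𝓘(ℝ, F)) a₀).source) (b : V a.proj) :
    chartDeriv (I.prod 𝓘(ℝ, F)) a₀ a (vertLift I a b) =
      (0, fibreCoord a₀.proj (⟨a.proj, b⟩ : TotalSpace F V)) := by
  have h1 := hasDerivAt_extChartAt_velocityAt (lineCurve_zero a b)
    ((contMDiff_lineCurve (I := I) a b 0).mdifferentiableAt (by simp)) ha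
  refine h1.unique ?_
  simp only [extChartAt_lineCurve ha]
  have := ((hasDerivAt_id (0 : ℝ)).smul_const
    ((0 : EN), fibreCoord a₀.proj (⟨a.proj, b⟩ : TotalSpace F V))).const_add
    (extChartAt (I.prod 𝓘(ℝ, F)) a₀ a)
  simpa using this

theorem vertLift_injective (a : TotalSpace F V) : Function.Injective (vertLift I a) := by
  intro b b' h
  have ha := mem_extChartAt_source (I := I.prod 𝓘(ℝ, F)) a
  have h1 := congrArg (chartDeriv (I.prod 𝓘(ℝ, F)) a a) h
  rw [chartDeriv_vertLift ha, chartDeriv_vertLift ha] at h1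
  exact fibreCoord_injective (mem_extChartAt_total_source.1 ha).1 (Prod.mk.inj h1).2

theorem vertProj_vertLift (a : TotalSpace F V) (b : V a.proj) :
    vertProj I a (vertLift I a b) = b := by
  have h : ∃ b', vertLift I a b' = vertLift I a b := ⟨b, rfl⟩
  unfold vertProj
  rw [dif_pos h]
  exact vertLift_injective a h.choose_spec

/-- Verticality can be tested in any bundle chart around `a`: it means that the base coordinate of
the vector vanishes. Surjectivity of the fibre coordinate then supplies `b`. -/
theorem exists_vertLift_eq {a₀ a : TotalSpace F V}
    (ha : a ∈ (extChartAt (I.prod 𝓘(ℝ, F)) a₀).source) {w : TangentSpace (I.prod 𝓘(ℝ, F)) a}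
    (hw : (chartDeriv (I.prod 𝓘(ℝ, F)) a₀ a w).1 = 0) : ∃ b, vertLift I a b = w := by
  obtain ⟨b, hb⟩ := fibreCoord_surjective (mem_extChartAt_total_source.1 ha).1
    (chartDeriv (I.prod 𝓘(ℝ, F)) a₀ a w).2
  refine ⟨b, chartDeriv_injective ha ?_⟩
  rw [chartDeriv_vertLift ha, hb, ← hw]

theorem vertLift_vertProj {a₀ a : TotalSpace F V}
    (ha : a ∈ (extChartAt (I.prod 𝓘(ℝ, F)) a₀).source) {w : TangentSpace (I.prod 𝓘(ℝ, F)) a}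
    (hw : (chartDeriv (I.prod 𝓘(ℝ, F)) a₀ a w).1 = 0) : vertLift I a (vertProj I a w) = w := by
  obtain ⟨b, rfl⟩ := exists_vertLift_eq ha hw
  rw [vertProj_vertLift]

theorem fibreCoord_vertProj {a₀ a : TotalSpace F V}
    (ha : a ∈ (extChartAt (I.prod 𝓘(ℝ, F)) a₀).source) {w : TangentSpace (I.prod 𝓘(ℝ, F)) a}
    (hw : (chartDeriv (I.prod 𝓘(ℝ, F)) a₀ a w).1 = 0) :
    fibreCoord a₀.proj (⟨a.proj, vertProj I a w⟩ : TotalSpace F V) =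
      (chartDeriv (I.prod 𝓘(ℝ, F)) a₀ a w).2 := by
  conv_rhs => rw [← vertLift_vertProj ha hw, chartDeriv_vertLift ha]

theorem chartDeriv_mfderiv_proj {a₀ a : TotalSpace F V}
    (ha : a ∈ (extChartAt (I.prod 𝓘(ℝ, F)) a₀).source) (w : TangentSpace (I.prod 𝓘(ℝ, F)) a) :
    chartDeriv I a₀.proj a.proj (mfderiv (I.prod 𝓘(ℝ, F)) I (π F V) a w) =
      (chartDeriv (I.prod 𝓘(ℝ, F)) a₀ a w).1 := by
  refine chartDeriv_mfderiv (f := π F V) (g := Prod.fst) (g' := ContinuousLinearMap.fst ℝ EN F)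
    ((contMDiff_proj (n := ∞) V a).mdifferentiableAt (by simp)) ha
    (mem_extChartAt_total_source.1 ha).2 hasFDerivAt_fst ?_ w
  filter_upwards [(isOpen_extChartAt_source a₀).mem_nhds ha] with x hx
  exact (extChartAt_total_fst hx).symm

theorem exists_vertLift_eq_iff {a : TotalSpace F V} {w : TangentSpace (I.prod 𝓘(ℝ, F)) a} :
    (∃ b, vertLift I a b = w) ↔ mfderiv (I.prod 𝓘(ℝ, F)) I (π F V) a w = 0 := by
  have ha := mem_extChartAt_source (I := I.prod 𝓘(ℝ, F)) a
  constructor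
  · rintro ⟨b, rfl⟩
    refine chartDeriv_injective (mem_extChartAt_total_source.1 ha).2 ?_
    erw [chartDeriv_mfderiv_proj ha, chartDeriv_vertLift ha]
    simp
  · intro h
    refine exists_vertLift_eq ha ?_
    rw [← chartDeriv_mfderiv_proj ha, h, map_zero]

/-! ### The pullback bundle in coordinates -/

/-- The trivialization of the pullback bundle is pulled back from the one of `V` at the foot of `pr₁
z₀`, so its base set imposes no condition beyond that of the chart of the total space. -/
theorem mem_extChartAt_pull_source {z₀ z : Pull I F V} :
    z ∈ (extChartAt ((I.prod 𝓘(ℝ, F)).prod 𝓘(ℝ, F)) z₀).source ↔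
      pr₁ I z ∈ (extChartAt (I.prod 𝓘(ℝ, F)) (pr₁ I z₀)).source := by
  rw [mem_extChartAt_total_source]
  refine and_iff_right_of_imp fun h => ?_
  exact (mem_extChartAt_total_source.1 h).1

theorem extChartAt_pull_apply {z₀ z : Pull I F V}
    (hz : pr₁ I z ∈ (extChartAt (I.prod 𝓘(ℝ, F)) (pr₁ I z₀)).source) :
    extChartAt ((I.prod 𝓘(ℝ, F)).prod 𝓘(ℝ, F)) z₀ z =
      (extChartAt (I.prod 𝓘(ℝ, F)) (pr₁ I z₀) (pr₁ I z), fibreCoord (pr₁ I z₀).proj (pr₂ I z)) :=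
  extChartAt_total_apply (mem_extChartAt_total_source.1 hz).1

theorem contMDiff_pr₁ : ContMDiff ((I.prod 𝓘(ℝ, F)).prod 𝓘(ℝ, F)) (I.prod 𝓘(ℝ, F)) ∞
    (pr₁ I : Pull I F V → TotalSpace F V) :=
  contMDiff_proj (PullFibre I F V)

theorem contMDiffAt_fibreCoord_pr₂ {z : Pull I F V} {x₀ : N}
    (hz : z.proj.proj ∈ (trivializationAt F V x₀).baseSet) :
    ContMDiffAt ((I.prod 𝓘(ℝ, F)).prod 𝓘(ℝ, F)) 𝓘(ℝ, F) ∞ (fun z => fibreCoord x₀ (pr₂ I z)) z :=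
  ((contMDiffAt_total (V := PullFibre I F V) (f := fun z : Pull I F V => z) (q := z)
    -- Any point over `x₀` would do: the trivialization of the pullback depends only on its foot.
    (x₀ := (⟨x₀, 0⟩ : TotalSpace F V)) hz).1 contMDiffAt_id).2

theorem contMDiff_pr₂ : ContMDiff ((I.prod 𝓘(ℝ, F)).prod 𝓘(ℝ, F)) (I.prod 𝓘(ℝ, F)) ∞
    (pr₂ I : Pull I F V → TotalSpace F V) := fun z =>
  (contMDiffAt_total (f := pr₂ I) (mem_baseSet_trivializationAt F V z.proj.proj)).2
    ⟨(contMDiff_proj (n := ∞) V).comp contMDiff_pr₁ z,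
      contMDiffAt_fibreCoord_pr₂ (mem_baseSet_trivializationAt F V z.proj.proj)⟩

theorem contMDiff_addMap : ContMDiff ((I.prod 𝓘(ℝ, F)).prod 𝓘(ℝ, F)) (I.prod 𝓘(ℝ, F)) ∞
    (addMap I : Pull I F V → TotalSpace F V) := by
  intro z
  have hb := mem_baseSet_trivializationAt F V z.proj.proj
  refine (contMDiffAt_total (f := addMap I) (x₀ := z.proj.proj) hb).2
    ⟨(contMDiff_proj (n := ∞) V).comp contMDiff_pr₁ z, ?_⟩
  have h1 : ContMDiffAt ((I.prod 𝓘(ℝ, F)).prod 𝓘(ℝ, F)) 𝓘(ℝ, F) ∞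
      (fun y : Pull I F V => fibreCoord z.proj.proj (pr₁ I y)) z :=
    ((contMDiffAt_total (f := pr₁ I) (x₀ := z.proj.proj) hb).1 (contMDiff_pr₁ z)).2
  refine (h1.add (contMDiffAt_fibreCoord_pr₂ hb)).congr_of_eventuallyEq ?_
  have hn : ∀ᶠ y : Pull I F V in 𝓝 z,
      y.proj.proj ∈ (trivializationAt F V z.proj.proj).baseSet :=
    ((contMDiff_proj (n := ∞) V).comp contMDiff_pr₁ z).continuousAt.preimage_mem_nhds
      ((trivializationAt F V z.proj.proj).open_baseSet.mem_nhds hb)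
  filter_upwards [hn] with y hy
  exact fibreCoord_add hy _ _

theorem contMDiff_smulMap (r : ℝ) : ContMDiff (I.prod 𝓘(ℝ, F)) (I.prod 𝓘(ℝ, F)) ∞
    (smulMap r : TotalSpace F V → TotalSpace F V) := by
  intro a
  have hb := mem_baseSet_trivializationAt F V a.proj
  refine (contMDiffAt_total (x₀ := a.proj) hb).2 ⟨contMDiff_proj (n := ∞) V a, ?_⟩
  have h1 : ContMDiffAt (I.prod 𝓘(ℝ, F)) 𝓘(ℝ, F) ∞ (fun y => fibreCoord a.proj y) a :=
    ((contMDiffAt_total (x₀ := a.proj) hb).1 contMDiffAt_id).2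
  have h2 : ContMDiffAt (I.prod 𝓘(ℝ, F)) 𝓘(ℝ, F) ∞ (fun y => r • fibreCoord a.proj y) a :=
    ((contDiff_const_smul r).contMDiff (n := ∞)).contMDiffAt.comp a h1
  refine h2.congr_of_eventuallyEq ?_
  have hn : ∀ᶠ y : TotalSpace F V in 𝓝 a, y.proj ∈ (trivializationAt F V a.proj).baseSet :=
    (contMDiff_proj (IB := I) (n := ∞) V a).continuousAt.preimage_mem_nhds
      ((trivializationAt F V a.proj).open_baseSet.mem_nhds hb)
  filter_upwards [hn] with y hy
  exact fibreCoord_smul hy _ _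

theorem eventually_pull_source {z₀ z : Pull I F V}
    (hz : pr₁ I z ∈ (extChartAt (I.prod 𝓘(ℝ, F)) (pr₁ I z₀)).source) :
    ∀ᶠ y in 𝓝 z, pr₁ I y ∈ (extChartAt (I.prod 𝓘(ℝ, F)) (pr₁ I z₀)).source := by
  filter_upwards [(isOpen_extChartAt_source (I := (I.prod 𝓘(ℝ, F)).prod 𝓘(ℝ, F)) z₀).mem_nhds
    (mem_extChartAt_pull_source.2 hz)] with y hy using mem_extChartAt_pull_source.1 hy

section PullDeriv

variable {z₀ z : Pull I F V} (hz : pr₁ I z ∈ (extChartAt (I.prod 𝓘(ℝ, F)) (pr₁ I z₀)).source)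
  (ζ : TangentSpace ((I.prod 𝓘(ℝ, F)).prod 𝓘(ℝ, F)) z)
include hz

theorem chartDeriv_mfderiv_pr₁ :
    chartDeriv (I.prod 𝓘(ℝ, F)) (pr₁ I z₀) (pr₁ I z)
      (mfderiv ((I.prod 𝓘(ℝ, F)).prod 𝓘(ℝ, F)) (I.prod 𝓘(ℝ, F)) (pr₁ I) z ζ) =
    (chartDeriv ((I.prod 𝓘(ℝ, F)).prod 𝓘(ℝ, F)) z₀ z ζ).1 :=
  chartDeriv_mfderiv_proj (mem_extChartAt_pull_source.2 hz) ζ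

/-- In the chart `pr₂` is the continuous linear map `((x, f), g) ↦ (x, g)`, hence its own
derivative. The chart of the total space centred at `pr₁ z₀` also contains `pr₂ z`, which lies in
the same fibre as `pr₁ z`. -/
theorem chartDeriv_mfderiv_pr₂ :
    chartDeriv (I.prod 𝓘(ℝ, F)) (pr₁ I z₀) (pr₂ I z)
      (mfderiv ((I.prod 𝓘(ℝ, F)).prod 𝓘(ℝ, F)) (I.prod 𝓘(ℝ, F)) (pr₂ I) z ζ) =
    ((chartDeriv ((I.prod 𝓘(ℝ, F)).prod 𝓘(ℝ, F)) z₀ z ζ).1.1,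
      (chartDeriv ((I.prod 𝓘(ℝ, F)).prod 𝓘(ℝ, F)) z₀ z ζ).2) := by
  refine chartDeriv_mfderiv (f := pr₂ I) 
    (g := ((ContinuousLinearMap.fst ℝ EN F).comp (ContinuousLinearMap.fst ℝ (EN × F) F)).prod
      (ContinuousLinearMap.snd ℝ (EN × F) F))
    ((contMDiff_pr₂ z).mdifferentiableAt (by simp)) (mem_extChartAt_pull_source.2 hz)
    (mem_extChartAt_total_source_of_proj_eq hz rfl)
    (ContinuousLinearMap.hasFDerivAt _) ?_ ζ
  filter_upwards [eventually_pull_source hz] with y hy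
  rw [extChartAt_pull_apply hy]
  have hb := mem_extChartAt_total_source.1 hy
  rw [extChartAt_total_apply (a := pr₂ I y) hb.1, extChartAt_total_apply (a := pr₁ I y) hb.1]
  rfl

theorem chartDeriv_mfderiv_addMap :
    chartDeriv (I.prod 𝓘(ℝ, F)) (pr₁ I z₀) (addMap I z)
      (mfderiv ((I.prod 𝓘(ℝ, F)).prod 𝓘(ℝ, F)) (I.prod 𝓘(ℝ, F)) (addMap I) z ζ) =
    ((chartDeriv ((I.prod 𝓘(ℝ, F)).prod 𝓘(ℝ, F)) z₀ z ζ).1.1,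
      (chartDeriv ((I.prod 𝓘(ℝ, F)).prod 𝓘(ℝ, F)) z₀ z ζ).1.2 +
      (chartDeriv ((I.prod 𝓘(ℝ, F)).prod 𝓘(ℝ, F)) z₀ z ζ).2) := by
  refine chartDeriv_mfderiv (f := addMap I) 
    (g := ((ContinuousLinearMap.fst ℝ EN F).comp (ContinuousLinearMap.fst ℝ (EN × F) F)).prod
      ((ContinuousLinearMap.snd ℝ EN F).comp (ContinuousLinearMap.fst ℝ (EN × F) F) +
        ContinuousLinearMap.snd ℝ (EN × F) F))
    ((contMDiff_addMap z).mdifferentiableAt (by simp)) (mem_extChartAt_pull_source.2 hz)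
    (mem_extChartAt_total_source_of_proj_eq hz rfl)
    (ContinuousLinearMap.hasFDerivAt _) ?_ ζ
  filter_upwards [eventually_pull_source hz] with y hy
  rw [extChartAt_pull_apply hy]
  have hb := mem_extChartAt_total_source.1 hy
  rw [extChartAt_total_apply (a := addMap I y) hb.1, extChartAt_total_apply (a := pr₁ I y) hb.1]
  exact Prod.ext rfl (fibreCoord_add hb.1 _ _)

/-- The hypothesis is `Tπ v = Tπ w` in coordinates. It makes the vector with coordinates `(v, w₂)` a
solution, so `pair` does not take its default value, and the two projections determine the chosen
solution. -/
theorem chartDeriv_pair {v : TangentSpace (I.prod 𝓘(ℝ, F)) (pr₁ I z)}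
    {w : TangentSpace (I.prod 𝓘(ℝ, F)) (pr₂ I z)}
    (h : (chartDeriv (I.prod 𝓘(ℝ, F)) (pr₁ I z₀) (pr₁ I z) v).1 =
      (chartDeriv (I.prod 𝓘(ℝ, F)) (pr₁ I z₀) (pr₂ I z) w).1) :
    chartDeriv ((I.prod 𝓘(ℝ, F)).prod 𝓘(ℝ, F)) z₀ z (pair I z v w) =
      (chartDeriv (I.prod 𝓘(ℝ, F)) (pr₁ I z₀) (pr₁ I z) v,
        (chartDeriv (I.prod 𝓘(ℝ, F)) (pr₁ I z₀) (pr₂ I z) w).2) := by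
  obtain ⟨ζ, hζ⟩ := chartDeriv_surjective (mem_extChartAt_pull_source.2 hz)
    (chartDeriv (I.prod 𝓘(ℝ, F)) (pr₁ I z₀) (pr₁ I z) v,
        (chartDeriv (I.prod 𝓘(ℝ, F)) (pr₁ I z₀) (pr₂ I z) w).2)
  have hz2 : pr₂ I z ∈ (extChartAt (I.prod 𝓘(ℝ, F)) (pr₁ I z₀)).source :=
    mem_extChartAt_total_source_of_proj_eq hz rfl
  have hex : ∃ ζ : TangentSpace ((I.prod 𝓘(ℝ, F)).prod 𝓘(ℝ, F)) z,
      mfderiv ((I.prod 𝓘(ℝ, F)).prod 𝓘(ℝ, F)) (I.prod 𝓘(ℝ, F)) (pr₁ I) z ζ = v ∧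
      mfderiv ((I.prod 𝓘(ℝ, F)).prod 𝓘(ℝ, F)) (I.prod 𝓘(ℝ, F)) (pr₂ I) z ζ = w := by
    refine ⟨ζ, chartDeriv_injective hz ?_, chartDeriv_injective hz2 ?_⟩
    · rw [chartDeriv_mfderiv_pr₁ hz, hζ]
    · rw [chartDeriv_mfderiv_pr₂ hz, hζ]
      exact Prod.ext h rfl
  unfold pair
  rw [dif_pos hex]
  obtain ⟨h1, h2⟩ := hex.choose_spec
  refine Prod.ext ?_ ?_
  · rw [← chartDeriv_mfderiv_pr₁ hz, h1]
  · have := chartDeriv_mfderiv_pr₂ hz hex.choose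
    rw [h2] at this
    rw [this]

theorem chartDeriv_tAdd {v : TangentSpace (I.prod 𝓘(ℝ, F)) (pr₁ I z)}
    {w : TangentSpace (I.prod 𝓘(ℝ, F)) (pr₂ I z)}
    (h : (chartDeriv (I.prod 𝓘(ℝ, F)) (pr₁ I z₀) (pr₁ I z) v).1 =
      (chartDeriv (I.prod 𝓘(ℝ, F)) (pr₁ I z₀) (pr₂ I z) w).1) :
    chartDeriv (I.prod 𝓘(ℝ, F)) (pr₁ I z₀) (addMap I z) (tAdd I z v w) =
      ((chartDeriv (I.prod 𝓘(ℝ, F)) (pr₁ I z₀) (pr₁ I z) v).1,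
        (chartDeriv (I.prod 𝓘(ℝ, F)) (pr₁ I z₀) (pr₁ I z) v).2 +
        (chartDeriv (I.prod 𝓘(ℝ, F)) (pr₁ I z₀) (pr₂ I z) w).2) := by
  unfold tAdd
  rw [chartDeriv_mfderiv_addMap hz, chartDeriv_pair hz h]

end PullDeriv

theorem chartDeriv_tSmul {a₀ a : TotalSpace F V}
    (ha : a ∈ (extChartAt (I.prod 𝓘(ℝ, F)) a₀).source) (r : ℝ)
    (v : TangentSpace (I.prod 𝓘(ℝ, F)) a) :
    chartDeriv (I.prod 𝓘(ℝ, F)) a₀ (smulMap r a) (tSmul I r a v) =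
      ((chartDeriv (I.prod 𝓘(ℝ, F)) a₀ a v).1, r • (chartDeriv (I.prod 𝓘(ℝ, F)) a₀ a v).2) := by
  refine chartDeriv_mfderiv (f := smulMap r) 
    (g := (ContinuousLinearMap.fst ℝ EN F).prod (r • ContinuousLinearMap.snd ℝ EN F))
    ((contMDiff_smulMap r a).mdifferentiableAt (by simp)) ha
    (mem_extChartAt_total_source_of_proj_eq ha rfl)
    (ContinuousLinearMap.hasFDerivAt _) ?_ v
  filter_upwards [(isOpen_extChartAt_source a₀).mem_nhds ha] with y hy
  have hb := mem_extChartAt_total_source.1 hy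
  rw [extChartAt_total_apply (a := smulMap r y) hb.1, extChartAt_total_apply (a := y) hb.1]
  exact Prod.ext rfl (fibreCoord_smul hb.1 _ _)

end BundleCharts


/-! ### The defining equation of the fibre derivative -/

section FibreDerivCoordinates

variable {EN : Type*} [NormedAddCommGroup EN] [NormedSpace ℝ EN]
  {HN : Type*} [TopologicalSpace HN] {I : ModelWithCorners ℝ EN HN} [I.Boundaryless]
  {N : Type*} [TopologicalSpace N] [ChartedSpace HN N]
  {F : Type*} [NormedAddCommGroup F] [NormedSpace ℝ F]
  {V : N → Type*} [TopologicalSpace (TotalSpace F V)] [∀ x, AddCommMonoid (V x)]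
  [∀ x, Module ℝ (V x)] [∀ x, TopologicalSpace (V x)] [FiberBundle F V]
  [VectorBundle ℝ F V] [IsManifold I ∞ N] [ContMDiffVectorBundle ∞ F V I]

section

variable {z₀ z : Pull I F V} (hz : pr₁ I z ∈ (extChartAt (I.prod 𝓘(ℝ, F)) (pr₁ I z₀)).source)
  (ζ : TangentSpace ((I.prod 𝓘(ℝ, F)).prod 𝓘(ℝ, F)) z)
include hz

theorem chartDeriv_tLineCurve (s : ℝ) :
    chartDeriv (I.prod 𝓘(ℝ, F)) (pr₁ I z₀) (tLineCurve I z ζ s).proj (tLineCurve I z ζ s).snd =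
      (chartDeriv ((I.prod 𝓘(ℝ, F)).prod 𝓘(ℝ, F)) z₀ z ζ).1 +
        s • ((0 : EN), (chartDeriv ((I.prod 𝓘(ℝ, F)).prod 𝓘(ℝ, F)) z₀ z ζ).2) := by
  have hz2 : pr₂ I z ∈ (extChartAt (I.prod 𝓘(ℝ, F)) (pr₁ I z₀)).source :=
    mem_extChartAt_total_source_of_proj_eq hz rfl
  have h1 := chartDeriv_mfderiv_pr₁ hz ζ
  have h2 := chartDeriv_mfderiv_pr₂ hz ζ
  have h3 := chartDeriv_tSmul hz2 s
    (mfderiv ((I.prod 𝓘(ℝ, F)).prod 𝓘(ℝ, F)) (I.prod 𝓘(ℝ, F)) (pr₂ I) z ζ)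
  rw [h2] at h3
  -- The scalar multiplication of `Tπ` does not change the image under `Tπ`, so the two vectors can
  -- be added in `Tπ`.
  have h4 : (chartDeriv (I.prod 𝓘(ℝ, F)) (pr₁ I z₀) (pr₁ I (scaleSnd I s z))
      (mfderiv ((I.prod 𝓘(ℝ, F)).prod 𝓘(ℝ, F)) (I.prod 𝓘(ℝ, F)) (pr₁ I) z ζ)).1 =
      (chartDeriv (I.prod 𝓘(ℝ, F)) (pr₁ I z₀) (pr₂ I (scaleSnd I s z))
      (tSmul I s (pr₂ I z)
        (mfderiv ((I.prod 𝓘(ℝ, F)).prod 𝓘(ℝ, F)) (I.prod 𝓘(ℝ, F)) (pr₂ I) z ζ))).1 :=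
    (congrArg Prod.fst h1).trans (congrArg Prod.fst h3).symm
  have h5 := chartDeriv_tAdd (z := scaleSnd I s z) hz h4
  refine h5.trans (Prod.ext ?_ ?_)
  · exact (congrArg Prod.fst h1).trans (by simp)
  · refine (congrArg₂ (· + ·) (congrArg Prod.snd h1) (congrArg Prod.snd h3)).trans (by simp)

theorem tLineCurve_proj_mem (s : ℝ) :
    (tLineCurve I z ζ s).proj ∈ (extChartAt (I.prod 𝓘(ℝ, F)) (pr₁ I z₀)).source :=
  mem_extChartAt_total_source_of_proj_eq hz rfl

theorem extChartAt_tLineCurve_proj (s : ℝ) :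
    extChartAt (I.prod 𝓘(ℝ, F)) (pr₁ I z₀) (tLineCurve I z ζ s).proj =
      extChartAt (I.prod 𝓘(ℝ, F)) (pr₁ I z₀) (pr₁ I z) +
        s • ((0 : EN), fibreCoord (pr₁ I z₀).proj (pr₂ I z)) :=
  extChartAt_lineCurve hz (sndVec I z) s

theorem mdifferentiableAt_tLineCurve :
    MDifferentiableAt 𝓘(ℝ, ℝ) (I.prod 𝓘(ℝ, F)).tangent (tLineCurve I z ζ) 0 := by
  refine ContMDiffAt.mdifferentiableAt (n := ∞) ?_ (by simp)
  refine (contMDiffAt_tangentBundle (tLineCurve_proj_mem hz ζ 0)).2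
    ⟨contMDiff_lineCurve (pr₁ I z) (sndVec I z) 0, ?_⟩
  simp only [chartDeriv_tLineCurve hz]
  exact ContDiffAt.contMDiffAt (by fun_prop)

theorem tangentCoord_tLineCurve (s : ℝ) :
    tangentCoord (I.prod 𝓘(ℝ, F)) (pr₁ I z₀) (tLineCurve I z ζ s) =
      (extChartAt (I.prod 𝓘(ℝ, F)) (pr₁ I z₀) (pr₁ I z),
        chartDeriv ((I.prod 𝓘(ℝ, F)).prod 𝓘(ℝ, F)) z₀ z ζ |>.1) +
      s • (((0 : EN), fibreCoord (pr₁ I z₀).proj (pr₂ I z)),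
        ((0 : EN), (chartDeriv ((I.prod 𝓘(ℝ, F)).prod 𝓘(ℝ, F)) z₀ z ζ).2)) := by
  unfold tangentCoord
  rw [extChartAt_tLineCurve_proj hz ζ s, chartDeriv_tLineCurve hz ζ s]
  rfl

/-- The curve is affine in `s`, so its velocity is its direction. The velocity no longer shows the
first component of `ζ`, which is recovered from the foot point of the lift. -/
theorem tangentCoordDeriv_tVertLift :
    tangentCoordDeriv (I.prod 𝓘(ℝ, F)) (pr₁ I z₀) (tVertLift I z ζ) =
    (((0 : EN), fibreCoord (pr₁ I z₀).proj (pr₂ I z)),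
      ((0 : EN), (chartDeriv ((I.prod 𝓘(ℝ, F)).prod 𝓘(ℝ, F)) z₀ z ζ).2)) := by
  refine tangentCoordDeriv_curve (mdifferentiableAt_tLineCurve hz ζ)
    (tLineCurve_proj_mem hz ζ 0) ?_
  simp only [tangentCoord_tLineCurve hz ζ]
  have h := ((hasDerivAt_id (0 : ℝ)).smul_const
    (((0 : EN), fibreCoord (pr₁ I z₀).proj (pr₂ I z)),
      ((0 : EN), (chartDeriv ((I.prod 𝓘(ℝ, F)).prod 𝓘(ℝ, F)) z₀ z ζ).2))).const_add
    (extChartAt (I.prod 𝓘(ℝ, F)) (pr₁ I z₀) (pr₁ I z),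
        (chartDeriv ((I.prod 𝓘(ℝ, F)).prod 𝓘(ℝ, F)) z₀ z ζ).1)
  rw [one_smul] at h
  exact h

end

/-- The defining equation of the fibre derivative in coordinates. -/
theorem isFibreDerivAt_iff {Y : ∀ a : TotalSpace F V, TangentSpace (I.prod 𝓘(ℝ, F)) a}
    (hY : IsSmoothVF (I.prod 𝓘(ℝ, F)) Y) {z₀ z : Pull I F V}
    (hz : pr₁ I z ∈ (extChartAt (I.prod 𝓘(ℝ, F)) (pr₁ I z₀)).source)
    (ζ : TangentSpace ((I.prod 𝓘(ℝ, F)).prod 𝓘(ℝ, F)) z) :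
    IsFibreDerivAt I Y z ζ ↔
      (chartDeriv ((I.prod 𝓘(ℝ, F)).prod 𝓘(ℝ, F)) z₀ z ζ).1 =
        chartDeriv (I.prod 𝓘(ℝ, F)) (pr₁ I z₀) (pr₁ I z) (Y (pr₁ I z)) ∧
      ((0 : EN), (chartDeriv ((I.prod 𝓘(ℝ, F)).prod 𝓘(ℝ, F)) z₀ z ζ).2) =
        fderiv ℝ (vfRep (I.prod 𝓘(ℝ, F)) (pr₁ I z₀) Y)
          (extChartAt (I.prod 𝓘(ℝ, F)) (pr₁ I z₀) (pr₁ I z))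
          ((0 : EN), fibreCoord (pr₁ I z₀).proj (pr₂ I z)) := by
  unfold IsFibreDerivAt
  rw [doubleTangent_ext_iff (p₀ := pr₁ I z₀) (tLineCurve_proj_mem hz ζ 0) hz,
    tangentCoordDeriv_tVertLift hz, tangentCoordDeriv_vectorField hY hz]
  have h3 : tangentCoord (I.prod 𝓘(ℝ, F)) (pr₁ I z₀) (tVertLift I z ζ).proj = _ :=
    tangentCoord_tLineCurve hz ζ 0
  rw [zero_smul, add_zero] at h3
  have h4 : chartDeriv (I.prod 𝓘(ℝ, F)) (pr₁ I z₀) (pr₁ I z)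
      (vertLift I (pr₁ I z) (sndVec I z)) =
      ((0 : EN), fibreCoord (pr₁ I z₀).proj (pr₂ I z)) := chartDeriv_vertLift hz _
  rw [h3, h4]
  unfold tangentCoord
  simp only [Prod.mk.injEq]
  constructor
  -- The discarded equations say that both sides lie over the same point and have the same vertical
  -- velocity there, which is automatic.
  · rintro ⟨⟨-, h1⟩, -, h2⟩
    exact ⟨h1, h2⟩
  · rintro ⟨h1, h2⟩
    exact ⟨⟨rfl, h1⟩, trivial, h2⟩

/-! ### Projectable vector fields in coordinates -/

theorem ProjectsTo.chartDeriv_fst {Y : ∀ a : TotalSpace F V, TangentSpace (I.prod 𝓘(ℝ, F)) a}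
    {X : ∀ x : N, TangentSpace I x} (h : ProjectsTo I Y X) {a₀ a : TotalSpace F V}
    (ha : a ∈ (extChartAt (I.prod 𝓘(ℝ, F)) a₀).source) :
    (chartDeriv (I.prod 𝓘(ℝ, F)) a₀ a (Y a)).1 = chartDeriv I a₀.proj a.proj (X a.proj) := by
  rw [← chartDeriv_mfderiv_proj ha, h a]

theorem projectsTo_of_chartDeriv {Y : ∀ a : TotalSpace F V, TangentSpace (I.prod 𝓘(ℝ, F)) a}
    {X : ∀ x : N, TangentSpace I x}
    (h : ∀ a, (chartDeriv (I.prod 𝓘(ℝ, F)) a a (Y a)).1 = chartDeriv I a.proj a.proj (X a.proj)) :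
    ProjectsTo I Y X := by
  intro a
  refine chartDeriv_injective (p₀ := a.proj) (mem_extChartAt_source _) ?_
  exact (chartDeriv_mfderiv_proj (mem_extChartAt_source a) _).trans (h a)

theorem ProjectsTo.vfRep_fst {Y : ∀ a : TotalSpace F V, TangentSpace (I.prod 𝓘(ℝ, F)) a}
    {X : ∀ x : N, TangentSpace I x} (h : ProjectsTo I Y X) {a₀ : TotalSpace F V} {x : EN × F}
    (hx : x ∈ (extChartAt (I.prod 𝓘(ℝ, F)) a₀).target) :
    (vfRep (I.prod 𝓘(ℝ, F)) a₀ Y x).1 = vfRep I a₀.proj X x.1 := by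
  have hs := (extChartAt (I.prod 𝓘(ℝ, F)) a₀).map_target hx
  have h1 := extChartAt_total_fst hs
  rw [(extChartAt (I.prod 𝓘(ℝ, F)) a₀).right_inv hx] at h1
  rw [h1, vfRep_extChartAt _ (mem_extChartAt_total_source.1 hs).2]
  exact h.chartDeriv_fst hs

theorem mem_target_fst {a₀ : TotalSpace F V} {x : EN × F}
    (hx : x ∈ (extChartAt (I.prod 𝓘(ℝ, F)) a₀).target) :
    x.1 ∈ (extChartAt I a₀.proj).target := by
  rw [FiberBundle.extChartAt_target] at hx
  exact hx.1.1

/-- Differentiate `y₁(x, f) = X(x)`, which holds on the open target of the chart. -/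
theorem fderiv_vfRep_fst {Y : ∀ a : TotalSpace F V, TangentSpace (I.prod 𝓘(ℝ, F)) a}
    (hY : IsSmoothVF (I.prod 𝓘(ℝ, F)) Y)
    {X : ∀ x : N, TangentSpace I x} (hX : IsSmoothVF I X) (h : ProjectsTo I Y X)
    {a₀ : TotalSpace F V} {x : EN × F}
    (hx : x ∈ (extChartAt (I.prod 𝓘(ℝ, F)) a₀).target) (v : EN × F) :
    (fderiv ℝ (vfRep (I.prod 𝓘(ℝ, F)) a₀ Y) x v).1 = fderiv ℝ (vfRep I a₀.proj X) x.1 v.1 := by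
  have h1 : HasFDerivAt (fun y => (vfRep (I.prod 𝓘(ℝ, F)) a₀ Y y).1)
      ((ContinuousLinearMap.fst ℝ EN F).comp (fderiv ℝ (vfRep (I.prod 𝓘(ℝ, F)) a₀ Y) x)) x :=
    (ContinuousLinearMap.fst ℝ EN F).hasFDerivAt.comp x
      ((hY.contDiffAt_vfRep hx).differentiableAt (by simp)).hasFDerivAt
  have h2 : HasFDerivAt (fun y : EN × F => vfRep I a₀.proj X y.1)
      ((fderiv ℝ (vfRep I a₀.proj X) x.1).comp (ContinuousLinearMap.fst ℝ EN F)) x :=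
    HasFDerivAt.comp x ((hX.contDiffAt_vfRep (mem_target_fst hx)).differentiableAt
      (by simp)).hasFDerivAt (ContinuousLinearMap.fst ℝ EN F).hasFDerivAt
  refine DFunLike.congr_fun (h1.unique (h2.congr_of_eventuallyEq ?_)) v
  filter_upwards [(isOpen_extChartAt_target a₀).mem_nhds hx] with y hy using h.vfRep_fst hy

/-- This is the solvability condition for the equation of the fibre derivative: `y₁` is constant
along fibres, so `Dy` preserves vertical vectors. -/
theorem fderiv_vfRep_vertical {Y : ∀ a : TotalSpace F V, TangentSpace (I.prod 𝓘(ℝ, F)) a}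
    (hY : IsProjectable I Y) {a₀ : TotalSpace F V} {x : EN × F}
    (hx : x ∈ (extChartAt (I.prod 𝓘(ℝ, F)) a₀).target) (f : F) :
    (fderiv ℝ (vfRep (I.prod 𝓘(ℝ, F)) a₀ Y) x (0, f)).1 = 0 := by
  obtain ⟨hs, X, hX, h⟩ := hY
  rw [fderiv_vfRep_fst hs hX h hx, map_zero]

/-! ### The fibre derivative in coordinates -/

section

variable {Y : ∀ a : TotalSpace F V, TangentSpace (I.prod 𝓘(ℝ, F)) a} (hY : IsProjectable I Y)
include hY

theorem exists_isFibreDerivAt (z : Pull I F V) : ∃ ζ, IsFibreDerivAt I Y z ζ := by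
  have hz := mem_extChartAt_source (I := I.prod 𝓘(ℝ, F)) (pr₁ I z)
  obtain ⟨ζ, hζ⟩ := chartDeriv_surjective (p₀ := z) (mem_extChartAt_pull_source.2 hz)
    (chartDeriv (I.prod 𝓘(ℝ, F)) (pr₁ I z) (pr₁ I z) (Y (pr₁ I z)),
      (fderiv ℝ (vfRep (I.prod 𝓘(ℝ, F)) (pr₁ I z) Y)
          (extChartAt (I.prod 𝓘(ℝ, F)) (pr₁ I z) (pr₁ I z))
          ((0 : EN), fibreCoord (pr₁ I z).proj (pr₂ I z))).2)
  refine ⟨ζ, (isFibreDerivAt_iff hY.1 hz ζ).2 ?_⟩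
  rw [hζ]
  exact ⟨rfl, Prod.ext (fderiv_vfRep_vertical hY
    (mem_extChartAt_target (I := I.prod 𝓘(ℝ, F)) (pr₁ I z)) _).symm rfl⟩

theorem isFibreDerivAt_fibreDeriv (z : Pull I F V) :
    IsFibreDerivAt I Y z (fibreDeriv I Y z) := by
  unfold fibreDeriv
  rw [dif_pos (exists_isFibreDerivAt hY z)]
  exact (exists_isFibreDerivAt hY z).choose_spec

theorem isFibreDerivAt_unique {z : Pull I F V}
    {ζ ζ' : TangentSpace ((I.prod 𝓘(ℝ, F)).prod 𝓘(ℝ, F)) z}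
    (h : IsFibreDerivAt I Y z ζ) (h' : IsFibreDerivAt I Y z ζ') : ζ = ζ' := by
  have hz := mem_extChartAt_source (I := I.prod 𝓘(ℝ, F)) (pr₁ I z)
  have h1 := (isFibreDerivAt_iff hY.1 hz ζ).1 h
  have h2 := (isFibreDerivAt_iff hY.1 hz ζ').1 h'
  exact chartDeriv_injective (mem_extChartAt_pull_source.2 hz)
    (Prod.ext (h1.1.trans h2.1.symm) (Prod.mk.inj (h1.2.trans h2.2.symm)).2)

theorem chartDeriv_fibreDeriv {z₀ z : Pull I F V}
    (hz : pr₁ I z ∈ (extChartAt (I.prod 𝓘(ℝ, F)) (pr₁ I z₀)).source) :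
    chartDeriv ((I.prod 𝓘(ℝ, F)).prod 𝓘(ℝ, F)) z₀ z (fibreDeriv I Y z) =
      (chartDeriv (I.prod 𝓘(ℝ, F)) (pr₁ I z₀) (pr₁ I z) (Y (pr₁ I z)),
        (fderiv ℝ (vfRep (I.prod 𝓘(ℝ, F)) (pr₁ I z₀) Y)
          (extChartAt (I.prod 𝓘(ℝ, F)) (pr₁ I z₀) (pr₁ I z))
          ((0 : EN), fibreCoord (pr₁ I z₀).proj (pr₂ I z))).2) := by
  have h := (isFibreDerivAt_iff hY.1 hz _).1 (isFibreDerivAt_fibreDeriv hY z)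
  exact Prod.ext h.1 (congrArg (Prod.snd : EN × F → F) h.2)

end

/-- The coordinate expression of the fibre derivative of a vector field. -/
noncomputable def fibreDerivRep {E₁ F : Type*} [NormedAddCommGroup E₁] [NormedSpace ℝ E₁]
    [NormedAddCommGroup F] [NormedSpace ℝ F] (y : E₁ × F → E₁ × F) (x : (E₁ × F) × F) :
    (E₁ × F) × F :=
  (y x.1, (fderiv ℝ y x.1 (0, x.2)).2)

theorem contDiffAt_fibreDerivRep {E₁ F : Type*} [NormedAddCommGroup E₁] [NormedSpace ℝ E₁]
    [NormedAddCommGroup F] [NormedSpace ℝ F] {y : E₁ × F → E₁ × F} {x : (E₁ × F) × F}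
    (hy : ContDiffAt ℝ ∞ y x.1) : ContDiffAt ℝ ∞ (fibreDerivRep y) x := by
  have h0 : ContDiffAt ℝ ∞ (fun x : (E₁ × F) × F => y x.1) x := hy.comp x contDiffAt_fst
  have h1 : ContDiffAt ℝ ∞ (fun x : (E₁ × F) × F => fderiv ℝ y x.1) x :=
    (hy.fderiv_right (m := ∞) (by simp)).comp x contDiffAt_fst
  have h2 : ContDiffAt ℝ ∞ (fun x : (E₁ × F) × F => ((0 : E₁), x.2)) x :=
    contDiffAt_const.prodMk contDiffAt_snd
  exact h0.prodMk (contDiffAt_snd.comp x (h1.clm_apply h2))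

theorem chartDeriv_fibreDeriv_eq_fibreDerivRep
    {Y : ∀ a : TotalSpace F V, TangentSpace (I.prod 𝓘(ℝ, F)) a} (hY : IsProjectable I Y)
    {z₀ z : Pull I F V} (hz : pr₁ I z ∈ (extChartAt (I.prod 𝓘(ℝ, F)) (pr₁ I z₀)).source) :
    chartDeriv ((I.prod 𝓘(ℝ, F)).prod 𝓘(ℝ, F)) z₀ z (fibreDeriv I Y z) =
      fibreDerivRep (vfRep (I.prod 𝓘(ℝ, F)) (pr₁ I z₀) Y)
        (extChartAt ((I.prod 𝓘(ℝ, F)).prod 𝓘(ℝ, F)) z₀ z) := by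
  rw [chartDeriv_fibreDeriv hY hz, extChartAt_pull_apply hz, ← vfRep_extChartAt _ hz]
  rfl

theorem isSmoothVF_fibreDeriv {Y : ∀ a : TotalSpace F V, TangentSpace (I.prod 𝓘(ℝ, F)) a}
    (hY : IsProjectable I Y) : IsSmoothVF ((I.prod 𝓘(ℝ, F)).prod 𝓘(ℝ, F)) (fibreDeriv I Y) := by
  refine isSmoothVF_of_chartDeriv fun z₀ =>
    ⟨fibreDerivRep (vfRep (I.prod 𝓘(ℝ, F)) (pr₁ I z₀) Y), ?_, ?_⟩
  · have hz := mem_extChartAt_source (I := I.prod 𝓘(ℝ, F)) (pr₁ I z₀)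
    refine contDiffAt_fibreDerivRep (hY.1.contDiffAt_vfRep ?_)
    rw [extChartAt_pull_apply hz]
    exact (extChartAt (I.prod 𝓘(ℝ, F)) (pr₁ I z₀)).map_source hz
  · filter_upwards [eventually_pull_source
      (mem_extChartAt_source (I := I.prod 𝓘(ℝ, F)) (pr₁ I z₀))] with z hz
    exact chartDeriv_fibreDeriv_eq_fibreDerivRep hY hz

theorem projectsTo_fibreDeriv {Y : ∀ a : TotalSpace F V, TangentSpace (I.prod 𝓘(ℝ, F)) a}
    (hY : IsProjectable I Y) :
    ProjectsTo (F := F) (V := PullFibre I F V) (I.prod 𝓘(ℝ, F)) (fibreDeriv I Y) Y := by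
  refine projectsTo_of_chartDeriv (I := I.prod 𝓘(ℝ, F)) (V := PullFibre I F V) fun z => ?_
  rw [chartDeriv_fibreDeriv hY (mem_extChartAt_source (I := I.prod 𝓘(ℝ, F)) (pr₁ I z))]
  rfl

/-- The fibre derivative of a projectable vector field is a linear vector field. -/
theorem isLinearVF_fibreDeriv {Y : ∀ a : TotalSpace F V, TangentSpace (I.prod 𝓘(ℝ, F)) a}
    (hY : IsProjectable I Y) :
    IsLinearVF (F := F) (V := PullFibre I F V) (I.prod 𝓘(ℝ, F)) (fibreDeriv I Y) Y where
  smooth := isSmoothVF_fibreDeriv hY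
  smooth_base := hY.1
  projectsTo := projectsTo_fibreDeriv hY
  map_add := fun z => by
    -- Here `z` is a pair of points `(a, b)`, `(a, b')` of the pullback bundle. These and `(a, b +
    -- b')` lie over the same `a`, so one chart serves all three.
    have hz := mem_extChartAt_source (I := I.prod 𝓘(ℝ, F)) (pr₁ I (pr₁ (I.prod 𝓘(ℝ, F)) z))
    have hz' := mem_extChartAt_pull_source (z₀ := pr₁ (I.prod 𝓘(ℝ, F)) z).2 hz
    have h1 := chartDeriv_fibreDeriv hY (z₀ := pr₁ (I.prod 𝓘(ℝ, F)) z)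
      (z := pr₁ (I.prod 𝓘(ℝ, F)) z) hz
    have h2 := chartDeriv_fibreDeriv hY (z₀ := pr₁ (I.prod 𝓘(ℝ, F)) z)
      (z := pr₂ (I.prod 𝓘(ℝ, F)) z) hz
    have h3 := chartDeriv_fibreDeriv hY (z₀ := pr₁ (I.prod 𝓘(ℝ, F)) z)
      (z := addMap (I.prod 𝓘(ℝ, F)) z) hz
    refine chartDeriv_injective (p₀ := pr₁ (I.prod 𝓘(ℝ, F)) z) (p := addMap (I.prod 𝓘(ℝ, F)) z)
      (mem_extChartAt_total_source_of_proj_eq hz' rfl) ?_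
    have h4 := chartDeriv_tAdd (I := I.prod 𝓘(ℝ, F)) (z₀ := z) (z := z) hz'
      (v := fibreDeriv I Y (pr₁ (I.prod 𝓘(ℝ, F)) z)) (w := fibreDeriv I Y (pr₂ (I.prod 𝓘(ℝ, F)) z))
      ((congrArg Prod.fst h1).trans (congrArg Prod.fst h2).symm)
    refine h3.trans (Eq.trans (Prod.ext ?_ ?_) h4.symm)
    · exact (congrArg Prod.fst h1).symm
    · refine Eq.trans ?_ (congrArg₂ (· + ·) (congrArg Prod.snd h1) (congrArg Prod.snd h2)).symm
      have h5 : fibreCoord (pr₁ I (pr₁ (I.prod 𝓘(ℝ, F)) z)).proj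
          (pr₂ I (addMap (I.prod 𝓘(ℝ, F)) z)) =
          fibreCoord (pr₁ I (pr₁ (I.prod 𝓘(ℝ, F)) z)).proj (pr₂ I (pr₁ (I.prod 𝓘(ℝ, F)) z)) +
          fibreCoord (pr₁ I (pr₁ (I.prod 𝓘(ℝ, F)) z)).proj (pr₂ I (pr₂ (I.prod 𝓘(ℝ, F)) z)) :=
        fibreCoord_add (mem_extChartAt_total_source.1 hz).1 _ _
      rw [h5]
      have h6 : ∀ f g : F, ((0 : EN), f + g) = (0, f) + (0, g) := fun f g => by simp
      -- Additivity of `𝓕Y` is linearity of `Dy` on vertical vectors.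
      rw [h6, map_add]
      rfl
  map_smul := fun r z => by
    have hz := mem_extChartAt_source (I := I.prod 𝓘(ℝ, F)) (pr₁ I z)
    have hz' := mem_extChartAt_pull_source (z₀ := z).2 hz
    have h1 := chartDeriv_fibreDeriv hY (z₀ := z) (z := z) hz
    have h3 := chartDeriv_fibreDeriv hY (z₀ := z) (z := smulMap r z) hz
    refine chartDeriv_injective (p₀ := z) (p := smulMap r z)
      (mem_extChartAt_total_source_of_proj_eq hz' rfl) ?_
    have h4 := chartDeriv_tSmul (I := I.prod 𝓘(ℝ, F)) (V := PullFibre I F V) hz' r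
      (fibreDeriv I Y z)
    refine h3.trans (Eq.trans (Prod.ext ?_ ?_) h4.symm)
    · exact (congrArg Prod.fst h1).symm
    · refine Eq.trans ?_ (congrArg (r • ·) (congrArg Prod.snd h1)).symm
      have h5 : fibreCoord (pr₁ I z).proj (pr₂ I (smulMap r z)) =
          r • fibreCoord (pr₁ I z).proj (pr₂ I z) :=
        fibreCoord_smul (mem_extChartAt_total_source.1 hz).1 _ _
      rw [h5]
      have h6 : ∀ f : F, ((0 : EN), r • f) = r • (0, f) := fun f => by simp
      rw [h6, map_smul]
      rfl

end FibreDerivCoordinates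


/-! ### Integral curves -/

section IntegralCurves

variable {EP : Type*} [NormedAddCommGroup EP] [NormedSpace ℝ EP]
  {HP : Type*} [TopologicalSpace HP] {I : ModelWithCorners ℝ EP HP}
  {P : Type*} [TopologicalSpace P] [ChartedSpace HP P]

/-- The uniqueness theorem for integral curves is stated on `Ioo a b`. Openness provides points of
`J` on both sides of `s` and of `t`, and order-connectedness fills the gaps. -/
theorem exists_Ioo_subset {J : Set ℝ} (hJ : IsOpen J) (hc : OrdConnected J) {s t : ℝ} (hs : s ∈ J)
    (ht : t ∈ J) : ∃ a b, s ∈ Ioo a b ∧ t ∈ Ioo a b ∧ Ioo a b ⊆ J := by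
  have key : ∀ r ∈ J, ∃ a b, a ∈ J ∧ b ∈ J ∧ a < r ∧ r < b := by
    intro r hr
    obtain ⟨ε, hε, h⟩ := Metric.isOpen_iff.1 hJ r hr
    refine ⟨r - ε / 2, r + ε / 2, h ?_, h ?_, by linarith, by linarith⟩ <;>
      simp only [Metric.mem_ball, Real.dist_eq]
    · rw [abs_lt]; constructor <;> linarith
    · rw [abs_lt]; constructor <;> linarith
  obtain ⟨a, b, ha, hb, h1, h2⟩ := key s hs
  obtain ⟨a', b', ha', hb', h1', h2'⟩ := key t ht
  refine ⟨min a a', max b b', ⟨min_lt_of_left_lt h1, lt_max_of_lt_left h2⟩,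
    ⟨min_lt_of_right_lt h1', lt_max_of_lt_right h2'⟩, Ioo_subset_Icc_self.trans (hc.out ?_ ?_)⟩
  · rcases min_choice a a' with h | h <;> rwa [h]
  · rcases max_choice b b' with h | h <;> rwa [h]

theorem hasMFDerivAt_of_isMIntegralCurveOn {Z : ∀ p : P, TangentSpace I p} {γ : ℝ → P} {J : Set ℝ}
    (h : IsMIntegralCurveOn (I := I) γ Z J) (hJ : IsOpen J) {t : ℝ} (ht : t ∈ J) :
    HasMFDerivAt 𝓘(ℝ, ℝ) I γ t ((1 : ℝ →L[ℝ] ℝ).smulRight (Z (γ t))) :=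
  (h t ht).hasMFDerivAt (hJ.mem_nhds ht)

theorem mfderiv_of_isMIntegralCurveOn {Z : ∀ p : P, TangentSpace I p} {γ : ℝ → P} {J : Set ℝ}
    (h : IsMIntegralCurveOn (I := I) γ Z J) (hJ : IsOpen J) {t : ℝ} (ht : t ∈ J) :
    mfderiv 𝓘(ℝ, ℝ) I γ t (1 : ℝ) = Z (γ t) := by
  rw [(hasMFDerivAt_of_isMIntegralCurveOn h hJ ht).mfderiv]
  exact one_smul ℝ (Z (γ t))

variable [IsManifold I ∞ P]

theorem hasDerivAt_extChartAt_of_isMIntegralCurveOn {Z : ∀ p : P, TangentSpace I p} {γ : ℝ → P}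
    {J : Set ℝ} (h : IsMIntegralCurveOn (I := I) γ Z J) (hJ : IsOpen J) {t : ℝ} (ht : t ∈ J)
    {p₀ : P} (hs : γ t ∈ (extChartAt I p₀).source) :
    HasDerivAt (fun s => extChartAt I p₀ (γ s)) (chartDeriv I p₀ (γ t) (Z (γ t))) t := by
  have h1 := chartDeriv_mfderiv_curve
    (hasMFDerivAt_of_isMIntegralCurveOn h hJ ht).mdifferentiableAt hs
  rwa [mfderiv_of_isMIntegralCurveOn h hJ ht] at h1

variable [I.Boundaryless]

theorem eq_of_isMIntegralCurveOn [T2Space P] {Z : ∀ p : P, TangentSpace I p}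
    (hZ : IsSmoothVF I Z) {γ γ' : ℝ → P} {J J' : Set ℝ} (hJ : IsOpen J) (hJ' : IsOpen J')
    (hc : OrdConnected J) (hc' : OrdConnected J') (h : IsMIntegralCurveOn (I := I) γ Z J)
    (h' : IsMIntegralCurveOn (I := I) γ' Z J') (h0 : (0 : ℝ) ∈ J) (h0' : (0 : ℝ) ∈ J')
    (he : γ 0 = γ' 0) {s : ℝ} (hs : s ∈ J) (hs' : s ∈ J') : γ s = γ' s := by
  obtain ⟨a, b, h1, h2, h3⟩ := exists_Ioo_subset (hJ.inter hJ') (hc.inter hc')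
    ⟨h0, h0'⟩ ⟨hs, hs'⟩
  exact isMIntegralCurveOn_Ioo_eqOn_of_contMDiff_boundaryless h1
    (ContMDiff.of_le hZ (by norm_cast)) (h.mono (h3.trans inter_subset_left))
    (h'.mono (h3.trans inter_subset_right)) he h2

/-- Uniqueness of integral curves makes the value independent of the curve chosen in `flowMap`. -/
theorem flowMap_eq [T2Space P] {Z : ∀ p : P, TangentSpace I p}
    (hZ : IsSmoothVF I Z) {γ : ℝ → P} {J : Set ℝ} (hJ : IsOpen J)
    (hc : OrdConnected J) (h : IsMIntegralCurveOn (I := I) γ Z J) (h0 : (0 : ℝ) ∈ J)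
    {s : ℝ} (hs : s ∈ J) {p : P} (hp : γ 0 = p) : flowMap I Z s p = γ s := by
  have hex : ∃ (γ : ℝ → P) (J : Set ℝ), IsOpen J ∧ OrdConnected J ∧ (0 : ℝ) ∈ J ∧ s ∈ J ∧ γ 0 = p ∧
      IsMIntegralCurveOn (I := I) γ Z J := ⟨γ, J, hJ, hc, h0, hs, hp, h⟩
  unfold flowMap
  rw [dif_pos hex]
  obtain ⟨J', hJ', hc', h0', hs', hp', h'⟩ := hex.choose_spec
  exact eq_of_isMIntegralCurveOn hZ hJ' hJ hc' hc h' h h0' h0 (hp'.trans hp.symm) hs' hs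

/-- A local flow in coordinates. -/
noncomputable def flowRep (I : ModelWithCorners ℝ EP HP) (φ : ℝ → P → P) (p₀ q₀ : P)
    (x : ℝ × EP) : EP :=
  extChartAt I q₀ (φ x.1 ((extChartAt I p₀).symm x.2))

section FlowCoordinates

variable {Z : ∀ p : P, TangentSpace I p} {D : Set (ℝ × P)} {φ : ℝ → P → P}
  (hφ : IsLocalFlow I Z D φ)
include hφ

theorem IsLocalFlow.isOpen_slice (p : P) : IsOpen {s : ℝ | (s, p) ∈ D} :=
  hφ.isOpen.preimage (by fun_prop)

theorem IsLocalFlow.contMDiffAt_uncurry {s : ℝ} {p : P} (h : (s, p) ∈ D) :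
    ContMDiffAt (𝓘(ℝ, ℝ).prod I) I ∞ (fun q : ℝ × P => φ q.1 q.2) (s, p) :=
  hφ.smooth.contMDiffAt (hφ.isOpen.mem_nhds h)

theorem IsLocalFlow.contMDiffAt {s : ℝ} {p : P} (h : (s, p) ∈ D) :
    ContMDiffAt I I ∞ (φ s) p :=
  (hφ.contMDiffAt_uncurry h).comp p (contMDiffAt_const.prodMk contMDiffAt_id)

variable {p₀ q₀ p : P} {s : ℝ} (h : (s, p) ∈ D) (hp : p ∈ (extChartAt I p₀).source)
  (hq : φ s p ∈ (extChartAt I q₀).source)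
include h hp hq

theorem IsLocalFlow.contDiffAt_flowRep :
    ContDiffAt ℝ ∞ (flowRep I φ p₀ q₀) (s, extChartAt I p₀ p) := by
  have h1 : ContMDiffAt 𝓘(ℝ, ℝ × EP) (𝓘(ℝ, ℝ).prod I) ∞
      (fun x : ℝ × EP => (x.1, (extChartAt I p₀).symm x.2)) (s, extChartAt I p₀ p) :=
    contDiffAt_fst.contMDiffAt.prodMk
      (ContMDiffAt.comp (s, extChartAt I p₀ p) (f := Prod.snd)
        (contMDiffAt_extChartAt_symm ((extChartAt I p₀).map_source hp)) contDiffAt_snd.contMDiffAt)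
  have e1 : (extChartAt I p₀).symm (extChartAt I p₀ p) = p := (extChartAt I p₀).left_inv hp
  have h2 : ContMDiffAt 𝓘(ℝ, ℝ × EP) I ∞
      (fun x : ℝ × EP => φ x.1 ((extChartAt I p₀).symm x.2)) (s, extChartAt I p₀ p) :=
    ContMDiffAt.comp_of_eq (hφ.contMDiffAt_uncurry h) h1 (by rw [e1])
  have h3 : ContMDiffAt 𝓘(ℝ, ℝ × EP) 𝓘(ℝ, EP) ∞ (flowRep I φ p₀ q₀) (s, extChartAt I p₀ p) :=
    ContMDiffAt.comp_of_eq (contMDiffAt_extChartAt_of_mem hq) h2 (by rw [e1])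
  exact h3.contDiffAt

/-- The space derivative is written as the full derivative of `flowRep` in the direction `(0, v)`,
so that it can later be differentiated in time by exchanging mixed derivatives. -/
theorem IsLocalFlow.chartDeriv_mfderiv_flow (v : TangentSpace I p) :
    chartDeriv I q₀ (φ s p) (mfderiv I I (φ s) p v) =
      fderiv ℝ (flowRep I φ p₀ q₀) (s, extChartAt I p₀ p) (0, chartDeriv I p₀ p v) := by
  have h1 := ((hφ.contDiffAt_flowRep h hp hq).differentiableAt (by simp)).hasFDerivAt
  have h2 : HasFDerivAt (fun x : EP => flowRep I φ p₀ q₀ (s, x))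
      ((fderiv ℝ (flowRep I φ p₀ q₀) (s, extChartAt I p₀ p)).comp (ContinuousLinearMap.inr ℝ ℝ EP))
      (extChartAt I p₀ p) :=
    h1.comp (extChartAt I p₀ p) (hasFDerivAt_prodMk_right s (extChartAt I p₀ p))
  refine chartDeriv_mfderiv ((hφ.contMDiffAt h).mdifferentiableAt (by simp)) hp hq h2 ?_ v
  filter_upwards [(isOpen_extChartAt_source p₀).mem_nhds hp] with x hx
  unfold flowRep
  rw [(extChartAt I p₀).left_inv hx]

theorem IsLocalFlow.hasDerivAt_flowRep :
    HasDerivAt (fun t => flowRep I φ p₀ q₀ (t, extChartAt I p₀ p))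
      (vfRep I q₀ Z (flowRep I φ p₀ q₀ (s, extChartAt I p₀ p))) s := by
  have h1 := hasDerivAt_extChartAt_of_isMIntegralCurveOn (hφ.integralCurve p)
    (hφ.isOpen_slice p) h hq
  have e : ∀ t, flowRep I φ p₀ q₀ (t, extChartAt I p₀ p) = extChartAt I q₀ (φ t p) := fun t => by
    unfold flowRep
    rw [(extChartAt I p₀).left_inv hp]
  simp only [e]
  rw [vfRep_extChartAt _ hq]
  exact h1

theorem IsLocalFlow.fderiv_flowRep_time :
    fderiv ℝ (flowRep I φ p₀ q₀) (s, extChartAt I p₀ p) (1, 0) =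
      vfRep I q₀ Z (flowRep I φ p₀ q₀ (s, extChartAt I p₀ p)) := by
  have h1 := ((hφ.contDiffAt_flowRep h hp hq).differentiableAt (by simp)).hasFDerivAt
  have h2 : HasDerivAt (fun t : ℝ => (t, extChartAt I p₀ p)) ((1 : ℝ), (0 : EP)) s :=
    (hasDerivAt_id s).prodMk (hasDerivAt_const s _)
  have h3 : HasDerivAt (fun t => flowRep I φ p₀ q₀ (t, extChartAt I p₀ p)) _ s :=
    HasFDerivAt.comp_hasDerivAt (f := fun t : ℝ => (t, extChartAt I p₀ p)) s h1 h2
  exact h3.unique (hφ.hasDerivAt_flowRep h hp hq)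

omit h hp hq in
theorem IsLocalFlow.eventually_flowRep (h : (s, p) ∈ D) (hp : p ∈ (extChartAt I p₀).source)
    (hq : φ s p ∈ (extChartAt I q₀).source) :
    ∀ᶠ q : ℝ × P in 𝓝 (s, p), q ∈ D ∧ q.2 ∈ (extChartAt I p₀).source ∧
      φ q.1 q.2 ∈ (extChartAt I q₀).source := by
  refine Filter.Eventually.and (hφ.isOpen.mem_nhds h) (Filter.Eventually.and ?_ ?_)
  · exact continuousAt_snd.preimage_mem_nhds ((isOpen_extChartAt_source p₀).mem_nhds hp)
  · exact (hφ.contMDiffAt_uncurry h).continuousAt.preimage_mem_nhds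
      ((isOpen_extChartAt_source q₀).mem_nhds hq)

/-- The flow equation is needed on a neighbourhood in time and space because it will be
differentiated in space. -/
theorem IsLocalFlow.eventually_fderiv_flowRep_time :
    ∀ᶠ x in 𝓝 (s, extChartAt I p₀ p), fderiv ℝ (flowRep I φ p₀ q₀) x (1, 0) =
      vfRep I q₀ Z (flowRep I φ p₀ q₀ x) := by
  have hc : ContinuousAt (fun x : ℝ × EP => (x.1, (extChartAt I p₀).symm x.2))
      (s, extChartAt I p₀ p) :=
    continuousAt_fst.prodMk (ContinuousAt.comp (f := Prod.snd)
      (continuousAt_extChartAt_symm' hp) continuousAt_snd)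
  have h1 := hφ.eventually_flowRep h hp hq
  rw [← (extChartAt I p₀).left_inv hp] at h1
  have h2 : ∀ᶠ x : ℝ × EP in 𝓝 (s, extChartAt I p₀ p), x.2 ∈ (extChartAt I p₀).target :=
    continuousAt_snd.preimage_mem_nhds
      ((isOpen_extChartAt_target p₀).mem_nhds ((extChartAt I p₀).map_source hp))
  filter_upwards [hc.eventually h1, h2] with x hx hx2
  have h3 := hφ.fderiv_flowRep_time hx.1 hx.2.1 hx.2.2
  rwa [(extChartAt I p₀).right_inv hx2] at h3

end FlowCoordinates

/-- The first variation of a solution of an ordinary differential equation solves the linearized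
equation. -/
theorem hasDerivAt_fderiv_of_ode {W W' : Type*} [NormedAddCommGroup W] [NormedSpace ℝ W]
    [NormedAddCommGroup W'] [NormedSpace ℝ W'] {G : ℝ × W → W'} {y : W' → W'} {s : ℝ} {x : W}
    (hG : ContDiffAt ℝ ∞ G (s, x)) (hy : DifferentiableAt ℝ y (G (s, x)))
    (hode : ∀ᶠ q in 𝓝 (s, x), fderiv ℝ G q (1, 0) = y (G q)) (v : W) :
    HasDerivAt (fun t => fderiv ℝ G (t, x) (0, v))
      (fderiv ℝ y (G (s, x)) (fderiv ℝ G (s, x) (0, v))) s := by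
  have hd : DifferentiableAt ℝ (fderiv ℝ G) (s, x) :=
    (hG.fderiv_right (m := ∞) (by simp)).differentiableAt (by simp)
  have hsymm : IsSymmSndFDerivAt ℝ G (s, x) :=
    hG.isSymmSndFDerivAt (by simp only [minSmoothness_of_isRCLikeNormedField]; norm_cast)
  have h1 : ∀ u : ℝ × W, HasFDerivAt (fun q => fderiv ℝ G q u)
      ((ContinuousLinearMap.apply ℝ W' u).comp (fderiv ℝ (fderiv ℝ G) (s, x))) (s, x) := fun u =>
    (ContinuousLinearMap.apply ℝ W' u).hasFDerivAt.comp (s, x) hd.hasFDerivAt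
  have h2 : HasDerivAt (fun t : ℝ => (t, x)) ((1 : ℝ), (0 : W)) s :=
    (hasDerivAt_id s).prodMk (hasDerivAt_const s _)
  have h3 := (h1 (0, v)).comp_hasDerivAt s h2
  have h4 : HasFDerivAt (fun q => y (G q)) ((fderiv ℝ y (G (s, x))).comp (fderiv ℝ G (s, x)))
      (s, x) :=
    hy.hasFDerivAt.comp (s, x) (hG.differentiableAt (by simp)).hasFDerivAt
  -- Differentiate both sides of the equation, then evaluate in the direction `(0, v)`; symmetry of
  -- the second derivative turns the space derivative of `∂ₜG` into the time derivative of `DG(0,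
  -- v)`.
  have h5 := (h1 (1, 0)).unique (h4.congr_of_eventuallyEq hode)
  have h6 := DFunLike.congr_fun h5 ((0 : ℝ), v)
  have h7 : fderiv ℝ (fderiv ℝ G) (s, x) (1, 0) (0, v) =
      fderiv ℝ y (G (s, x)) (fderiv ℝ G (s, x) (0, v)) :=
    (hsymm.eq (1, 0) (0, v)).trans h6
  rw [← h7]
  exact h3

end IntegralCurves


theorem hasDerivAt_extChartAt_comp_velocityAt
    {EP : Type*} [NormedAddCommGroup EP] [NormedSpace ℝ EP]
    {HP : Type*} [TopologicalSpace HP] {I : ModelWithCorners ℝ EP HP}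
    {P : Type*} [TopologicalSpace P] [ChartedSpace HP P] [IsManifold I ∞ P]
    {EQ : Type*} [NormedAddCommGroup EQ] [NormedSpace ℝ EQ]
    {HQ : Type*} [TopologicalSpace HQ] {K : ModelWithCorners ℝ EQ HQ}
    {Q : Type*} [TopologicalSpace Q] [ChartedSpace HQ Q] [IsManifold K ∞ Q]
    {p : P} {q₀ : Q} {φ : P → Q} {c : ℝ → P} (h : c 0 = p)
    (hc : MDifferentiableAt 𝓘(ℝ, ℝ) I c 0) (hφ : MDifferentiableAt I K φ p)
    (hq : φ p ∈ (extChartAt K q₀).source) :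
    HasDerivAt (fun s => extChartAt K q₀ (φ (c s)))
      (chartDeriv K q₀ (φ p) (mfderiv I K φ p (velocityAt I c p h))) 0 := by
  subst h
  have h1 := chartDeriv_mfderiv_curve (c := φ ∘ c) (hφ.comp 0 hc) hq
  rw [mfderiv_comp 0 hφ hc] at h1
  exact h1

/-! ### The flow of the fibre derivative -/

section FlowOfFibreDeriv

variable {EN : Type*} [NormedAddCommGroup EN] [NormedSpace ℝ EN]
  {HN : Type*} [TopologicalSpace HN] {I : ModelWithCorners ℝ EN HN} [I.Boundaryless]
  {N : Type*} [TopologicalSpace N] [ChartedSpace HN N]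
  {F : Type*} [NormedAddCommGroup F] [NormedSpace ℝ F]
  {V : N → Type*} [TopologicalSpace (TotalSpace F V)] [∀ x, AddCommMonoid (V x)]
  [∀ x, Module ℝ (V x)] [∀ x, TopologicalSpace (V x)] [FiberBundle F V]

/-- Points of different fibres are separated in the base, points of one fibre in a trivialization.
The Hausdorff property is needed for uniqueness of integral curves on the total spaces. -/
theorem t2Space_totalSpace [T2Space N] : T2Space (TotalSpace F V) := by
  refine ⟨fun a b hab => ?_⟩
  by_cases h : a.proj = b.proj
  · have ha : a ∈ (trivializationAt F V a.proj).source :=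
      (Trivialization.mem_source _).2 (mem_baseSet_trivializationAt F V a.proj)
    have hb : b ∈ (trivializationAt F V a.proj).source :=
      (Trivialization.mem_source _).2 (h ▸ mem_baseSet_trivializationAt F V a.proj)
    have hne : trivializationAt F V a.proj a ≠ trivializationAt F V a.proj b := fun he =>
      hab ((trivializationAt F V a.proj).injOn ha hb he)
    obtain ⟨u, v, hu, hv, hau, hbv, huv⟩ := t2_separation hne
    refine ⟨_, _, (trivializationAt F V a.proj).continuousOn.isOpen_inter_preimage
      (trivializationAt F V a.proj).open_source hu,
      (trivializationAt F V a.proj).continuousOn.isOpen_inter_preimage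
      (trivializationAt F V a.proj).open_source hv, ⟨ha, hau⟩, ⟨hb, hbv⟩, ?_⟩
    exact (huv.preimage _).mono inter_subset_right inter_subset_right
  · obtain ⟨u, v, hu, hv, hau, hbv, huv⟩ := t2_separation h
    exact ⟨_, _, hu.preimage (FiberBundle.continuous_proj F V),
      hv.preimage (FiberBundle.continuous_proj F V), hau, hbv, huv.preimage _⟩

variable [VectorBundle ℝ F V] [IsManifold I ∞ N] [ContMDiffVectorBundle ∞ F V I]
  {Y : ∀ a : TotalSpace F V, TangentSpace (I.prod 𝓘(ℝ, F)) a}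

theorem ProjectsTo.isMIntegralCurveOn_proj {X : ∀ x : N, TangentSpace I x}
    (h : ProjectsTo I Y X) {γ : ℝ → TotalSpace F V} {J : Set ℝ} (hJ : IsOpen J)
    (hγ : IsMIntegralCurveOn (I := I.prod 𝓘(ℝ, F)) γ Y J) :
    IsMIntegralCurveOn (I := I) (fun s => (γ s).proj) X J := by
  intro t ht
  have h1 := hasMFDerivAt_of_isMIntegralCurveOn hγ hJ ht
  have h2 := ((contMDiff_proj (IB := I) (n := ∞) V (γ t)).mdifferentiableAt
    (by simp)).hasMFDerivAt.comp t h1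
  have h3 : (mfderiv (I.prod 𝓘(ℝ, F)) I (π F V) (γ t)).comp
      ((1 : ℝ →L[ℝ] ℝ).smulRight (Y (γ t))) = (1 : ℝ →L[ℝ] ℝ).smulRight (X (γ t).proj) := by
    refine ContinuousLinearMap.ext_ring ?_
    refine Eq.trans ?_ ((h (γ t)).trans (one_smul ℝ _).symm)
    exact congrArg _ (one_smul ℝ (Y (γ t)))
  exact (h2.congr_mfderiv h3).hasMFDerivWithinAt

theorem mdifferentiableAt_lineCurve_zero (a : TotalSpace F V) (b : V a.proj) :
    MDifferentiableAt 𝓘(ℝ, ℝ) (I.prod 𝓘(ℝ, F)) (lineCurve a b) 0 :=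
  (contMDiff_lineCurve a b 0).mdifferentiableAt (by simp)

variable [T2Space N] {D : Set (ℝ × TotalSpace F V)} {φ : ℝ → TotalSpace F V → TotalSpace F V}

/-- The flow maps fibres to fibres: both curves project to integral curves of `X` with the same
initial point. -/
theorem IsLocalFlow.proj_eq (hφ : IsLocalFlow (I.prod 𝓘(ℝ, F)) Y D φ) (hY : IsProjectable I Y)
    {s : ℝ} {a b : TotalSpace F V} (ha : (s, a) ∈ D) (hb : (s, b) ∈ D) (hab : a.proj = b.proj) :
    (φ s a).proj = (φ s b).proj := by
  obtain ⟨-, X, hX, h⟩ := hY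
  refine eq_of_isMIntegralCurveOn hX (hφ.isOpen_slice a) (hφ.isOpen_slice b)
    (hφ.ordConnected a) (hφ.ordConnected b)
    (h.isMIntegralCurveOn_proj (hφ.isOpen_slice a) (hφ.integralCurve a))
    (h.isMIntegralCurveOn_proj (hφ.isOpen_slice b) (hφ.integralCurve b))
    (hφ.zero_mem a) (hφ.zero_mem b) ?_ ha hb
  rw [hφ.map_zero, hφ.map_zero, hab]

/-- For small `r` the point `φ s (a + r b)` is defined and stays over `φ s a`, so the base
coordinate is constant in `r`. Hence `vertProj` in `fibreDerivMap` is applied to a vertical vector.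
-/
theorem IsLocalFlow.mfderiv_vertLift_fst (hφ : IsLocalFlow (I.prod 𝓘(ℝ, F)) Y D φ)
    (hY : IsProjectable I Y) {s : ℝ} {a a₀ : TotalSpace F V} (ha : (s, a) ∈ D)
    (h₀ : φ s a ∈ (extChartAt (I.prod 𝓘(ℝ, F)) a₀).source) (b : V a.proj) :
    (chartDeriv (I.prod 𝓘(ℝ, F)) a₀ (φ s a)
      (mfderiv (I.prod 𝓘(ℝ, F)) (I.prod 𝓘(ℝ, F)) (φ s) a (vertLift I a b))).1 = 0 := by
  have hs := (hφ.contMDiffAt ha).mdifferentiableAt (by simp)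
  have hl := mdifferentiableAt_lineCurve_zero (I := I) a b
  have h1 := hasDerivAt_extChartAt_comp_velocityAt (lineCurve_zero a b) hl hs h₀
  have h2 : HasDerivAt (fun r => (extChartAt (I.prod 𝓘(ℝ, F)) a₀ (φ s (lineCurve a b r))).1)
      (chartDeriv (I.prod 𝓘(ℝ, F)) a₀ (φ s a)
      (mfderiv (I.prod 𝓘(ℝ, F)) (I.prod 𝓘(ℝ, F)) (φ s) a (vertLift I a b))).1 0 :=
    (ContinuousLinearMap.fst ℝ EN F).hasFDerivAt.comp_hasDerivAt 0 h1
  refine h2.unique ((hasDerivAt_const (0 : ℝ)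
    (extChartAt I a₀.proj (φ s a).proj)).congr_of_eventuallyEq ?_)
  have hc : ContinuousAt (fun r => (s, lineCurve a b r)) 0 :=
    continuousAt_const.prodMk hl.continuousAt
  have h3 : ∀ᶠ r in 𝓝 (0 : ℝ), (s, lineCurve a b r) ∈ D ∧
      φ s (lineCurve a b r) ∈ (extChartAt (I.prod 𝓘(ℝ, F)) a₀).source := by
    have h4 := hφ.eventually_flowRep ha (mem_extChartAt_source a) h₀
    rw [← lineCurve_zero a b] at h4
    have h5 := hc.eventually (p := fun q : ℝ × TotalSpace F V => q ∈ D ∧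
      φ q.1 q.2 ∈ (extChartAt (I.prod 𝓘(ℝ, F)) a₀).source) (h4.mono fun q hq => ⟨hq.1, hq.2.2⟩)
    exact h5
  filter_upwards [h3] with r hr
  rw [extChartAt_total_fst hr.2, hφ.proj_eq hY hr.1 ha rfl]

theorem IsLocalFlow.fibreCoord_fibreDerivMap (hφ : IsLocalFlow (I.prod 𝓘(ℝ, F)) Y D φ)
    (hY : IsProjectable I Y) {s : ℝ} {z : Pull I F V} {p₀ q₀ : TotalSpace F V}
    (h : (s, pr₁ I z) ∈ D) (hp : pr₁ I z ∈ (extChartAt (I.prod 𝓘(ℝ, F)) p₀).source)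
    (hq : φ s (pr₁ I z) ∈ (extChartAt (I.prod 𝓘(ℝ, F)) q₀).source) :
    fibreCoord q₀.proj (pr₂ I (fibreDerivMap I (φ s) z)) =
      (fderiv ℝ (flowRep (I.prod 𝓘(ℝ, F)) φ p₀ q₀)
        (s, extChartAt (I.prod 𝓘(ℝ, F)) p₀ (pr₁ I z))
        (0, ((0 : EN), fibreCoord p₀.proj (pr₂ I z)))).2 := by
  have h1 := fibreCoord_vertProj hq (hφ.mfderiv_vertLift_fst hY h hq (sndVec I z))
  have h2 := hφ.chartDeriv_mfderiv_flow h hp hq (vertLift I (pr₁ I z) (sndVec I z))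
  have h3 : chartDeriv (I.prod 𝓘(ℝ, F)) p₀ (pr₁ I z)
      (vertLift I (pr₁ I z) (sndVec I z)) =
      ((0 : EN), fibreCoord p₀.proj (pr₂ I z)) := chartDeriv_vertLift hp _
  rw [h3] at h2
  rw [h2] at h1
  exact h1

theorem IsLocalFlow.fderiv_flowRep_vertical (hφ : IsLocalFlow (I.prod 𝓘(ℝ, F)) Y D φ)
    (hY : IsProjectable I Y) {s : ℝ} {z : Pull I F V} {p₀ q₀ : TotalSpace F V}
    (h : (s, pr₁ I z) ∈ D) (hp : pr₁ I z ∈ (extChartAt (I.prod 𝓘(ℝ, F)) p₀).source)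
    (hq : φ s (pr₁ I z) ∈ (extChartAt (I.prod 𝓘(ℝ, F)) q₀).source) :
    fderiv ℝ (flowRep (I.prod 𝓘(ℝ, F)) φ p₀ q₀)
        (s, extChartAt (I.prod 𝓘(ℝ, F)) p₀ (pr₁ I z))
        (0, ((0 : EN), fibreCoord p₀.proj (pr₂ I z))) =
      ((0 : EN), fibreCoord q₀.proj (pr₂ I (fibreDerivMap I (φ s) z))) := by
  have h1 := hφ.mfderiv_vertLift_fst hY h hq (sndVec I z)
  have h2 := hφ.chartDeriv_mfderiv_flow h hp hq (vertLift I (pr₁ I z) (sndVec I z))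
  have h3 : chartDeriv (I.prod 𝓘(ℝ, F)) p₀ (pr₁ I z)
      (vertLift I (pr₁ I z) (sndVec I z)) =
      ((0 : EN), fibreCoord p₀.proj (pr₂ I z)) := chartDeriv_vertLift hp _
  rw [h3] at h2
  rw [h2] at h1
  exact Prod.ext h1 (hφ.fibreCoord_fibreDerivMap hY h hp hq).symm

/-- The maps of a local flow of a projectable vector field intertwine the vertical lift with the
fibre derivative. -/
theorem IsLocalFlow.vertLift_fibreDerivMap (hφ : IsLocalFlow (I.prod 𝓘(ℝ, F)) Y D φ)
    (hY : IsProjectable I Y) {s : ℝ} {z : Pull I F V} (h : (s, pr₁ I z) ∈ D) :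
    vertLift I (φ s (pr₁ I z)) (sndVec I (fibreDerivMap I (φ s) z)) =
      mfderiv (I.prod 𝓘(ℝ, F)) (I.prod 𝓘(ℝ, F)) (φ s) (pr₁ I z)
        (vertLift I (pr₁ I z) (sndVec I z)) :=
  vertLift_vertProj (mem_extChartAt_source _)
    (hφ.mfderiv_vertLift_fst hY h (mem_extChartAt_source _) (sndVec I z))

theorem IsLocalFlow.contMDiffAt_fibreDerivMap (hφ : IsLocalFlow (I.prod 𝓘(ℝ, F)) Y D φ)
    (hY : IsProjectable I Y) {s : ℝ} {z : Pull I F V} (h : (s, pr₁ I z) ∈ D) :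
    ContMDiffAt (𝓘(ℝ, ℝ).prod ((I.prod 𝓘(ℝ, F)).prod 𝓘(ℝ, F))) ((I.prod 𝓘(ℝ, F)).prod 𝓘(ℝ, F)) ∞
      (fun q : ℝ × Pull I F V => fibreDerivMap I (φ q.1) q.2) (s, z) := by
  have hp := mem_extChartAt_source (I := I.prod 𝓘(ℝ, F)) (pr₁ I z)
  have hq := mem_extChartAt_source (I := I.prod 𝓘(ℝ, F)) (φ s (pr₁ I z))
  have hm : ContMDiffAt (𝓘(ℝ, ℝ).prod ((I.prod 𝓘(ℝ, F)).prod 𝓘(ℝ, F)))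
      (𝓘(ℝ, ℝ).prod (I.prod 𝓘(ℝ, F))) ∞
      (fun q : ℝ × Pull I F V => (q.1, pr₁ I q.2)) (s, z) :=
    contMDiffAt_fst.prodMk (ContMDiffAt.comp (s, z) (contMDiff_pr₁ z) contMDiffAt_snd)
  have hb : ContMDiffAt (𝓘(ℝ, ℝ).prod ((I.prod 𝓘(ℝ, F)).prod 𝓘(ℝ, F))) (I.prod 𝓘(ℝ, F)) ∞
      (fun q : ℝ × Pull I F V => φ q.1 (pr₁ I q.2)) (s, z) :=
    ContMDiffAt.comp (s, z) (g := fun q : ℝ × TotalSpace F V => φ q.1 q.2)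
      (hφ.contMDiffAt_uncurry h) hm
  refine (contMDiffAt_total (V := PullFibre I F V) (x₀ := φ s (pr₁ I z))
    (mem_baseSet_trivializationAt F V (φ s (pr₁ I z)).proj)).2
    ⟨hb, ?_⟩
  -- Joint smoothness in time and point: near `(s, z)` the fibre coordinate is this expression in
  -- the time, the coordinates of `pr₁` and the fibre coordinate of `pr₂`.
  have hG : ContDiffAt ℝ ∞ (fun x : (ℝ × (EN × F)) × F =>
      (fderiv ℝ (flowRep (I.prod 𝓘(ℝ, F)) φ (pr₁ I z) (φ s (pr₁ I z))) x.1
        (0, ((0 : EN), x.2))).2)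
      ((s, extChartAt (I.prod 𝓘(ℝ, F)) (pr₁ I z) (pr₁ I z)),
        fibreCoord (pr₁ I z).proj (pr₂ I z)) := by
    refine contDiffAt_snd.comp _ (ContDiffAt.clm_apply ?_ ?_)
    · exact ((hφ.contDiffAt_flowRep h hp hq).fderiv_right (m := ∞) (by simp)).comp
        ((s, extChartAt (I.prod 𝓘(ℝ, F)) (pr₁ I z) (pr₁ I z)),
        fibreCoord (pr₁ I z).proj (pr₂ I z)) contDiffAt_fst
    · exact contDiffAt_const.prodMk (contDiffAt_const.prodMk contDiffAt_snd)
  have hx : ContMDiffAt (𝓘(ℝ, ℝ).prod ((I.prod 𝓘(ℝ, F)).prod 𝓘(ℝ, F)))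
      𝓘(ℝ, (ℝ × (EN × F)) × F) ∞
      (fun q : ℝ × Pull I F V => ((q.1, extChartAt (I.prod 𝓘(ℝ, F)) (pr₁ I z) (pr₁ I q.2)),
        fibreCoord (pr₁ I z).proj (pr₂ I q.2))) (s, z) := by
    refine ContMDiffAt.prodMk_space (ContMDiffAt.prodMk_space contMDiffAt_fst ?_) ?_
    · exact ContMDiffAt.comp (s, z) (g := fun y : Pull I F V =>
        extChartAt (I.prod 𝓘(ℝ, F)) (pr₁ I z) (pr₁ I y))
        ((contMDiffAt_extChartAt_of_mem hp).comp z (contMDiff_pr₁ z)) contMDiffAt_snd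
    · exact ContMDiffAt.comp (s, z) (g := fun y : Pull I F V =>
        fibreCoord (pr₁ I z).proj (pr₂ I y))
        (contMDiffAt_fibreCoord_pr₂ (mem_extChartAt_total_source.1 hp).1) contMDiffAt_snd
  refine (ContMDiffAt.comp (s, z) hG.contMDiffAt hx).congr_of_eventuallyEq ?_
  filter_upwards [hm.continuousAt.eventually (hφ.eventually_flowRep h hp hq)] with q hq'
  exact hφ.fibreCoord_fibreDerivMap hY hq'.1 hq'.2.1 hq'.2.2

/-- The fibre derivatives of the maps of a local flow of `Y` are a local flow of the fibre
derivative of `Y`. -/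
theorem IsLocalFlow.fibreDerivMap (hφ : IsLocalFlow (I.prod 𝓘(ℝ, F)) Y D φ)
    (hY : IsProjectable I Y) :
    IsLocalFlow ((I.prod 𝓘(ℝ, F)).prod 𝓘(ℝ, F)) (fibreDeriv I Y)
      {q | (q.1, pr₁ I q.2) ∈ D} (fun s => FibreDerivative.fibreDerivMap I (φ s)) where
  isOpen := hφ.isOpen.preimage (continuous_fst.prodMk
    ((contMDiff_pr₁ (I := I) (F := F) (V := V)).continuous.comp continuous_snd))
  zero_mem := fun z => hφ.zero_mem (pr₁ I z)
  ordConnected := fun z => hφ.ordConnected (pr₁ I z)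
  smooth := fun q hq => (hφ.contMDiffAt_fibreDerivMap hY hq).contMDiffWithinAt
  map_zero := fun z => by
    have h0 : φ 0 = id := funext hφ.map_zero
    rw [h0]
    unfold FibreDerivative.fibreDerivMap
    rw [mfderiv_id]
    exact congrArg (TotalSpace.mk (pr₁ I z)) (vertProj_vertLift (pr₁ I z) (sndVec I z))
  integralCurve := fun z => by
    intro s hs
    have h : (s, pr₁ I z) ∈ D := hs
    have hp := mem_extChartAt_source (I := I.prod 𝓘(ℝ, F)) (pr₁ I z)
    have hq := mem_extChartAt_source (I := I.prod 𝓘(ℝ, F)) (φ s (pr₁ I z))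
    have hc : ContinuousAt (fun t => FibreDerivative.fibreDerivMap I (φ t) z) s :=
      ContinuousAt.comp (g := fun q : ℝ × Pull I F V => FibreDerivative.fibreDerivMap I (φ q.1) q.2)
        (f := fun t => (t, z)) (hφ.contMDiffAt_fibreDerivMap hY h).continuousAt (by fun_prop)
    refine (hasMFDerivAt_curve (I := (I.prod 𝓘(ℝ, F)).prod 𝓘(ℝ, F))
      (p₀ := FibreDerivative.fibreDerivMap I (φ s) z) hc
      (mem_extChartAt_pull_source.2 hq) ?_).hasMFDerivWithinAt
    have hG := hφ.contDiffAt_flowRep h hp hq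
    have hGs : flowRep (I.prod 𝓘(ℝ, F)) φ (pr₁ I z) (φ s (pr₁ I z))
        (s, extChartAt (I.prod 𝓘(ℝ, F)) (pr₁ I z) (pr₁ I z)) =
        extChartAt (I.prod 𝓘(ℝ, F)) (φ s (pr₁ I z)) (φ s (pr₁ I z)) := by
      unfold flowRep
      rw [(extChartAt (I.prod 𝓘(ℝ, F)) (pr₁ I z)).left_inv hp]
    -- The linearized equation in the vertical direction of `z`; its fibre component is the second
    -- component of `𝓕Y` along the curve.
    have hd := hasDerivAt_fderiv_of_ode hG
      (y := vfRep (I.prod 𝓘(ℝ, F)) (φ s (pr₁ I z)) Y)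
      ((hY.1.contDiffAt_vfRep (by rw [hGs]; exact mem_extChartAt_target _)).differentiableAt
        (by simp)) (hφ.eventually_fderiv_flowRep_time h hp hq)
      ((0 : EN), fibreCoord (pr₁ I z).proj (pr₂ I z))
    rw [hφ.fderiv_flowRep_vertical hY h hp hq, hGs] at hd
    have h1 := hasDerivAt_extChartAt_of_isMIntegralCurveOn (hφ.integralCurve (pr₁ I z))
      (hφ.isOpen_slice (pr₁ I z)) h hq
    have h2 := h1.prodMk ((ContinuousLinearMap.snd ℝ EN F).hasFDerivAt.comp_hasDerivAt s hd)
    have h3 := chartDeriv_fibreDeriv hY (z₀ := FibreDerivative.fibreDerivMap I (φ s) z)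
      (z := FibreDerivative.fibreDerivMap I (φ s) z) hq
    have h4 := h2.congr_of_eventuallyEq (f₁ := fun t =>
      extChartAt ((I.prod 𝓘(ℝ, F)).prod 𝓘(ℝ, F)) (FibreDerivative.fibreDerivMap I (φ s) z)
        (FibreDerivative.fibreDerivMap I (φ t) z)) ?_
    · rw [h3]
      exact h4
    · have hc2 : ContinuousAt (fun t : ℝ => (t, pr₁ I z)) s := by fun_prop
      filter_upwards [hc2.eventually (hφ.eventually_flowRep h hp hq)] with t ht
      have h5 := hφ.fibreCoord_fibreDerivMap hY ht.1 ht.2.1 ht.2.2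
      have h6 := extChartAt_pull_apply (z₀ := FibreDerivative.fibreDerivMap I (φ s) z)
        (z := FibreDerivative.fibreDerivMap I (φ t) z) ht.2.2
      exact h6.trans (Prod.ext rfl h5)

/-- The fibre derivatives of the maps of the maximal local flow of `Y` are the maximal local flow of
the fibre derivative of `Y`. -/
theorem IsMaximalLocalFlow.fibreDerivMap (hφ : IsMaximalLocalFlow (I.prod 𝓘(ℝ, F)) Y D φ)
    (hY : IsProjectable I Y) :
    IsMaximalLocalFlow ((I.prod 𝓘(ℝ, F)).prod 𝓘(ℝ, F)) (fibreDeriv I Y)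
      {q | (q.1, pr₁ I q.2) ∈ D} (fun s => FibreDerivative.fibreDerivMap I (φ s)) where
  toIsLocalFlow := hφ.toIsLocalFlow.fibreDerivMap hY
  maximal := fun γ J hJ hc h0 hγ s hs => by
    have : T2Space (TotalSpace F V) := t2Space_totalSpace
    have : T2Space (Pull I F V) := t2Space_totalSpace (V := PullFibre I F V)
    -- The projected curve is an integral curve of `Y`, so maximality of `φ` bounds its lifetime;
    -- uniqueness upstairs then identifies `γ` with the flow.
    have h1 := (projectsTo_fibreDeriv hY).isMIntegralCurveOn_proj hJ hγ
    have h2 := hφ.maximal (fun s => pr₁ I (γ s)) J hJ hc h0 h1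
    have hF := hφ.toIsLocalFlow.fibreDerivMap hY
    have e : ∀ (Ψ : ℝ → Pull I F V → Pull I F V) (D' : Set (ℝ × Pull I F V)),
        IsLocalFlow ((I.prod 𝓘(ℝ, F)).prod 𝓘(ℝ, F)) (fibreDeriv I Y) D' Ψ → (s, γ 0) ∈ D' →
        γ s = Ψ s (γ 0) := fun Ψ D' hF hs' =>
      eq_of_isMIntegralCurveOn (isSmoothVF_fibreDeriv hY) hJ (hF.isOpen_slice (γ 0)) hc
        (hF.ordConnected (γ 0)) hγ (hF.integralCurve (γ 0)) h0 (hF.zero_mem (γ 0))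
        (hF.map_zero (γ 0)).symm hs hs'
    exact ⟨(h2 s hs).1, e _ _ hF (h2 s hs).1⟩

end FlowOfFibreDeriv


/-! ### The bracket of fibre derivatives in coordinates -/

section VectorSpace

variable {E₁ F : Type*} [NormedAddCommGroup E₁] [NormedSpace ℝ E₁]
    [NormedAddCommGroup F] [NormedSpace ℝ F] {y y' : E₁ × F → E₁ × F}

theorem fderiv_fibreDerivRep {x : (E₁ × F) × F} (hy : ContDiffAt ℝ ∞ y x.1) (v : (E₁ × F) × F) :
    fderiv ℝ (fibreDerivRep y) x v = (fderiv ℝ y x.1 v.1,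
      (fderiv ℝ (fderiv ℝ y) x.1 v.1 (0, x.2) + fderiv ℝ y x.1 (0, v.2)).2) := by
  have h0 : HasFDerivAt (fun x : (E₁ × F) × F => y x.1)
      ((fderiv ℝ y x.1).comp (ContinuousLinearMap.fst ℝ (E₁ × F) F)) x :=
    (hy.differentiableAt (by simp)).hasFDerivAt.comp x hasFDerivAt_fst
  have h1 : HasFDerivAt (fun x : (E₁ × F) × F => fderiv ℝ y x.1)
      ((fderiv ℝ (fderiv ℝ y) x.1).comp (ContinuousLinearMap.fst ℝ (E₁ × F) F)) x :=
    ((hy.fderiv_right (m := ∞) (by simp)).differentiableAt (by simp)).hasFDerivAt.comp x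
      hasFDerivAt_fst
  have h2 : HasFDerivAt (fun x : (E₁ × F) × F => ((0 : E₁), x.2))
      ((ContinuousLinearMap.inr ℝ E₁ F).comp (ContinuousLinearMap.snd ℝ (E₁ × F) F)) x :=
    ((ContinuousLinearMap.inr ℝ E₁ F).comp (ContinuousLinearMap.snd ℝ (E₁ × F) F)).hasFDerivAt
  have h3 := h0.prodMk ((ContinuousLinearMap.snd ℝ E₁ F).hasFDerivAt.comp x (h1.clm_apply h2))
  have h4 : HasFDerivAt (fibreDerivRep y) _ x := h3
  rw [h4.fderiv]
  refine Prod.ext (by simp) ?_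
  simp [add_comm]

theorem fderiv_lieBracket {p : E₁} {y y' : E₁ → E₁} (hy : ContDiffAt ℝ ∞ y p)
    (hy' : ContDiffAt ℝ ∞ y' p) (u : E₁) :
    fderiv ℝ (VectorField.lieBracket ℝ y y') p u =
      (fderiv ℝ (fderiv ℝ y') p u (y p) + fderiv ℝ y' p (fderiv ℝ y p u)) -
      (fderiv ℝ (fderiv ℝ y) p u (y' p) + fderiv ℝ y p (fderiv ℝ y' p u)) := by
  have key : ∀ {y y' : E₁ → E₁}, ContDiffAt ℝ ∞ y p → ContDiffAt ℝ ∞ y' p →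
      HasFDerivAt (fun x => fderiv ℝ y' x (y x)) _ p := fun hy hy' =>
    ((hy'.fderiv_right (m := ∞) (by simp)).differentiableAt (by simp)).hasFDerivAt.clm_apply
      (hy.differentiableAt (by simp)).hasFDerivAt
  have h : HasFDerivAt (VectorField.lieBracket ℝ y y') _ p := (key hy hy').sub (key hy' hy)
  rw [h.fderiv]
  simp [add_comm]

/-- Both fibre components are the antisymmetrization of `D²y'(y, (0, g)) + Dy'(Dy(0, g))`: on the
left the inner vector appears as `(0, (Dy(0, g))₂)`, which verticality identifies with `Dy(0, g)`,
and the arguments of `D²` are exchanged by symmetry. -/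
theorem lieBracket_fibreDerivRep {x : (E₁ × F) × F} (hy : ContDiffAt ℝ ∞ y x.1)
    (hy' : ContDiffAt ℝ ∞ y' x.1) (hv : ∀ f, (fderiv ℝ y x.1 (0, f)).1 = 0)
    (hv' : ∀ f, (fderiv ℝ y' x.1 (0, f)).1 = 0) :
    VectorField.lieBracket ℝ (fibreDerivRep y) (fibreDerivRep y') x =
      fibreDerivRep (VectorField.lieBracket ℝ y y') x := by
  have hsymm : ∀ {y : E₁ × F → E₁ × F}, ContDiffAt ℝ ∞ y x.1 → IsSymmSndFDerivAt ℝ y x.1 :=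
    fun hy => hy.isSymmSndFDerivAt
      (by simp only [minSmoothness_of_isRCLikeNormedField]; norm_cast)
  have e : ((0 : E₁), (fderiv ℝ y x.1 (0, x.2)).2) = fderiv ℝ y x.1 (0, x.2) :=
    Prod.ext (hv _).symm rfl
  have e' : ((0 : E₁), (fderiv ℝ y' x.1 (0, x.2)).2) = fderiv ℝ y' x.1 (0, x.2) :=
    Prod.ext (hv' _).symm rfl
  have h1 : VectorField.lieBracket ℝ (fibreDerivRep y) (fibreDerivRep y') x =
    fderiv ℝ (fibreDerivRep y') x (fibreDerivRep y x) -
      fderiv ℝ (fibreDerivRep y) x (fibreDerivRep y' x) := rfl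
  rw [h1, fderiv_fibreDerivRep hy, fderiv_fibreDerivRep hy']
  unfold fibreDerivRep
  simp only [e, e']
  rw [fderiv_lieBracket hy hy', (hsymm hy).eq (y' x.1), (hsymm hy').eq (y x.1)]
  rfl

end VectorSpace

/-! ### Brackets of projectable vector fields -/

section Brackets

variable {EN : Type*} [NormedAddCommGroup EN] [NormedSpace ℝ EN] [CompleteSpace EN]
  {HN : Type*} [TopologicalSpace HN] {I : ModelWithCorners ℝ EN HN} [I.Boundaryless]
  {N : Type*} [TopologicalSpace N] [ChartedSpace HN N]
  {F : Type*} [NormedAddCommGroup F] [NormedSpace ℝ F] [CompleteSpace F]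
  {V : N → Type*} [TopologicalSpace (TotalSpace F V)] [∀ x, AddCommMonoid (V x)]
  [∀ x, Module ℝ (V x)] [∀ x, TopologicalSpace (V x)] [FiberBundle F V]
  [VectorBundle ℝ F V] [IsManifold I ∞ N] [ContMDiffVectorBundle ∞ F V I]
  {Y Y' : ∀ a : TotalSpace F V, TangentSpace (I.prod 𝓘(ℝ, F)) a}

/-- The base component of the coordinate bracket involves only the base components of the two
fields, hence is the bracket of the projected fields. -/
theorem IsProjectable.mlieBracket (hY : IsProjectable I Y) (hY' : IsProjectable I Y') :
    IsProjectable I (VectorField.mlieBracket (I.prod 𝓘(ℝ, F)) Y Y') := by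
  obtain ⟨hs, X, hX, h⟩ := hY
  obtain ⟨hs', X', hX', h'⟩ := hY'
  refine ⟨hs.mlieBracket hs', VectorField.mlieBracket I X X', hX.mlieBracket hX',
    projectsTo_of_chartDeriv fun a => ?_⟩
  have ha := mem_extChartAt_source (I := I.prod 𝓘(ℝ, F)) a
  have ht := mem_extChartAt_target (I := I.prod 𝓘(ℝ, F)) a
  have hp := mem_extChartAt_source (I := I) a.proj
  have e1 : (extChartAt (I.prod 𝓘(ℝ, F)) a a).1 = extChartAt I a.proj a.proj :=
    extChartAt_total_fst ha
  rw [← vfRep_extChartAt _ ha, ← vfRep_extChartAt _ hp, vfRep_mlieBracket hs hs' ht,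
    vfRep_mlieBracket hX hX' (mem_extChartAt_target a.proj)]
  unfold VectorField.lieBracket
  rw [Prod.fst_sub, fderiv_vfRep_fst hs hX h ht, fderiv_vfRep_fst hs' hX' h' ht,
    h.vfRep_fst ht, h'.vfRep_fst ht, e1]

theorem vfRep_fibreDeriv (hY : IsProjectable I Y) {z₀ : Pull I F V} {x : (EN × F) × F}
    (hx : x ∈ (extChartAt ((I.prod 𝓘(ℝ, F)).prod 𝓘(ℝ, F)) z₀).target) :
    vfRep ((I.prod 𝓘(ℝ, F)).prod 𝓘(ℝ, F)) z₀ (fibreDeriv I Y) x =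
      fibreDerivRep (vfRep (I.prod 𝓘(ℝ, F)) (pr₁ I z₀) Y) x := by
  have hs := (extChartAt ((I.prod 𝓘(ℝ, F)).prod 𝓘(ℝ, F)) z₀).map_target hx
  have h1 := chartDeriv_fibreDeriv_eq_fibreDerivRep hY (mem_extChartAt_pull_source.1 hs)
  rw [← vfRep_extChartAt _ hs, (extChartAt ((I.prod 𝓘(ℝ, F)).prod 𝓘(ℝ, F)) z₀).right_inv hx] at h1
  exact h1

/-- The fibre derivative of vector fields is compatible with the Lie bracket. -/
theorem mlieBracket_fibreDeriv (hY : IsProjectable I Y) (hY' : IsProjectable I Y') :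
    VectorField.mlieBracket ((I.prod 𝓘(ℝ, F)).prod 𝓘(ℝ, F)) (fibreDeriv I Y) (fibreDeriv I Y') =
      fibreDeriv I (VectorField.mlieBracket (I.prod 𝓘(ℝ, F)) Y Y') := by
  funext z
  have hz := mem_extChartAt_source (I := I.prod 𝓘(ℝ, F)) (pr₁ I z)
  have hz' := mem_extChartAt_source (I := (I.prod 𝓘(ℝ, F)).prod 𝓘(ℝ, F)) z
  have ht := mem_extChartAt_target (I := (I.prod 𝓘(ℝ, F)).prod 𝓘(ℝ, F)) z
  have ht1 : (extChartAt ((I.prod 𝓘(ℝ, F)).prod 𝓘(ℝ, F)) z z).1 ∈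
      (extChartAt (I.prod 𝓘(ℝ, F)) (pr₁ I z)).target := by
    rw [extChartAt_pull_apply hz]
    exact mem_extChartAt_target _
  refine chartDeriv_injective hz' ?_
  rw [chartDeriv_fibreDeriv_eq_fibreDerivRep (hY.mlieBracket hY') hz, ← vfRep_extChartAt _ hz',
    vfRep_mlieBracket (isSmoothVF_fibreDeriv hY) (isSmoothVF_fibreDeriv hY') ht]
  have key : ∀ {Y : ∀ a : TotalSpace F V, TangentSpace (I.prod 𝓘(ℝ, F)) a}, IsProjectable I Y →
      vfRep ((I.prod 𝓘(ℝ, F)).prod 𝓘(ℝ, F)) z (fibreDeriv I Y)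
        =ᶠ[𝓝 (extChartAt ((I.prod 𝓘(ℝ, F)).prod 𝓘(ℝ, F)) z z)]
      fibreDerivRep (vfRep (I.prod 𝓘(ℝ, F)) (pr₁ I z) Y) := fun {Y} hY => by
    filter_upwards [(isOpen_extChartAt_target z).mem_nhds ht] with x hx
    exact vfRep_fibreDeriv hY hx
  rw [Filter.EventuallyEq.lieBracket_vectorField_eq (key hY) (key hY'),
    lieBracket_fibreDerivRep (hY.1.contDiffAt_vfRep ht1) (hY'.1.contDiffAt_vfRep ht1)
      (fderiv_vfRep_vertical hY ht1) (fderiv_vfRep_vertical hY' ht1)]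
  -- Equality at the point would not suffice, because `fibreDerivRep` differentiates the bracket.
  have e : vfRep (I.prod 𝓘(ℝ, F)) (pr₁ I z) (VectorField.mlieBracket (I.prod 𝓘(ℝ, F)) Y Y')
      =ᶠ[𝓝 (extChartAt ((I.prod 𝓘(ℝ, F)).prod 𝓘(ℝ, F)) z z).1]
      VectorField.lieBracket ℝ (vfRep (I.prod 𝓘(ℝ, F)) (pr₁ I z) Y)
        (vfRep (I.prod 𝓘(ℝ, F)) (pr₁ I z) Y') := by
    filter_upwards [(isOpen_extChartAt_target (pr₁ I z)).mem_nhds ht1] with x hx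
    exact vfRep_mlieBracket hY.1 hY'.1 hx
  unfold fibreDerivRep
  rw [e.fderiv_eq, e.self_of_nhds]

end Brackets


/-! ### The linearized equation along a solution -/

section LinearizedFlow

variable {W F : Type*} [NormedAddCommGroup W] [NormedSpace ℝ W] [CompleteSpace W]
  [NormedAddCommGroup F] [NormedSpace ℝ F] [CompleteSpace F]

/-- Short-time solutions of an ordinary differential equation together with the fundamental
solution of a linear equation along them. -/
theorem exists_fundamentalSolution {y : W → W} {L : W → F →L[ℝ] F} {p : W} {T : Set W}
    (hy : ContDiffAt ℝ 1 y p) (hL : ContDiffAt ℝ 1 L p) (hT : T ∈ 𝓝 p) :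
    ∃ ε > (0 : ℝ), ∃ (c : ℝ → W) (U : ℝ → F →L[ℝ] F), c 0 = p ∧ U 0 = 1 ∧
      ∀ t ∈ Ioo (-ε) ε, c t ∈ T ∧ IsUnit (U t) ∧ HasDerivAt c (y (c t)) t ∧
        HasDerivAt U (L (c t) * U t) t := by
  -- One autonomous equation on `W × (F →L[ℝ] F)` with initial value `(p, 1)` gives the curve and
  -- the fundamental solution together.
  have hf : ContDiffAt ℝ 1 (fun x : W × (F →L[ℝ] F) => (y x.1, L x.1 * x.2)) (p, 1) :=
    (hy.comp (p, (1 : F →L[ℝ] F)) contDiffAt_fst).prodMk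
      ((hL.comp (p, (1 : F →L[ℝ] F)) contDiffAt_fst).mul contDiffAt_snd)
  obtain ⟨α, h0, ε, hε, h⟩ :=
    hf.exists_forall_mem_closedBall_exists_eq_forall_mem_Ioo_hasDerivAt₀ 0
  have hd : ∀ t ∈ Ioo (-ε) ε, HasDerivAt α (y (α t).1, L (α t).1 * (α t).2) t := by
    simpa using h
  have hc : ContinuousAt α 0 := (hd 0 ⟨by linarith, hε⟩).continuousAt
  -- Units form an open set containing `1`, so `U` stays invertible for short times.
  have h1 : ∀ᶠ t in 𝓝 (0 : ℝ), (α t).1 ∈ T ∧ IsUnit (α t).2 := by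
    refine Filter.Eventually.and ?_ ?_
    · have : ContinuousAt (fun t => (α t).1) 0 := continuousAt_fst.comp hc
      refine this.preimage_mem_nhds ?_
      simpa [h0] using hT
    · have : ContinuousAt (fun t => (α t).2) 0 := continuousAt_snd.comp hc
      refine this.preimage_mem_nhds (Units.isOpen.mem_nhds ?_)
      simp [h0]
  obtain ⟨δ, hδ, hball⟩ := Metric.eventually_nhds_iff.1 h1
  refine ⟨min ε δ, lt_min hε hδ, fun t => (α t).1, fun t => (α t).2, congrArg Prod.fst h0,
    congrArg Prod.snd h0,
    fun t ht => ?_⟩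
  have ht1 : t ∈ Ioo (-ε) ε :=
    ⟨by linarith [ht.1, min_le_left ε δ], ht.2.trans_le (min_le_left _ _)⟩
  have ht2 : dist t 0 < δ := by
    rw [Real.dist_eq, sub_zero, abs_lt]
    exact ⟨by linarith [ht.1, min_le_right ε δ], ht.2.trans_le (min_le_right _ _)⟩
  exact ⟨(hball ht2).1, (hball ht2).2,
    (ContinuousLinearMap.fst ℝ W (F →L[ℝ] F)).hasFDerivAt.comp_hasDerivAt t (hd t ht1),
    (ContinuousLinearMap.snd ℝ W (F →L[ℝ] F)).hasFDerivAt.comp_hasDerivAt t (hd t ht1)⟩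

theorem hasDerivAt_ringInverse_of_eq_one {A : Type*} [NormedRing A] [NormedAlgebra ℝ A]
    [CompleteSpace A] {U : ℝ → A} {U' : A} {t : ℝ} (h1 : U t = 1) (hU : HasDerivAt U U' t) :
    HasDerivAt (fun s => Ring.inverse (U s)) (-U') t := by
  have h : HasFDerivAt (𝕜 := ℝ) Ring.inverse
      (-ContinuousLinearMap.mulLeftRight ℝ A (((1 : Aˣ)⁻¹ : Aˣ) : A) (((1 : Aˣ)⁻¹ : Aˣ) : A))
      (U t) := by
    rw [h1]
    exact hasFDerivAt_ringInverse (𝕜 := ℝ) (1 : Aˣ)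
  refine (h.comp_hasDerivAt t hU).congr_deriv ?_
  change -((((1 : Aˣ)⁻¹ : Aˣ) : A) * U' * (((1 : Aˣ)⁻¹ : Aˣ) : A)) = -U'
  rw [inv_one, Units.val_one, one_mul, mul_one]

omit [CompleteSpace W] in
-- Product rule, with `(U⁻¹)' = -U' = -L(p)` at time `0`, where `U = 1`.
theorem hasDerivAt_inverse_fundamentalSolution {y : W → W} {L : W → F →L[ℝ] F} {p : W}
    {c : ℝ → W} {U : ℝ → F →L[ℝ] F} {S : W → F} (hc0 : c 0 = p) (hU0 : U 0 = 1)
    (hc : HasDerivAt c (y (c 0)) 0) (hU : HasDerivAt U (L (c 0) * U 0) 0)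
    (hS : DifferentiableAt ℝ S p) :
    HasDerivAt (fun s => Ring.inverse (U s) (S (c s))) (fderiv ℝ S p (y p) - L p (S p)) 0 := by
  rw [hc0, hU0, mul_one] at hU
  have h2 := hasDerivAt_ringInverse_of_eq_one hU0 hU
  have h3 : HasDerivAt (fun s => S (c s)) (fderiv ℝ S p (y p)) 0 := by
    rw [hc0] at hc
    have h4 : HasFDerivAt S (fderiv ℝ S p) (c 0) := by rw [hc0]; exact hS.hasFDerivAt
    exact h4.comp_hasDerivAt 0 hc
  refine (h2.clm_apply h3).congr_deriv ?_
  rw [hU0, hc0, Ring.inverse_one]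
  exact (add_comm _ _).trans (sub_eq_add_neg _ _).symm

end LinearizedFlow


theorem isMIntegralCurveOn_extChartAt_symm {EP : Type*} [NormedAddCommGroup EP] [NormedSpace ℝ EP]
    {HP : Type*} [TopologicalSpace HP] {I : ModelWithCorners ℝ EP HP} [I.Boundaryless]
    {P : Type*} [TopologicalSpace P] [ChartedSpace HP P] [IsManifold I ∞ P]
    {Z : ∀ p : P, TangentSpace I p} {p₀ : P} {c : ℝ → EP} {J : Set ℝ} (hJ : IsOpen J)
    (h : ∀ t ∈ J, c t ∈ (extChartAt I p₀).target ∧ HasDerivAt c (vfRep I p₀ Z (c t)) t) :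
    IsMIntegralCurveOn (I := I) (fun t => (extChartAt I p₀).symm (c t)) Z J := by
  intro t ht
  have hc := (h t ht).2.continuousAt
  have h1 : ContinuousAt (fun t => (extChartAt I p₀).symm (c t)) t :=
    ContinuousAt.comp (f := c) (contMDiffAt_extChartAt_symm (h t ht).1).continuousAt hc
  refine (hasMFDerivAt_curve h1 ((extChartAt I p₀).map_target (h t ht).1) ?_).hasMFDerivWithinAt
  refine (h t ht).2.congr_of_eventuallyEq ?_
  filter_upwards [hJ.mem_nhds ht] with s hs
  exact (extChartAt I p₀).right_inv (h s hs).1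

/-! ### Sections along the projection in coordinates -/

section Derivation

variable {EN : Type*} [NormedAddCommGroup EN] [NormedSpace ℝ EN]
  {HN : Type*} [TopologicalSpace HN] {I : ModelWithCorners ℝ EN HN} [I.Boundaryless]
  {N : Type*} [TopologicalSpace N] [ChartedSpace HN N]
  {F : Type*} [NormedAddCommGroup F] [NormedSpace ℝ F]
  {V : N → Type*} [TopologicalSpace (TotalSpace F V)] [∀ x, AddCommMonoid (V x)]
  [∀ x, Module ℝ (V x)] [∀ x, TopologicalSpace (V x)] [FiberBundle F V]
  [VectorBundle ℝ F V] [IsManifold I ∞ N] [ContMDiffVectorBundle ∞ F V I]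
  {Y : ∀ a : TotalSpace F V, TangentSpace (I.prod 𝓘(ℝ, F)) a}
  {σ : ∀ a : TotalSpace F V, V a.proj}

/-- The coordinate expression of a section along the projection. -/
noncomputable def secRep (I : ModelWithCorners ℝ EN HN) (a₀ : TotalSpace F V)
    (σ : ∀ a : TotalSpace F V, V a.proj) (x : EN × F) : F :=
  fibreCoord a₀.proj (⟨((extChartAt (I.prod 𝓘(ℝ, F)) a₀).symm x).proj,
    σ ((extChartAt (I.prod 𝓘(ℝ, F)) a₀).symm x)⟩ : TotalSpace F V)

theorem secRep_extChartAt {a₀ a : TotalSpace F V}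
    (ha : a ∈ (extChartAt (I.prod 𝓘(ℝ, F)) a₀).source) :
    secRep I a₀ σ (extChartAt (I.prod 𝓘(ℝ, F)) a₀ a) =
      fibreCoord a₀.proj (⟨a.proj, σ a⟩ : TotalSpace F V) := by
  unfold secRep
  rw [(extChartAt (I.prod 𝓘(ℝ, F)) a₀).left_inv ha]

theorem IsSmoothAlong.contDiffAt_secRep (hσ : IsSmoothAlong I σ) {a₀ : TotalSpace F V} {x : EN × F}
    (hx : x ∈ (extChartAt (I.prod 𝓘(ℝ, F)) a₀).target) : ContDiffAt ℝ ∞ (secRep I a₀ σ) x := by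
  have h1 := (extChartAt (I.prod 𝓘(ℝ, F)) a₀).map_target hx
  have h2 := ((contMDiffAt_total (I := I)
    (f := fun a : TotalSpace F V => (⟨a.proj, σ a⟩ : TotalSpace F V))
    (mem_extChartAt_total_source.1 h1).1).1 (hσ _)).2
  exact (h2.comp x (contMDiffAt_extChartAt_symm hx)).contDiffAt

/-- The zero vector over the point with coordinates `x.1` lies in the chart, and its fibre
coordinate may then be replaced by any other, since the target is a product with all of `F`. -/
theorem mem_extChartAt_pull_target {z₀ : Pull I F V} {x : (EN × F) × F}
    (hx : x.1 ∈ (extChartAt (I.prod 𝓘(ℝ, F)) (pr₁ I z₀)).target) :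
    x ∈ (extChartAt ((I.prod 𝓘(ℝ, F)).prod 𝓘(ℝ, F)) z₀).target := by
  have hs := (extChartAt (I.prod 𝓘(ℝ, F)) (pr₁ I z₀)).map_target hx
  have h1 := (extChartAt ((I.prod 𝓘(ℝ, F)).prod 𝓘(ℝ, F)) z₀).map_source
    (mem_extChartAt_pull_source (z := (⟨(extChartAt (I.prod 𝓘(ℝ, F)) (pr₁ I z₀)).symm x.1, 0⟩ :
      Pull I F V)).2 hs)
  have h2 := mem_extChartAt_total_target (V := PullFibre I F V) (f := x.2) h1
  rw [extChartAt_pull_apply (z := (⟨(extChartAt (I.prod 𝓘(ℝ, F)) (pr₁ I z₀)).symm x.1, 0⟩ :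
      Pull I F V)) hs] at h2
  have e : extChartAt (I.prod 𝓘(ℝ, F)) (pr₁ I z₀) (pr₁ I
      (⟨(extChartAt (I.prod 𝓘(ℝ, F)) (pr₁ I z₀)).symm x.1, 0⟩ : Pull I F V)) = x.1 :=
    (extChartAt (I.prod 𝓘(ℝ, F)) (pr₁ I z₀)).right_inv hx
  rw [e] at h2
  exact h2

/-- Hence the base flow in the pullback of sections is the flow of `Y`. -/
theorem baseVF_fibreDeriv (hY : IsProjectable I Y) :
    baseVF (F := F) (V := PullFibre I F V) (I.prod 𝓘(ℝ, F)) (fibreDeriv I Y) = Y :=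
  funext fun a => projectsTo_fibreDeriv hY (zeroSection F (PullFibre I F V) a)

theorem inFibre_mk {x : N} (v : V x) : inFibre x (⟨x, v⟩ : TotalSpace F V) = v := by
  simp [inFibre]

end Derivation


/-! ### Pulling back a section by the flow of the fibre derivative -/

section FlowQuotient

variable {EN : Type*} [NormedAddCommGroup EN] [NormedSpace ℝ EN] [CompleteSpace EN]
  {HN : Type*} [TopologicalSpace HN] {I : ModelWithCorners ℝ EN HN} [I.Boundaryless]
  {N : Type*} [TopologicalSpace N] [ChartedSpace HN N] [T2Space N]
  {F : Type*} [NormedAddCommGroup F] [NormedSpace ℝ F] [CompleteSpace F]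
  {V : N → Type*} [TopologicalSpace (TotalSpace F V)] [∀ x, AddCommMonoid (V x)]
  [∀ x, Module ℝ (V x)] [∀ x, TopologicalSpace (V x)] [FiberBundle F V]
  [VectorBundle ℝ F V] [IsManifold I ∞ N] [ContMDiffVectorBundle ∞ F V I]
  {Y : ∀ a : TotalSpace F V, TangentSpace (I.prod 𝓘(ℝ, F)) a}
  {σ : ∀ a : TotalSpace F V, V a.proj}

/-- The linear map `f ↦ (Dy(x)(0, f))₂`. -/
noncomputable def verticalPart {E₁ F : Type*} [NormedAddCommGroup E₁] [NormedSpace ℝ E₁]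
    [NormedAddCommGroup F] [NormedSpace ℝ F] (y : E₁ × F → E₁ × F) (x : E₁ × F) : F →L[ℝ] F :=
  (ContinuousLinearMap.snd ℝ E₁ F).comp ((fderiv ℝ y x).comp (ContinuousLinearMap.inr ℝ E₁ F))

theorem contDiffAt_verticalPart {E₁ F : Type*} [NormedAddCommGroup E₁] [NormedSpace ℝ E₁]
    [NormedAddCommGroup F] [NormedSpace ℝ F] {y : E₁ × F → E₁ × F} {x : E₁ × F}
    (hy : ContDiffAt ℝ ∞ y x) : ContDiffAt ℝ ∞ (verticalPart y) x :=
  contDiffAt_const.clm_comp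
    ((hy.fderiv_right (m := ∞) (by simp)).clm_comp contDiffAt_const)

/-- Used for the end point of a curve flowed back to time `0`: it lies in the fibre over `a`, so
`inFibre` returns its actual fibre component. -/
theorem exists_pull_eq {a : TotalSpace F V} (σ : ∀ a : TotalSpace F V, V a.proj) (f : F) :
    ∃ v : V a.proj, fibreCoord a.proj (⟨a.proj, v⟩ : TotalSpace F V) = f ∧
      (extChartAt ((I.prod 𝓘(ℝ, F)).prod 𝓘(ℝ, F)) (⟨a, σ a⟩ : Pull I F V)).symm
        (extChartAt (I.prod 𝓘(ℝ, F)) a a, f) = ⟨a, v⟩ := by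
  obtain ⟨v, hv⟩ := fibreCoord_surjective (mem_baseSet_trivializationAt F V a.proj) f
  refine ⟨v, hv, ?_⟩
  have ha := mem_extChartAt_source (I := I.prod 𝓘(ℝ, F)) a
  have h1 := extChartAt_pull_apply (z₀ := (⟨a, σ a⟩ : Pull I F V)) (z := (⟨a, v⟩ : Pull I F V)) ha
  have h2 : extChartAt ((I.prod 𝓘(ℝ, F)).prod 𝓘(ℝ, F)) (⟨a, σ a⟩ : Pull I F V)
      (⟨a, v⟩ : Pull I F V) = (extChartAt (I.prod 𝓘(ℝ, F)) a a, f) :=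
    h1.trans (Prod.ext rfl hv)
  rw [← h2]
  exact (extChartAt ((I.prod 𝓘(ℝ, F)).prod 𝓘(ℝ, F)) (⟨a, σ a⟩ : Pull I F V)).left_inv
    (mem_extChartAt_pull_source.2 ha)

/-- The pullback of a section by the flow of the fibre derivative, in coordinates. -/
theorem exists_hasDerivAt_flowPullback (hY : IsProjectable I Y) (hσ : IsSmoothAlong I σ)
    (a : TotalSpace F V) :
    ∃ R : ℝ → F, HasDerivAt R
        (fderiv ℝ (secRep I a σ) (extChartAt (I.prod 𝓘(ℝ, F)) a a)
            (vfRep (I.prod 𝓘(ℝ, F)) a Y (extChartAt (I.prod 𝓘(ℝ, F)) a a)) -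
          verticalPart (vfRep (I.prod 𝓘(ℝ, F)) a Y) (extChartAt (I.prod 𝓘(ℝ, F)) a a)
            (secRep I a σ (extChartAt (I.prod 𝓘(ℝ, F)) a a))) 0 ∧
      R 0 = fibreCoord a.proj (⟨a.proj, σ a⟩ : TotalSpace F V) ∧
      ∀ᶠ s in 𝓝 (0 : ℝ), ∃ v : V a.proj,
        flowPullback (F := F) (V := PullFibre I F V) (I.prod 𝓘(ℝ, F)) (fibreDeriv I Y) σ a s = v ∧
        fibreCoord a.proj (⟨a.proj, v⟩ : TotalSpace F V) = R s := by
  have hT2 : T2Space (TotalSpace F V) := t2Space_totalSpace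
  have hT2' : T2Space (Pull I F V) := t2Space_totalSpace (V := PullFibre I F V)
  have ha := mem_extChartAt_source (I := I.prod 𝓘(ℝ, F)) a
  have ht := mem_extChartAt_target (I := I.prod 𝓘(ℝ, F)) a
  have hy := hY.1.contDiffAt_vfRep ht
  obtain ⟨ε, hε, c, U, hc0, hU0, h⟩ := exists_fundamentalSolution (hy.of_le (by norm_cast))
    ((contDiffAt_verticalPart hy).of_le (by norm_cast)) ((isOpen_extChartAt_target a).mem_nhds ht)
  have h0 : (0 : ℝ) ∈ Ioo (-ε) ε := ⟨by linarith, hε⟩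
  refine ⟨fun s => Ring.inverse (U s) (secRep I a σ (c s)),
    hasDerivAt_inverse_fundamentalSolution hc0 hU0 (h 0 h0).2.2.1 (h 0 h0).2.2.2
      ((hσ.contDiffAt_secRep ht).differentiableAt (by simp)), ?_, ?_⟩
  · simp only [hc0, hU0, Ring.inverse_one]
    exact secRep_extChartAt ha
  filter_upwards [isOpen_Ioo.mem_nhds h0] with s hs
  have hγ : IsMIntegralCurveOn (I := I.prod 𝓘(ℝ, F))
      (fun t => (extChartAt (I.prod 𝓘(ℝ, F)) a).symm (c t)) Y (Ioo (-ε) ε) :=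
    isMIntegralCurveOn_extChartAt_symm isOpen_Ioo fun t ht => ⟨(h t ht).1, (h t ht).2.2.1⟩
  have e1 : flowMap (I.prod 𝓘(ℝ, F)) Y s a = (extChartAt (I.prod 𝓘(ℝ, F)) a).symm (c s) :=
    flowMap_eq hY.1 isOpen_Ioo ordConnected_Ioo hγ h0 hs
      (by simp only [hc0]; exact (extChartAt (I.prod 𝓘(ℝ, F)) a).left_inv ha)
  -- Chosen so that `U s f` is the coordinate of the section at `c s`: the integral curve `t ↦ (c t,
  -- U t f)` of `𝓕Y` then meets the section at time `s`.
  set f : F := Ring.inverse (U s) (secRep I a σ (c s))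
  have hβ : IsMIntegralCurveOn (I := (I.prod 𝓘(ℝ, F)).prod 𝓘(ℝ, F))
      (fun t => (extChartAt ((I.prod 𝓘(ℝ, F)).prod 𝓘(ℝ, F)) (⟨a, σ a⟩ : Pull I F V)).symm
        (c t, U t f)) (fibreDeriv I Y) (Ioo (-ε) ε) :=
    isMIntegralCurveOn_extChartAt_symm isOpen_Ioo fun t ht => by
      have hm : (c t, U t f) ∈ (extChartAt ((I.prod 𝓘(ℝ, F)).prod 𝓘(ℝ, F))
          (⟨a, σ a⟩ : Pull I F V)).target := mem_extChartAt_pull_target (h t ht).1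
      refine ⟨hm, ?_⟩
      rw [vfRep_fibreDeriv hY hm]
      exact (h t ht).2.2.1.prodMk
        (((ContinuousLinearMap.apply ℝ F f).hasFDerivAt).comp_hasDerivAt t (h t ht).2.2.2)
  -- Shifted to start on the section at time `0`, the curve at time `-s` is at `(c 0, f)`, over `a`.
  have hβs := hβ.comp_add s
  have hop : IsOpen {t : ℝ | t + s ∈ Ioo (-ε) ε} := isOpen_Ioo.preimage (by fun_prop)
  have hoc : OrdConnected {t : ℝ | t + s ∈ Ioo (-ε) ε} :=
    ordConnected_Ioo.preimage_mono fun x y hxy => by simpa using hxy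
  have hcs := (extChartAt (I.prod 𝓘(ℝ, F)) a).map_target (h s hs).1
  have hUs : U s f = secRep I a σ (c s) :=
    DFunLike.congr_fun (Ring.mul_inverse_cancel (U s) (h s hs).2.1) (secRep I a σ (c s))
  have e2 : (extChartAt ((I.prod 𝓘(ℝ, F)).prod 𝓘(ℝ, F)) (⟨a, σ a⟩ : Pull I F V)).symm
      (c s, U s f) = (⟨(extChartAt (I.prod 𝓘(ℝ, F)) a).symm (c s),
        σ ((extChartAt (I.prod 𝓘(ℝ, F)) a).symm (c s))⟩ : Pull I F V) := by
    have h1 := extChartAt_pull_apply (z₀ := (⟨a, σ a⟩ : Pull I F V))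
      (z := (⟨(extChartAt (I.prod 𝓘(ℝ, F)) a).symm (c s),
        σ ((extChartAt (I.prod 𝓘(ℝ, F)) a).symm (c s))⟩ : Pull I F V)) hcs
    have h2 : extChartAt ((I.prod 𝓘(ℝ, F)).prod 𝓘(ℝ, F)) (⟨a, σ a⟩ : Pull I F V)
      (⟨(extChartAt (I.prod 𝓘(ℝ, F)) a).symm (c s),
        σ ((extChartAt (I.prod 𝓘(ℝ, F)) a).symm (c s))⟩ : Pull I F V) = (c s, U s f) :=
      h1.trans (Prod.ext ((extChartAt (I.prod 𝓘(ℝ, F)) a).right_inv (h s hs).1) hUs.symm)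
    rw [← h2]
    exact (extChartAt ((I.prod 𝓘(ℝ, F)).prod 𝓘(ℝ, F)) (⟨a, σ a⟩ : Pull I F V)).left_inv
      (mem_extChartAt_pull_source.2 hcs)
  obtain ⟨v, hv, hv'⟩ := exists_pull_eq (I := I) (a := a) σ f
  refine ⟨v, ?_, hv⟩
  have e3 : flowMap ((I.prod 𝓘(ℝ, F)).prod 𝓘(ℝ, F)) (fibreDeriv I Y) (-s)
      (⟨(extChartAt (I.prod 𝓘(ℝ, F)) a).symm (c s),
        σ ((extChartAt (I.prod 𝓘(ℝ, F)) a).symm (c s))⟩ : Pull I F V) = ⟨a, v⟩ := by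
    rw [flowMap_eq (isSmoothVF_fibreDeriv hY) hop hoc hβs (by simpa using hs)
      (by simpa using h0) (by simpa using e2)]
    simp only [Function.comp_apply, neg_add_cancel, hc0, hU0]
    exact hv'
  unfold flowPullback
  rw [baseVF_fibreDeriv hY, e1]
  refine (congrArg (inFibre (F := F) (V := PullFibre I F V) a) e3).trans ?_
  exact inFibre_mk (F := F) (V := PullFibre I F V) v

end FlowQuotient


/-- Limits in a fibre must be unique for `limUnder` to compute the derivation. -/
theorem t2Space_fibre {N : Type*} [TopologicalSpace N]
    (F : Type*) [NormedAddCommGroup F] [NormedSpace ℝ F]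
    (V : N → Type*) [TopologicalSpace (TotalSpace F V)] [∀ x, AddCommMonoid (V x)]
    [∀ x, Module ℝ (V x)] [∀ x, TopologicalSpace (V x)] [FiberBundle F V]
    [VectorBundle ℝ F V] (x : N) : T2Space (V x) :=
  ((trivializationAt F V x).continuousLinearEquivAt ℝ x
    (mem_baseSet_trivializationAt F V x)).toHomeomorph.symm.t2Space

/-! ### The associated derivation as a Lie bracket -/

section AssocDerivation

variable {EN : Type*} [NormedAddCommGroup EN] [NormedSpace ℝ EN] [CompleteSpace EN]
  {HN : Type*} [TopologicalSpace HN] {I : ModelWithCorners ℝ EN HN} [I.Boundaryless]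
  {N : Type*} [TopologicalSpace N] [ChartedSpace HN N]
  {F : Type*} [NormedAddCommGroup F] [NormedSpace ℝ F] [CompleteSpace F]
  {V : N → Type*} [TopologicalSpace (TotalSpace F V)] [∀ x, AddCommMonoid (V x)]
  [∀ x, Module ℝ (V x)] [∀ x, TopologicalSpace (V x)] [FiberBundle F V]
  [VectorBundle ℝ F V]

variable [IsManifold I ∞ N] [ContMDiffVectorBundle ∞ F V I]
  {Y : ∀ a : TotalSpace F V, TangentSpace (I.prod 𝓘(ℝ, F)) a}
  {σ : ∀ a : TotalSpace F V, V a.proj}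

/-- A limit in a fibre can be computed in the fibre coordinate. -/
theorem tendsto_of_fibreCoord {ι : Type*} {l : Filter ι} {x : N} {u : ι → V x} {f : F}
    (h : Tendsto (fun i => fibreCoord x (⟨x, u i⟩ : TotalSpace F V)) l (𝓝 f)) :
    ∃ b : V x, fibreCoord x (⟨x, b⟩ : TotalSpace F V) = f ∧ Tendsto u l (𝓝 b) := by
  have hx := mem_baseSet_trivializationAt F V x
  let e := (trivializationAt F V x).continuousLinearEquivAt ℝ x hx
  have he : ∀ v : V x, e v = fibreCoord x (⟨x, v⟩ : TotalSpace F V) := fun v => rfl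
  refine ⟨e.symm f, (he _).symm.trans (e.apply_symm_apply f), ?_⟩
  have h1 := (e.symm.continuous.tendsto f).comp h
  refine h1.congr fun i => ?_
  exact e.symm_apply_apply (u i)

/-- The limit that defines the derivation associated with the fibre derivative exists. -/
theorem tendsto_flowQuotient [T2Space N] (hY : IsProjectable I Y) (hσ : IsSmoothAlong I σ)
    (a : TotalSpace F V) :
    Tendsto (flowQuotient (F := F) (V := PullFibre I F V) (I.prod 𝓘(ℝ, F)) (fibreDeriv I Y) σ a)
        (𝓝[≠] (0 : ℝ)) (𝓝 (derivationAlong I (fibreDeriv I Y) σ a)) ∧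
      fibreCoord a.proj
        (⟨a.proj, derivationAlong I (fibreDeriv I Y) σ a⟩ : TotalSpace F V) =
      fderiv ℝ (secRep I a σ) (extChartAt (I.prod 𝓘(ℝ, F)) a a)
          (vfRep (I.prod 𝓘(ℝ, F)) a Y (extChartAt (I.prod 𝓘(ℝ, F)) a a)) -
        verticalPart (vfRep (I.prod 𝓘(ℝ, F)) a Y) (extChartAt (I.prod 𝓘(ℝ, F)) a a)
          (secRep I a σ (extChartAt (I.prod 𝓘(ℝ, F)) a a)) := by
  have hx := mem_baseSet_trivializationAt F V a.proj
  obtain ⟨R, hR, hR0, h⟩ := exists_hasDerivAt_flowPullback hY hσ a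
  rw [hasDerivAt_iff_tendsto_slope] at hR
  let q : ℝ → V a.proj :=
    flowQuotient (F := F) (V := PullFibre I F V) (I.prod 𝓘(ℝ, F)) (fibreDeriv I Y) σ a
  -- By linearity of the fibre coordinate, the coordinate of the difference quotient is the slope of
  -- `R` at `0`.
  have h1 : Tendsto (fun s => fibreCoord a.proj (⟨a.proj, q s⟩ : TotalSpace F V)) (𝓝[≠] (0 : ℝ))
      (𝓝 (fderiv ℝ (secRep I a σ) (extChartAt (I.prod 𝓘(ℝ, F)) a a)
          (vfRep (I.prod 𝓘(ℝ, F)) a Y (extChartAt (I.prod 𝓘(ℝ, F)) a a)) -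
        verticalPart (vfRep (I.prod 𝓘(ℝ, F)) a Y) (extChartAt (I.prod 𝓘(ℝ, F)) a a)
          (secRep I a σ (extChartAt (I.prod 𝓘(ℝ, F)) a a)))) := by
    refine hR.congr' ?_
    filter_upwards [mem_nhdsWithin_of_mem_nhds h] with s hs
    obtain ⟨v, hv, hv'⟩ := hs
    have e : q s = s⁻¹ • (v + (-1 : ℝ) • σ a) :=
      congrArg (fun w : V a.proj => s⁻¹ • (w + (-1 : ℝ) • σ a)) hv
    rw [e, fibreCoord_smul hx, fibreCoord_add hx, fibreCoord_smul hx, hv', ← hR0, slope_def_module,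
      sub_zero, neg_one_smul, sub_eq_add_neg]
  obtain ⟨b, hb, hb'⟩ := tendsto_of_fibreCoord h1
  have hT : T2Space (V a.proj) := t2Space_fibre F V a.proj
  have e : derivationAlong I (fibreDeriv I Y) σ a = b := hb'.limUnder_eq
  rw [e]
  exact ⟨hb', hb⟩

theorem vfRep_vertLiftVF {a₀ : TotalSpace F V} {x : EN × F}
    (hx : x ∈ (extChartAt (I.prod 𝓘(ℝ, F)) a₀).target) :
    vfRep (I.prod 𝓘(ℝ, F)) a₀ (vertLiftVF I σ) x = ((0 : EN), secRep I a₀ σ x) :=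
  chartDeriv_vertLift ((extChartAt (I.prod 𝓘(ℝ, F)) a₀).map_target hx) _

theorem IsSmoothAlong.isSmoothVF_vertLiftVF (hσ : IsSmoothAlong I σ) :
    IsSmoothVF (I.prod 𝓘(ℝ, F)) (vertLiftVF I σ) := by
  refine isSmoothVF_of_chartDeriv fun a₀ => ⟨fun x => ((0 : EN), secRep I a₀ σ x),
    contDiffAt_const.prodMk (hσ.contDiffAt_secRep (mem_extChartAt_target a₀)), ?_⟩
  filter_upwards [(isOpen_extChartAt_source a₀).mem_nhds
    (mem_extChartAt_source (I := I.prod 𝓘(ℝ, F)) a₀)] with a ha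
  rw [secRep_extChartAt ha]
  exact chartDeriv_vertLift ha _

/-- This gives smoothness of the derived section from smoothness of a Lie bracket, with no need to
study the limit as the point varies. -/
theorem isSmoothAlong_of_isSmoothVF_vertLiftVF (h : IsSmoothVF (I.prod 𝓘(ℝ, F)) (vertLiftVF I σ)) :
    IsSmoothAlong I σ := fun a => by
  have ha := mem_extChartAt_source (I := I.prod 𝓘(ℝ, F)) a
  refine (contMDiffAt_total (I := I) (f := fun a : TotalSpace F V => (⟨a.proj, σ a⟩ : TotalSpace F V))
    (mem_extChartAt_total_source.1 ha).1).2 ⟨contMDiff_proj V a, ?_⟩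
  refine (contDiffAt_snd.contMDiffAt.comp a (h.contMDiffAt_chartDeriv ha)).congr_of_eventuallyEq ?_
  filter_upwards [(isOpen_extChartAt_source a).mem_nhds ha] with b hb
  exact (congrArg Prod.snd (chartDeriv_vertLift (I := I) hb (σ b))).symm

/-- The derivation associated with the fibre derivative is given by the Lie bracket with vertical
lifts. -/
theorem vertLiftVF_derivationAlong [T2Space N] (hY : IsProjectable I Y) (hσ : IsSmoothAlong I σ) :
    vertLiftVF I (derivationAlong I (fibreDeriv I Y) σ) =
      VectorField.mlieBracket (I.prod 𝓘(ℝ, F)) Y (vertLiftVF I σ) := by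
  funext a
  have ha := mem_extChartAt_source (I := I.prod 𝓘(ℝ, F)) a
  have ht := mem_extChartAt_target (I := I.prod 𝓘(ℝ, F)) a
  refine chartDeriv_injective ha ?_
  rw [← vfRep_extChartAt (VectorField.mlieBracket _ _ _) ha, vfRep_mlieBracket hY.1 hσ.isSmoothVF_vertLiftVF ht]
  refine (chartDeriv_vertLift ha _).trans ?_
  rw [(tendsto_flowQuotient hY hσ a).2]
  have e : vfRep (I.prod 𝓘(ℝ, F)) a (vertLiftVF I σ) =ᶠ[𝓝 (extChartAt (I.prod 𝓘(ℝ, F)) a a)]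
      fun x => ((0 : EN), secRep I a σ x) := by
    filter_upwards [(isOpen_extChartAt_target a).mem_nhds ht] with x hx
    exact vfRep_vertLiftVF hx
  have hS := ((hσ.contDiffAt_secRep ht).differentiableAt (by simp)).hasFDerivAt
  have hS' := ((hasFDerivAt_const (0 : EN) _).prodMk hS).fderiv
  unfold VectorField.lieBracket
  rw [e.fderiv_eq, e.self_of_nhds, hS']
  -- The fibre components agree by definition; the base component of the bracket vanishes since
  -- `Dy(0, S)` is vertical.
  refine Prod.ext ?_ rfl
  have h2 := fderiv_vfRep_vertical hY ht (secRep I a σ (extChartAt (I.prod 𝓘(ℝ, F)) a a))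
  rw [Prod.fst_sub, h2]
  simp

end AssocDerivation


/-! ### Derivation properties and the commutator formula -/

section DerivationProperties

variable {EN : Type*} [NormedAddCommGroup EN] [NormedSpace ℝ EN] [CompleteSpace EN]
  {HN : Type*} [TopologicalSpace HN] {I : ModelWithCorners ℝ EN HN} [I.Boundaryless]
  {N : Type*} [TopologicalSpace N] [ChartedSpace HN N] [T2Space N]
  {F : Type*} [NormedAddCommGroup F] [NormedSpace ℝ F] [CompleteSpace F]
  {V : N → Type*} [TopologicalSpace (TotalSpace F V)] [∀ x, AddCommMonoid (V x)]
  [∀ x, Module ℝ (V x)] [∀ x, TopologicalSpace (V x)] [FiberBundle F V]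
  [VectorBundle ℝ F V] [IsManifold I ∞ N] [ContMDiffVectorBundle ∞ F V I]
  {Y Y' : ∀ a : TotalSpace F V, TangentSpace (I.prod 𝓘(ℝ, F)) a}
  {σ σ' : ∀ a : TotalSpace F V, V a.proj}

theorem vertLift_add (a : TotalSpace F V) (b b' : V a.proj) :
    vertLift I a (b + b') = vertLift I a b + vertLift I a b' := by
  have ha := mem_extChartAt_source (I := I.prod 𝓘(ℝ, F)) a
  refine chartDeriv_injective ha ?_
  rw [map_add, chartDeriv_vertLift ha, chartDeriv_vertLift ha, chartDeriv_vertLift ha,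
    fibreCoord_add (mem_baseSet_trivializationAt F V a.proj)]
  exact Prod.ext (add_zero 0).symm rfl

theorem vertLift_smul (a : TotalSpace F V) (r : ℝ) (b : V a.proj) :
    vertLift I a (r • b) = r • vertLift I a b := by
  have ha := mem_extChartAt_source (I := I.prod 𝓘(ℝ, F)) a
  refine chartDeriv_injective ha ?_
  rw [map_smul, chartDeriv_vertLift ha, chartDeriv_vertLift ha,
    fibreCoord_smul (mem_baseSet_trivializationAt F V a.proj)]
  exact Prod.ext (smul_zero r).symm rfl

theorem IsSmoothAlong.derivationAlong (hY : IsProjectable I Y) (hσ : IsSmoothAlong I σ) :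
    IsSmoothAlong I (derivationAlong I (fibreDeriv I Y) σ) :=
  isSmoothAlong_of_isSmoothVF_vertLiftVF <| by
    rw [vertLiftVF_derivationAlong hY hσ]
    exact hY.1.mlieBracket hσ.isSmoothVF_vertLiftVF

theorem IsSmoothAlong.add (hσ : IsSmoothAlong I σ) (hσ' : IsSmoothAlong I σ') :
    IsSmoothAlong I (fun a => σ a + σ' a) := fun a => by
  have ha := mem_extChartAt_source (I := I.prod 𝓘(ℝ, F)) a
  have hb := (mem_extChartAt_total_source.1 ha).1
  have h := ((contMDiffAt_total (I := I)
    (f := fun a : TotalSpace F V => (⟨a.proj, σ a⟩ : TotalSpace F V)) hb).1 (hσ a)).2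
  have h' := ((contMDiffAt_total (I := I)
    (f := fun a : TotalSpace F V => (⟨a.proj, σ' a⟩ : TotalSpace F V)) hb).1 (hσ' a)).2
  refine (contMDiffAt_total (I := I)
    (f := fun a : TotalSpace F V => (⟨a.proj, σ a + σ' a⟩ : TotalSpace F V)) hb).2
    ⟨contMDiff_proj V a, (h.add h').congr_of_eventuallyEq ?_⟩
  filter_upwards [(isOpen_extChartAt_source a).mem_nhds ha] with b hb
  exact fibreCoord_add (mem_extChartAt_total_source.1 hb).1 _ _

theorem IsSmoothAlong.smul {f : TotalSpace F V → ℝ}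
    (hf : ContMDiff (I.prod 𝓘(ℝ, F)) 𝓘(ℝ, ℝ) ∞ f) (hσ : IsSmoothAlong I σ) :
    IsSmoothAlong I (fun a => f a • σ a) := fun a => by
  have ha := mem_extChartAt_source (I := I.prod 𝓘(ℝ, F)) a
  have hb := (mem_extChartAt_total_source.1 ha).1
  have h := ((contMDiffAt_total (I := I)
    (f := fun a : TotalSpace F V => (⟨a.proj, σ a⟩ : TotalSpace F V)) hb).1 (hσ a)).2
  refine (contMDiffAt_total (I := I)
    (f := fun a : TotalSpace F V => (⟨a.proj, f a • σ a⟩ : TotalSpace F V)) hb).2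
    ⟨contMDiff_proj V a, ((hf a).smul h).congr_of_eventuallyEq ?_⟩
  filter_upwards [(isOpen_extChartAt_source a).mem_nhds ha] with b hb
  exact fibreCoord_smul (mem_extChartAt_total_source.1 hb).1 _ _

/-- Since `vertLift` is injective and linear on fibres, identities for the derivation can be checked
as identities of brackets with vertical lifts. -/
theorem vertLift_derivationAlong (hY : IsProjectable I Y) (hσ : IsSmoothAlong I σ)
    (a : TotalSpace F V) :
    vertLift I a (derivationAlong I (fibreDeriv I Y) σ a) =
      VectorField.mlieBracket (I.prod 𝓘(ℝ, F)) Y (vertLiftVF I σ) a :=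
  congrFun (vertLiftVF_derivationAlong hY hσ) a

/-- The derivation associated with the fibre derivative of `Y` is a derivation with symbol `Y`. -/
theorem isDerivationAlong_fibreDeriv (hY : IsProjectable I Y) :
    IsDerivationAlong I (derivationAlong I (fibreDeriv I Y)) Y where
  smooth := fun _ hσ => hσ.derivationAlong hY
  map_add := fun σ σ' hσ hσ' a => vertLift_injective (I := I) a <| by
    have e : vertLiftVF I (fun a => σ a + σ' a) = vertLiftVF I σ + vertLiftVF I σ' :=
      funext fun a => vertLift_add a (σ a) (σ' a)
    rw [vertLift_add, vertLift_derivationAlong hY (hσ.add hσ'), vertLift_derivationAlong hY hσ,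
      vertLift_derivationAlong hY hσ', e]
    exact VectorField.mlieBracket_add_right (hσ.isSmoothVF_vertLiftVF.mdifferentiableAt a)
      (hσ'.isSmoothVF_vertLiftVF.mdifferentiableAt a)
  leibniz := fun f σ hf hσ a => vertLift_injective (I := I) a <| by
    have e : vertLiftVF I (fun a => f a • σ a) = f • vertLiftVF I σ :=
      funext fun a => vertLift_smul a (f a) (σ a)
    rw [vertLift_add, vertLift_smul, vertLift_smul, vertLift_derivationAlong hY (hσ.smul hf),
      vertLift_derivationAlong hY hσ, e]
    refine (VectorField.mlieBracket_smul_right ((hf a).mdifferentiableAt (by simp))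
      (hσ.isSmoothVF_vertLiftVF.mdifferentiableAt a)).trans ?_
    exact add_comm _ _

/-- The Jacobi identity for `Y`, `Y'` and `σ^V`. It is stated as a sum because the fibres are only
additive monoids here. -/
theorem derivationAlong_derivationAlong (hY : IsProjectable I Y) (hY' : IsProjectable I Y')
    (hσ : IsSmoothAlong I σ) (a : TotalSpace F V) :
    derivationAlong I (fibreDeriv I Y) (derivationAlong I (fibreDeriv I Y') σ) a =
      derivationAlong I (fibreDeriv I (VectorField.mlieBracket (I.prod 𝓘(ℝ, F)) Y Y')) σ a +
        derivationAlong I (fibreDeriv I Y') (derivationAlong I (fibreDeriv I Y) σ) a :=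
  vertLift_injective (I := I) a <| by
    have h3 : IsManifold (I.prod 𝓘(ℝ, F)) (minSmoothness ℝ 3) (TotalSpace F V) :=
      IsManifold.of_le (n := ∞) (by
        simp only [minSmoothness_of_isRCLikeNormedField]; norm_cast)
    have h2 : ∀ {Z : ∀ a : TotalSpace F V, TangentSpace (I.prod 𝓘(ℝ, F)) a},
        IsSmoothVF (I.prod 𝓘(ℝ, F)) Z → ContMDiffAt (I.prod 𝓘(ℝ, F)) (I.prod 𝓘(ℝ, F)).tangent
          (minSmoothness ℝ 2)
          (fun a => (⟨a, Z a⟩ : TangentBundle (I.prod 𝓘(ℝ, F)) (TotalSpace F V))) a := fun hZ =>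
      (hZ a).of_le (by simp only [minSmoothness_of_isRCLikeNormedField]; norm_cast)
    rw [vertLift_add, vertLift_derivationAlong hY (hσ.derivationAlong hY'),
      vertLift_derivationAlong hY' (hσ.derivationAlong hY),
      vertLift_derivationAlong (hY.mlieBracket hY') hσ, vertLiftVF_derivationAlong hY hσ,
      vertLiftVF_derivationAlong hY' hσ]
    exact VectorField.leibniz_identity_mlieBracket_apply (h2 hY.1) (h2 hY'.1)
      (h2 hσ.isSmoothVF_vertLiftVF)

end DerivationProperties

end FibreDerivative

/-! ### The proposition -/

theorem proposition6p1
    {B : Type*} [NormedAddCommGroup B] [NormedSpace ℝ B] [CompleteSpace B]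
    {F : Type*} [NormedAddCommGroup F] [NormedSpace ℝ F] [CompleteSpace F]
    {M : Type*} [TopologicalSpace M] [T2Space M] [ChartedSpace B M] [IsManifold 𝓘(ℝ, B) ∞ M]
    (V : M → Type*) [TopologicalSpace (TotalSpace F V)] [∀ x, AddCommGroup (V x)]
    [∀ x, Module ℝ (V x)] [∀ x, TopologicalSpace (V x)] [FiberBundle F V] [VectorBundle ℝ F V]
    [ContMDiffVectorBundle ∞ F V 𝓘(ℝ, B)]
    (Y : ∀ a : TotalSpace F V, TangentSpace (𝓘(ℝ, B).prod 𝓘(ℝ, F)) a)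
    (hY : IsProjectable 𝓘(ℝ, B) Y) :
    -- `𝓕Y` is well defined by its defining equation and is a linear vector field over `Y`
    ((∀ z, IsFibreDerivAt 𝓘(ℝ, B) Y z (fibreDeriv 𝓘(ℝ, B) Y z) ∧
        ∀ ζ, IsFibreDerivAt 𝓘(ℝ, B) Y z ζ → ζ = fibreDeriv 𝓘(ℝ, B) Y z) ∧
      IsLinearVF (F := F) (V := PullFibre 𝓘(ℝ, B) F V) (𝓘(ℝ, B).prod 𝓘(ℝ, F))
        (fibreDeriv 𝓘(ℝ, B) Y) Y) ∧
    -- if `φ_s` is the local flow of `Y`, then `𝓕φ_s` is the local flow of `𝓕Y`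
    (∀ (D : Set (ℝ × TotalSpace F V)) (φ : ℝ → TotalSpace F V → TotalSpace F V),
      IsLocalFlow (𝓘(ℝ, B).prod 𝓘(ℝ, F)) Y D φ →
      (∀ (s : ℝ) (z : Pull 𝓘(ℝ, B) F V), (s, pr₁ 𝓘(ℝ, B) z) ∈ D →
        vertLift 𝓘(ℝ, B) (φ s (pr₁ 𝓘(ℝ, B) z))
            (sndVec 𝓘(ℝ, B) (fibreDerivMap 𝓘(ℝ, B) (φ s) z)) =
          mfderiv (𝓘(ℝ, B).prod 𝓘(ℝ, F)) (𝓘(ℝ, B).prod 𝓘(ℝ, F)) (φ s) (pr₁ 𝓘(ℝ, B) z)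
            (vertLift 𝓘(ℝ, B) (pr₁ 𝓘(ℝ, B) z) (sndVec 𝓘(ℝ, B) z))) ∧
      IsLocalFlow ((𝓘(ℝ, B).prod 𝓘(ℝ, F)).prod 𝓘(ℝ, F)) (fibreDeriv 𝓘(ℝ, B) Y)
        {q | (q.1, pr₁ 𝓘(ℝ, B) q.2) ∈ D} (fun s => fibreDerivMap 𝓘(ℝ, B) (φ s))) ∧
    (∀ (D : Set (ℝ × TotalSpace F V)) (φ : ℝ → TotalSpace F V → TotalSpace F V),
      IsMaximalLocalFlow (𝓘(ℝ, B).prod 𝓘(ℝ, F)) Y D φ →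
      IsMaximalLocalFlow ((𝓘(ℝ, B).prod 𝓘(ℝ, F)).prod 𝓘(ℝ, F)) (fibreDeriv 𝓘(ℝ, B) Y)
        {q | (q.1, pr₁ 𝓘(ℝ, B) q.2) ∈ D} (fun s => fibreDerivMap 𝓘(ℝ, B) (φ s))) ∧
    -- the limit defining the derivation `𝒟^Y` associated with `𝓕Y` exists, `[Y, σ^V]` is
    -- vertical, `𝒟^Y σ = ν([Y, σ^V])`, and `𝒟^Y` is a derivation of sections along the projection
    (∀ σ : ∀ a : TotalSpace F V, V a.proj, IsSmoothAlong 𝓘(ℝ, B) σ → ∀ a,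
      Tendsto
        (flowQuotient (F := F) (V := PullFibre 𝓘(ℝ, B) F V) (𝓘(ℝ, B).prod 𝓘(ℝ, F))
          (fibreDeriv 𝓘(ℝ, B) Y) σ a)
        (𝓝[≠] (0 : ℝ)) (𝓝 (derivationAlong 𝓘(ℝ, B) (fibreDeriv 𝓘(ℝ, B) Y) σ a)) ∧
      mfderiv (𝓘(ℝ, B).prod 𝓘(ℝ, F)) 𝓘(ℝ, B) (π F V) a
        (VectorField.mlieBracket (𝓘(ℝ, B).prod 𝓘(ℝ, F)) Y (vertLiftVF 𝓘(ℝ, B) σ) a) = 0 ∧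
      derivationAlong 𝓘(ℝ, B) (fibreDeriv 𝓘(ℝ, B) Y) σ a =
        vertProj 𝓘(ℝ, B) a
          (VectorField.mlieBracket (𝓘(ℝ, B).prod 𝓘(ℝ, F)) Y (vertLiftVF 𝓘(ℝ, B) σ) a)) ∧
    IsDerivationAlong 𝓘(ℝ, B) (derivationAlong 𝓘(ℝ, B) (fibreDeriv 𝓘(ℝ, B) Y)) Y ∧
    (∀ Y' : ∀ a : TotalSpace F V, TangentSpace (𝓘(ℝ, B).prod 𝓘(ℝ, F)) a,
      IsProjectable 𝓘(ℝ, B) Y' →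
      IsProjectable 𝓘(ℝ, B) (VectorField.mlieBracket (𝓘(ℝ, B).prod 𝓘(ℝ, F)) Y Y') ∧
      -- `[𝓕Y, 𝓕Y'] = 𝓕[Y, Y']`
      VectorField.mlieBracket ((𝓘(ℝ, B).prod 𝓘(ℝ, F)).prod 𝓘(ℝ, F))
          (fibreDeriv 𝓘(ℝ, B) Y) (fibreDeriv 𝓘(ℝ, B) Y') =
        fibreDeriv 𝓘(ℝ, B) (VectorField.mlieBracket (𝓘(ℝ, B).prod 𝓘(ℝ, F)) Y Y') ∧
      -- `[𝒟^Y, 𝒟^Y'] = 𝒟^[Y, Y']` on smooth sections along the projection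
      ∀ σ : ∀ a : TotalSpace F V, V a.proj, IsSmoothAlong 𝓘(ℝ, B) σ → ∀ a,
        derivationAlong 𝓘(ℝ, B) (fibreDeriv 𝓘(ℝ, B) Y)
            (derivationAlong 𝓘(ℝ, B) (fibreDeriv 𝓘(ℝ, B) Y') σ) a -
          derivationAlong 𝓘(ℝ, B) (fibreDeriv 𝓘(ℝ, B) Y')
            (derivationAlong 𝓘(ℝ, B) (fibreDeriv 𝓘(ℝ, B) Y) σ) a =
        derivationAlong 𝓘(ℝ, B)
          (fibreDeriv 𝓘(ℝ, B) (VectorField.mlieBracket (𝓘(ℝ, B).prod 𝓘(ℝ, F)) Y Y')) σ a) := by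
  exact ⟨⟨fun z => ⟨isFibreDerivAt_fibreDeriv hY z, fun _ h =>
      isFibreDerivAt_unique hY h (isFibreDerivAt_fibreDeriv hY z)⟩, isLinearVF_fibreDeriv hY⟩,
    fun _ _ hφ => ⟨fun _ _ h => hφ.vertLift_fibreDerivMap hY h, hφ.fibreDerivMap hY⟩,
    fun _ _ hφ => hφ.fibreDerivMap hY,
    fun σ hσ a => ⟨(tendsto_flowQuotient hY hσ a).1,
      exists_vertLift_eq_iff.1 ⟨_, vertLift_derivationAlong hY hσ a⟩,
      by rw [← vertLift_derivationAlong hY hσ a, vertProj_vertLift]⟩,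
    isDerivationAlong_fibreDeriv hY,
    fun Y' hY' => ⟨hY.mlieBracket hY', mlieBracket_fibreDeriv hY hY', fun σ hσ a =>
      sub_eq_of_eq_add (derivationAlong_derivationAlong hY hY' hσ a)⟩⟩
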